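/- All graphs are finite and simple. For a graph $G$ and $T\subseteq V(G)$ let $c_G(T)$ be the number of connected components of $G\setminus T$; $T$ is a \emph{cutset} if $c_G(T\setminus\{v\})<c_G(T)$ for every $v\in T$, and $v$ is a \emph{cutpoint} if $\{v\}$ is a cutset. A \emph{block} of $G$ is a connected induced subgraph without cutpoints of its own that is maximal with this property. Let $K$ be a field and let $J_G\subseteq K[x_v,y_v : v\in V(G)]$ be the binomial edge ideal, generated by the $x_uy_v-x_vy_u$ for $\{u,v\}\in E(G)$. The graph $G$ is \emph{accessible} if $J_G$ is unmixed (all its associated primes have the same height) and every non-empty cutset $T$ contains some $t$ such that $T\setminus\{t\}$ is a cutset. If $G$ is connected, $J_G$ is unmixed and $B$ is a block of $G$, then $\overline{B}$ denotes the graph obtained from $B$ by attaching one whisker (a new vertex of degree 1) to each vertex of $B$ that is a cutpoint of $G$. Let (D) be the class of blocks $B$ of cycle rank $|E(B)|-|V(B)|+1=3$ that are subdivisions of $K_4$: exactly four vertices of $B$ have degree at least 3, these have degree 3, and $B$ consists of lines joining any two of them (paths with no interior vertex of degree at least $3$). Let $\mathcal{K}_4$ be the family consisting, up to isomorphism, of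 the graphs of the following four types: (1) the complete graph $K_4$ with or without whiskers, that is, with at most one whisker attached to each vertex, on an arbitrary (possibly empty) set of vertices; (2) the graph obtained from $K_4$ on $a,b,c,d$ by replacing the edge $ab$ by a path $a,e,b$ and the edge $cd$ by a path $c,f,d$, with one whisker on each of $a$ and $c$; (3) the graph obtained from $K_4$ on $a,b,c,d$ by replacing the edge $ab$ by a path $a,e,b$, with one whisker on each of $a$, $c$, $d$; (4) the same subdivision as in (3), with one whisker on each of $a$, $c$, $e$. Then a graph is accessible and isomorphic to $\overline{B}$ for some block $B$ in the class (D) if and only if it belongs to $\mathcal{K}_4$. -/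

import Mathlib

namespace WhiskeredBlocks

noncomputable section

/-! ### Cutsets, blocks, cycle rank -/

/-- `c_G(T)`: the number of connected components of `G \ T`, the subgraph of `G` induced on the
complement of `T`. -/
def numComponents {V : Type*} (G : SimpleGraph V) (T : Set V) : ℕ :=
  Nat.card (G.induce Tᶜ).ConnectedComponent

/-- `T` is a cutset of `G`: `c_G(T \ {v}) < c_G(T)` for each `v ∈ T` (so `∅` is a cutset). -/
def IsCutset {V : Type*} (G : SimpleGraph V) (T : Set V) : Prop :=
  ∀ v ∈ T, numComponents G (T \ {v}) < numComponents G T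

/-- `v` is a cutpoint of `G`. -/
def IsCutpoint {V : Type*} (G : SimpleGraph V) (v : V) : Prop :=
  IsCutset G {v}

/-- The subgraph induced on `B` is a block of `G`: it is a connected induced subgraph without
cutpoints of its own, and `B` is maximal with respect to this property. -/
def IsBlock {V : Type*} (G : SimpleGraph V) (B : Set V) : Prop :=
  Maximal (fun s : Set V => (G.induce s).Connected ∧ ∀ v : s, ¬ IsCutpoint (G.induce s) v) B

/-- The cycle rank `m(G) = |E(G)| - |V(G)| + 1` of a connected finite graph. -/
def cycleRank {V : Type*} (G : SimpleGraph V) : ℤ :=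
  (Nat.card G.edgeSet : ℤ) - Nat.card V + 1

/-! ### Binomial edge ideals and accessible graphs -/

/-- The polynomial ring `K[x_v, y_v : v ∈ V]`; `x_v` is `X (Sum.inl v)` and `y_v` is
`X (Sum.inr v)`. -/
abbrev EdgeRing (K V : Type*) [Field K] : Type _ := MvPolynomial (V ⊕ V) K

/-- The binomial edge ideal `J_G`, generated by `x_u y_v - x_v y_u` for the edges `{u, v}` of `G`
(exchanging `u` and `v` only changes the sign of the generator). -/
def binomialEdgeIdeal (K : Type*) [Field K] {V : Type*} (G : SimpleGraph V) :
    Ideal (EdgeRing K V) :=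
  Ideal.span {f | ∃ u v : V, G.Adj u v ∧
    f = MvPolynomial.X (Sum.inl u) * MvPolynomial.X (Sum.inr v)
      - MvPolynomial.X (Sum.inl v) * MvPolynomial.X (Sum.inr u)}

/-- An ideal `I` of `R` is unmixed if all associated primes of `R / I` have the same height. -/
def IsUnmixed {R : Type*} [CommRing R] (I : Ideal R) : Prop :=
  ∀ P ∈ associatedPrimes R (R ⧸ I), ∀ Q ∈ associatedPrimes R (R ⧸ I), P.height = Q.height

/-- `G` is accessible (over the field `K`): `J_G` is unmixed, and every non-empty cutset `T` of `G`
contains some `t` such that `T \ {t}` is again a cutset. -/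
def IsAccessible (K : Type*) [Field K] {V : Type*} (G : SimpleGraph V) : Prop :=
  IsUnmixed (binomialEdgeIdeal K G) ∧
    ∀ T : Set V, IsCutset G T → T.Nonempty → ∃ t ∈ T, IsCutset G (T \ {t})

/-! ### Blocks with whiskers -/

/-- The graph obtained from `B` by attaching one new pendant vertex (`Sum.inr w`, a whisker) to each
vertex `w ∈ W`. -/
def addWhiskers {β : Type*} (B : SimpleGraph β) (W : Set β) : SimpleGraph (β ⊕ W) where
  Adj
    | Sum.inl a, Sum.inl b => B.Adj a b
    | Sum.inl a, Sum.inr w => a = w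
    | Sum.inr w, Sum.inl a => a = w
    | Sum.inr _, Sum.inr _ => False
  symm := ⟨by
    rintro (a | w) (b | w') h
    · exact B.adj_symm h
    · exact h
    · exact h
    · exact h⟩
  loopless := ⟨by
    rintro (a | w) h
    · exact B.loopless.irrefl a h
    · exact h⟩

/-- The block with whiskers of a block `B` of `G`: one whisker is attached to the subgraph induced
on `B` at each vertex of `B` that is a cutpoint of `G`. -/
def blockWithWhiskers {V : Type*} (G : SimpleGraph V) (B : Set V) :
    SimpleGraph (B ⊕ {w : B | IsCutpoint G (w : V)}) :=
  addWhiskers (G.induce B) {w : B | IsCutpoint G (w : V)}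

/-! ### Blocks of cycle rank 3 that are subdivisions of `K₄` -/

/-- The degree of `v` in `B`. -/
def deg {β : Type*} (B : SimpleGraph β) (v : β) : ℕ := (B.neighborSet v).ncard

/-- A vertex is pivotal if it has degree at least 3. -/
def IsPivotal {β : Type*} (B : SimpleGraph β) (v : β) : Prop := 3 ≤ deg B v

/-- A line is a path joining two pivotal vertices, with no pivotal vertex in its interior. -/
def IsLine {β : Type*} (B : SimpleGraph β) {a b : β} (L : B.Walk a b) : Prop :=
  L.IsPath ∧ IsPivotal B a ∧ IsPivotal B b ∧
    ∀ v ∈ L.support, v ≠ a → v ≠ b → ¬ IsPivotal B v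

/-- The blocks of cycle rank 3 that are subdivisions of `K₄`: there are exactly four pivotal
vertices, all of degree 3, any two of them are joined by a line, and `B` consists of these lines. -/
structure IsSubdividedK4Block {β : Type*} (B : SimpleGraph β) : Prop where
  connected : B.Connected
  noCutpoint : ∀ v, ¬ IsCutpoint B v
  cycleRank_eq : cycleRank B = 3
  lines : ∃ p : Fin 4 → β, Function.Injective p ∧ (∀ v, IsPivotal B v ↔ v ∈ Set.range p) ∧
    (∀ i, deg B (p i) = 3) ∧
    (∀ i j, i ≠ j → ∃ L : B.Walk (p i) (p j), IsLine B L) ∧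
    ∀ e ∈ B.edgeSet, ∃ i j, i ≠ j ∧ ∃ L : B.Walk (p i) (p j), IsLine B L ∧ e ∈ L.edges

/-! ### The family `𝒦₄`

The vertices `a, b, c, d, e, f` are numbered `0, 1, 2, 3, 4, 5`. -/

/-- `K₄` on `a, b, c, d` with the edge `ab` replaced by the line `a, e, b`. -/
def K4Sub1 : SimpleGraph (Fin 5) :=
  SimpleGraph.fromEdgeSet
    {s(0, 4), s(4, 1), s(0, 2), s(0, 3), s(1, 2), s(1, 3), s(2, 3)}

/-- `K₄` on `a, b, c, d` with the edge `ab` replaced by the line `a, e, b` and the edge `cd`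
replaced by the line `c, f, d`. -/
def K4Sub2 : SimpleGraph (Fin 6) :=
  SimpleGraph.fromEdgeSet
    {s(0, 4), s(4, 1), s(0, 2), s(0, 3), s(1, 2), s(1, 3), s(2, 5), s(5, 3)}

/-- `H` is (up to isomorphism) a member of the family `𝒦₄`:
(1) `K₄` with or without whiskers;
(2) `K4Sub2` with whiskers on `a` and `c`;
(3) `K4Sub1` with whiskers on `a`, `c` and `d`;
(4) `K4Sub1` with whiskers on `a`, `c` and `e`. -/
def InFamilyK4 {V : Type*} (H : SimpleGraph V) : Prop :=
  (∃ W : Set (Fin 4), Nonempty (H ≃g addWhiskers (⊤ : SimpleGraph (Fin 4)) W)) ∨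
  Nonempty (H ≃g addWhiskers K4Sub2 {0, 2}) ∨
  Nonempty (H ≃g addWhiskers K4Sub1 {0, 2, 3}) ∨
  Nonempty (H ≃g addWhiskers K4Sub1 {0, 2, 4})

end

end WhiskeredBlocks

/-! The proof turns unmixedness into a count of components and then reduces the classification to
finitely many small graphs.

Algebra. For a set `T` of vertices let P_T be the kernel of the map that kills the variables over
`T` and sends x_v, y_v to τ_v a_l, τ_v b_l when v lies in the component l of G \ T. Every P_T
contains J_G, and every prime over J_G contains some P_T (`labelPrime_le_of_binomialEdgeIdeal_le`).
Modulo J_G each polynomial reduces to standard monomials, and no nonzero combination of these lies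
in all P_T; so J_G is the intersection of the P_T (`binomialEdgeIdeal_eq_iInf`). Hence J_G is
radical, its associated primes are its minimal primes, and these are the P_T with `T` a cutset.
Chains of such primes give height P_T = |T| + |V| - c(T) (`labelPrime_height`), so J_G is unmixed
exactly when c(T) = |T| + c(∅) for all cutsets (`isUnmixed_binomialEdgeIdeal_iff`).

Combinatorics. A block of class (D) is determined by the lengths of its six lines (`IsK4Lines.iso`),
and a whisker at v contributes one component exactly when v is removed. Component counts do not
change when connected pieces disjoint from the removed set are contracted, so lines of arbitrary
length can be tested on codes with at most three edges per line. Finite checks then show that two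
lines with a common end are never both subdivided (`not_subdivided_adjacent`) and that no line has
three or more edges (`length_le_two`). What remains is K₄ itself, one subdivided edge, or two
opposite subdivided edges; checking all sets of whiskers on these leaves the listed family
(`IsK4Lines.inFamilyK4`).

For the converse, accessibility of each member is checked over all subsets of the block, and the
member serves as its own ambient graph (`exists_blockWithWhiskers`). -/

namespace WhiskeredBlocks

open MvPolynomial

/-! ### Reduction to standard monomials modulo J_G. -/

section BinomialEdgeIdeals

variable {K : Type*} [Field K] {V : Type*}

/-- The `2`-minor `x_u y_v - x_v y_u`. -/
noncomputable def minor (K : Type*) [Field K] {V : Type*} (u v : V) : EdgeRing K V :=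
  X (Sum.inl u) * X (Sum.inr v) - X (Sum.inl v) * X (Sum.inr u)

lemma minor_self (u : V) : minor K u u = 0 := by simp [minor]

lemma minor_mem_of_adj {G : SimpleGraph V} {u v : V} (h : G.Adj u v) :
    minor K u v ∈ binomialEdgeIdeal K G :=
  Ideal.subset_span ⟨u, v, h, rfl⟩

/-- The identity x_k[i,j] = x_i[k,j] + x_j[i,k] (and its analogue with y_k in front) trades a
variable over the next vertex k for one over i. The shortened walk then starts at k, and a later
return to i is covered by the variable just gained. -/
lemma monomial_mul_minor_mem {G : SimpleGraph V} {i j : V} (w : G.Walk i j) :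
    ∀ q : V ⊕ V →₀ ℕ,
      (∀ k ∈ w.support, k = i ∨ k = j ∨ q (Sum.inl k) ≠ 0 ∨ q (Sum.inr k) ≠ 0) →
      monomial q (1 : K) * minor K i j ∈ binomialEdgeIdeal K G := by
  classical
  induction w with
  | nil => intro q _; simp [minor_self]
  | @cons i k j h p ih =>
    intro q hq
    by_cases hkj : k = j
    · subst hkj
      exact Ideal.mul_mem_left _ _ (minor_mem_of_adj h)
    by_cases hki : k = i
    · exact absurd hki h.ne'
    have hk : q (Sum.inl k) ≠ 0 ∨ q (Sum.inr k) ≠ 0 := by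
      have := hq k (by simp)
      tauto
    -- Here `s` selects which of the two variables over k divides the monomial, so that both cases
    -- share one argument.
    have key : ∀ s : V → V ⊕ V, (s = Sum.inl ∨ s = Sum.inr) → q (s k) ≠ 0 →
        (X (s k) * minor K i j = X (s i) * minor K k j + X (s j) * minor K i k) →
        monomial q (1 : K) * minor K i j ∈ binomialEdgeIdeal K G := by
      intro s hs hqk hid
      obtain ⟨q', rfl⟩ : ∃ q', q = q' + Finsupp.single (s k) 1 :=
        ⟨q - Finsupp.single (s k) 1, (tsub_add_cancel_of_le (by
          rw [Finsupp.single_le_iff]; exact Nat.one_le_iff_ne_zero.mpr hqk)).symm⟩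
      have e1 : monomial (q' + Finsupp.single (s k) 1) (1 : K) = monomial q' 1 * X (s k) := by
        rw [X, monomial_mul, mul_one]
      have e2 : monomial (q' + Finsupp.single (s i) 1) (1 : K) = monomial q' 1 * X (s i) := by
        rw [X, monomial_mul, mul_one]
      rw [e1, mul_assoc, hid, mul_add, ← mul_assoc, ← mul_assoc, ← e2]
      refine add_mem (ih _ fun l hl => ?_) (Ideal.mul_mem_left _ _ (minor_mem_of_adj h))
      by_cases hlk : l = k
      · exact Or.inl hlk
      by_cases hlj : l = j
      · exact Or.inr (Or.inl hlj)
      refine Or.inr (Or.inr ?_)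
      by_cases hli : l = i
      · subst hli
        rcases hs with rfl | rfl
        · left; simp
        · right; simp
      have hl' := ((hq l (by simp [hl])).resolve_left hli).resolve_left hlj
      have hsk : ∀ t : V → V ⊕ V, (t = Sum.inl ∨ t = Sum.inr) → s k ≠ t l := by
        rintro t (rfl | rfl) h' <;> rcases hs with rfl | rfl <;> simp at h' <;>
          exact hlk h'.symm
      have h1 := hsk Sum.inl (Or.inl rfl)
      have h2 := hsk Sum.inr (Or.inr rfl)
      simp only [Finsupp.coe_add, Pi.add_apply, Finsupp.single_apply, h1, h2, if_false,
        add_zero] at hl'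
      simp only [Finsupp.coe_add, Pi.add_apply]
      omega
    rcases hk with hk | hk
    · exact key Sum.inl (Or.inl rfl) hk (by simp only [minor]; ring)
    · exact key Sum.inr (Or.inr rfl) hk (by simp only [minor]; ring)

/-! ### Standard monomials -/

/-- The vertices whose variables occur in a monomial. -/
def vertexSupport (m : V ⊕ V →₀ ℕ) : Set V := {v | m (Sum.inl v) ≠ 0 ∨ m (Sum.inr v) ≠ 0}

/-- A monomial is standard if it is not divisible by `x_i y_j` with `i < j` connected in the
graph induced on its vertex support. -/
def IsStandard (G : SimpleGraph V) (idx : V → ℕ) (m : V ⊕ V →₀ ℕ) : Prop :=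
  ∀ i j (hi : i ∈ vertexSupport m) (hj : j ∈ vertexSupport m), m (Sum.inl i) ≠ 0 →
    m (Sum.inr j) ≠ 0 → idx i < idx j →
    ¬ (G.induce (vertexSupport m)).Reachable ⟨i, hi⟩ ⟨j, hj⟩

/-- The weight of a monomial. -/
def weight [Fintype V] (idx : V → ℕ) (m : V ⊕ V →₀ ℕ) : ℕ := ∑ v, idx v * m (Sum.inr v)

lemma weight_add [Fintype V] (idx : V → ℕ) (m m' : V ⊕ V →₀ ℕ) :
    weight idx (m + m') = weight idx m + weight idx m' := by
  simp [weight, mul_add, Finset.sum_add_distrib]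

lemma weight_single_inl [Fintype V] (idx : V → ℕ) (v : V) :
    weight idx (Finsupp.single (Sum.inl v) 1) = 0 := by
  simp [weight]

lemma weight_single_inr [Fintype V] (idx : V → ℕ) (v : V) :
    weight idx (Finsupp.single (Sum.inr v) 1) = idx v := by
  classical
  rw [weight, Finset.sum_eq_single v]
  · simp
  · intro b _ hb
    rw [Finsupp.single_apply, if_neg, mul_zero]
    simpa using hb.symm
  · simp

/-- A failure of standardness supplies x_i y_j with `idx i < idx j` and a walk inside the vertex
support. Replacing it by x_j y_i changes the monomial by an element of J_G and lowers the weight, so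
the rewriting terminates. -/
lemma exists_standard_monomial [Fintype V] (G : SimpleGraph V) (idx : V → ℕ) (n : ℕ) :
    ∀ m : V ⊕ V →₀ ℕ, weight idx m = n → ∃ m', IsStandard G idx m' ∧ weight idx m' ≤ n ∧
      monomial m (1 : K) - monomial m' 1 ∈ binomialEdgeIdeal K G := by
  classical
  induction n using Nat.strong_induction_on with
  | _ n ih =>
    intro m hm
    by_cases hs : IsStandard G idx m
    · exact ⟨m, hs, hm.le, by simp⟩
    simp only [IsStandard] at hs
    push Not at hs
    obtain ⟨i, j, hi, hj, hxi, hyj, hij, ⟨w⟩⟩ := hs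
    obtain ⟨q, rfl⟩ : ∃ q, m = q + Finsupp.single (Sum.inl i) 1 + Finsupp.single (Sum.inr j) 1 := by
      refine ⟨m - Finsupp.single (Sum.inl i) 1 - Finsupp.single (Sum.inr j) 1, ?_⟩
      ext a
      simp only [Finsupp.coe_add, Finsupp.coe_tsub, Pi.add_apply, Pi.sub_apply,
        Finsupp.single_apply]
      rcases a with a | a
      · by_cases h : i = a
        · subst h; simp; omega
        · simp [h]
      · by_cases h : j = a
        · subst h; simp; omega
        · simp [h]
    set m' := q + Finsupp.single (Sum.inl j) 1 + Finsupp.single (Sum.inr i) 1 with hm'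
    have hdiff : monomial (q + Finsupp.single (Sum.inl i) 1 + Finsupp.single (Sum.inr j) 1) (1 : K)
        - monomial m' 1 ∈ binomialEdgeIdeal K G := by
      have e : monomial (q + Finsupp.single (Sum.inl i) 1 + Finsupp.single (Sum.inr j) 1) (1 : K)
        - monomial m' 1 = monomial q 1 * minor K i j := by
        simp only [hm', minor, X, mul_sub, monomial_mul, mul_one, add_assoc]
      rw [e]
      refine monomial_mul_minor_mem (w.map (SimpleGraph.Embedding.induce _).toHom) q ?_
      intro k hk
      rw [SimpleGraph.Walk.support_map, List.mem_map] at hk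
      obtain ⟨⟨k', hk'⟩, -, rfl⟩ := hk
      by_cases h1 : k' = i
      · exact Or.inl h1
      by_cases h2 : k' = j
      · exact Or.inr (Or.inl h2)
      refine Or.inr (Or.inr ?_)
      have h1' : ¬ i = k' := fun h => h1 h.symm
      have h2' : ¬ j = k' := fun h => h2 h.symm
      change q (Sum.inl k') ≠ 0 ∨ q (Sum.inr k') ≠ 0
      simpa [vertexSupport, Finsupp.single_apply, h1', h2'] using hk'
    have hw : weight idx m' < n := by
      rw [← hm, hm']
      simp only [weight_add, weight_single_inl, weight_single_inr]
      omega
    obtain ⟨m'', h1, h2, h3⟩ := ih _ hw m' rfl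
    exact ⟨m'', h1, h2.trans hw.le, by simpa using add_mem hdiff h3⟩

lemma exists_standard_representative [Fintype V] (G : SimpleGraph V) (idx : V → ℕ)
    (f : EdgeRing K V) :
    ∃ f', f - f' ∈ binomialEdgeIdeal K G ∧ ∀ m ∈ f'.support, IsStandard G idx m := by
  classical
  induction f using MvPolynomial.induction_on' with
  | monomial m a =>
    obtain ⟨m', h1, -, h2⟩ := exists_standard_monomial (K := K) G idx _ m rfl
    refine ⟨monomial m' a, ?_, fun q hq => ?_⟩
    · have := Ideal.mul_mem_left _ (C a) h2
      rwa [mul_sub, C_mul_monomial, C_mul_monomial, mul_one] at this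
    · have := support_monomial_subset hq
      rw [Finset.mem_singleton] at this
      exact this ▸ h1
  | add f g hf hg =>
    obtain ⟨f', hf1, hf2⟩ := hf
    obtain ⟨g', hg1, hg2⟩ := hg
    refine ⟨f' + g', ?_, fun q hq => ?_⟩
    · rw [add_sub_add_comm]
      exact add_mem hf1 hg1
    · rcases Finset.mem_union.mp (support_add hq) with h | h
      · exact hf2 q h
      · exact hg2 q h

end BinomialEdgeIdeals
end WhiskeredBlocks

namespace WhiskeredBlocks

open MvPolynomial

/-! ### The primes attached to a vertex labelling, and their heights. -/

section BinomialEdgeIdeals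

variable {K : Type*} [Field K] {V : Type*}

/-- The polynomial ring in variables `τ_v`, `a_l`, `b_l`. -/
abbrev ParamRing (K V : Type*) [Field K] : Type _ := MvPolynomial (V ⊕ V ⊕ V) K

open Classical in
/-- The parametrization `x_v ↦ τ_v a_{c v}`, `y_v ↦ τ_v b_{c v}`, and `0` for `v ∈ T`. -/
noncomputable def paramHom (K : Type*) [Field K] {V : Type*} (T : Set V) (c : V → V) :
    EdgeRing K V →ₐ[K] ParamRing K V :=
  aeval (Sum.elim
    (fun v => if v ∈ T then 0 else X (Sum.inl v) * X (Sum.inr (Sum.inl (c v))))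
    (fun v => if v ∈ T then 0 else X (Sum.inl v) * X (Sum.inr (Sum.inr (c v)))))

/-- The kernel of the parametrization. -/
noncomputable def labelPrime (K : Type*) [Field K] {V : Type*} (T : Set V) (c : V → V) :
    Ideal (EdgeRing K V) :=
  RingHom.ker (paramHom K T c)

instance (T : Set V) (c : V → V) : (labelPrime K T c).IsPrime :=
  RingHom.ker_isPrime _

lemma mem_labelPrime {T : Set V} {c : V → V} {f : EdgeRing K V} :
    f ∈ labelPrime K T c ↔ paramHom K T c f = 0 := Iff.rfl

lemma paramHom_inl {T : Set V} {c : V → V} {v : V} (h : v ∉ T) :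
    paramHom K T c (X (Sum.inl v)) = X (Sum.inl v) * X (Sum.inr (Sum.inl (c v))) := by
  simp [paramHom, h]

lemma paramHom_inr {T : Set V} {c : V → V} {v : V} (h : v ∉ T) :
    paramHom K T c (X (Sum.inr v)) = X (Sum.inl v) * X (Sum.inr (Sum.inr (c v))) := by
  simp [paramHom, h]

lemma paramHom_inl_of_mem {T : Set V} {c : V → V} {v : V} (h : v ∈ T) :
    paramHom K T c (X (Sum.inl v)) = 0 := by
  simp [paramHom, h]

lemma paramHom_inr_of_mem {T : Set V} {c : V → V} {v : V} (h : v ∈ T) :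
    paramHom K T c (X (Sum.inr v)) = 0 := by
  simp [paramHom, h]

lemma X_inl_mem_labelPrime {T : Set V} {c : V → V} {v : V} :
    (X (Sum.inl v) : EdgeRing K V) ∈ labelPrime K T c ↔ v ∈ T := by
  rw [mem_labelPrime]
  by_cases h : v ∈ T
  · simp [paramHom_inl_of_mem h, h]
  · simp [paramHom_inl h, h, X_ne_zero]

lemma X_inr_mem_labelPrime {T : Set V} {c : V → V} {v : V} :
    (X (Sum.inr v) : EdgeRing K V) ∈ labelPrime K T c ↔ v ∈ T := by
  rw [mem_labelPrime]
  by_cases h : v ∈ T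
  · simp [paramHom_inr_of_mem h, h]
  · simp [paramHom_inr h, h, X_ne_zero]

lemma minor_mem_labelPrime {T : Set V} {c : V → V} {u v : V} :
    minor K u v ∈ labelPrime K T c ↔ u ∈ T ∨ v ∈ T ∨ c u = c v := by
  classical
  rw [mem_labelPrime, minor]
  simp only [map_sub, map_mul]
  by_cases hu : u ∈ T
  · simp [paramHom_inl_of_mem hu, paramHom_inr_of_mem hu, hu]
  by_cases hv : v ∈ T
  · simp [paramHom_inl_of_mem hv, paramHom_inr_of_mem hv, hv]
  rw [paramHom_inl hu, paramHom_inl hv, paramHom_inr hu, paramHom_inr hv]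
  simp only [hu, hv, false_or]
  constructor
  · intro h
    by_contra hne
    have := congrArg (eval (Sum.elim (fun _ => (1 : K))
      (Sum.elim (fun l => if l = c u then 1 else 0) (fun l => if l = c v then 1 else 0)))) h
    simp [hne, Ne.symm hne] at this
  · intro h
    rw [h]; ring

/-- Any algebra map through which the parametrization factors has a larger kernel. -/
lemma labelPrime_le_ker {A : Type*} [CommRing A] [Algebra K A] {T : Set V} {c : V → V}
    (g : EdgeRing K V →ₐ[K] A) (τ a b : V → A)
    (h1 : ∀ v ∈ T, g (X (Sum.inl v)) = 0) (h2 : ∀ v ∈ T, g (X (Sum.inr v)) = 0)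
    (h3 : ∀ v ∉ T, g (X (Sum.inl v)) = τ v * a (c v))
    (h4 : ∀ v ∉ T, g (X (Sum.inr v)) = τ v * b (c v)) :
    labelPrime K T c ≤ RingHom.ker g := by
  have hg : g = (aeval (Sum.elim τ (Sum.elim a b))).comp (paramHom K T c) := by
    apply MvPolynomial.algHom_ext
    rintro (v | v)
    · by_cases h : v ∈ T
      · simp [paramHom_inl_of_mem h, h1 v h]
      · simp [paramHom_inl h, h3 v h]
    · by_cases h : v ∈ T
      · simp [paramHom_inr_of_mem h, h2 v h]
      · simp [paramHom_inr h, h4 v h]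
  intro f hf
  rw [mem_labelPrime] at hf
  rw [RingHom.mem_ker, hg]
  simp [hf]

/-- A coarser labelling with more vertices killed is a specialization of the finer one: rename the
parameters a_l, b_l along the induced map of labels and set τ_v = 0 on `T`. -/
lemma labelPrime_mono {T T' : Set V} {c c' : V → V} (hT : T' ⊆ T)
    (hc : ∀ u v, u ∉ T → v ∉ T → c' u = c' v → c u = c v) :
    labelPrime K T' c' ≤ labelPrime K T c := by
  classical
  let g : V → V := fun l => if h : ∃ u, u ∉ T ∧ c' u = l then c h.choose else l
  have hg : ∀ v, v ∉ T → g (c' v) = c v := by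
    intro v hv
    have h : ∃ u, u ∉ T ∧ c' u = c' v := ⟨v, hv, rfl⟩
    simp only [g, dif_pos h]
    exact hc _ _ h.choose_spec.1 hv h.choose_spec.2
  refine labelPrime_le_ker (paramHom K T c) (fun v => if v ∈ T then 0 else X (Sum.inl v))
    (fun l => X (Sum.inr (Sum.inl (g l)))) (fun l => X (Sum.inr (Sum.inr (g l)))) ?_ ?_ ?_ ?_
  · exact fun v hv => paramHom_inl_of_mem (hT hv)
  · exact fun v hv => paramHom_inr_of_mem (hT hv)
  · intro v _
    by_cases h : v ∈ T
    · simp [paramHom_inl_of_mem h, h]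
    · simp [paramHom_inl h, h, hg v h]
  · intro v _
    by_cases h : v ∈ T
    · simp [paramHom_inr_of_mem h, h]
    · simp [paramHom_inr h, h, hg v h]

/-! ### Heights -/

lemma labelPrime_height_insert {T : Set V} {c : V → V} {v : V} (hv : v ∉ T) :
    (labelPrime K T c).height + 1 ≤ (labelPrime K (insert v T) c).height := by
  refine Ideal.height_add_one_le_of_lt_of_isPrime (lt_of_le_of_ne
    (labelPrime_mono (Set.subset_insert v T) fun _ _ _ _ h => h) fun h => hv ?_)
  rw [← X_inl_mem_labelPrime (K := K) (c := c), h, X_inl_mem_labelPrime]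
  exact Set.mem_insert v T

/-- Removing a vertex that is alone in its class raises the height by at least two. -/
lemma labelPrime_height_insert_of_singleton {T : Set V} {c : V → V} {v : V} (hv : v ∉ T)
    (hs : ∀ u ∉ T, c u = c v → u = v) :
    (labelPrime K T c).height + 2 ≤ (labelPrime K (insert v T) c).height := by
  classical
  -- Setting a_{c v} = 0 gives an intermediate prime `I`, which contains x_v but not y_v. Since v is
  -- alone in its class outside `T`, no other x-variable is affected, and so `I` stays below the
  -- prime in which v is removed.
  let σ : ParamRing K V →ₐ[K] ParamRing K V :=
    aeval (fun i => if i = Sum.inr (Sum.inl (c v)) then 0 else X i)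
  let I : Ideal (EdgeRing K V) := RingHom.ker (σ.comp (paramHom K T c))
  have hI : I.IsPrime := RingHom.ker_isPrime _
  have h1 : labelPrime K T c < I := by
    refine lt_of_le_of_ne (fun f hf => ?_) fun h => hv ?_
    · rw [mem_labelPrime] at hf
      simp [I, RingHom.mem_ker, hf]
    · rw [← X_inl_mem_labelPrime (K := K) (c := c), h]
      simp [I, RingHom.mem_ker, paramHom_inl hv, σ]
  have h2 : I < labelPrime K (insert v T) c := by
    refine lt_of_le_of_ne (fun f hf => ?_) fun h => ?_
    · let ρ : ParamRing K V →ₐ[K] ParamRing K V :=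
        aeval (fun i => if i = Sum.inl v then 0 else X i)
      have hρ : paramHom K (insert v T) c = ρ.comp (σ.comp (paramHom K T c)) := by
        apply MvPolynomial.algHom_ext
        rintro (u | u)
        · by_cases h : u ∈ T
          · simp [paramHom_inl_of_mem h, paramHom_inl_of_mem (Set.mem_insert_of_mem v h)]
          by_cases huv : u = v
          · subst huv
            simp [paramHom_inl h, paramHom_inl_of_mem (Set.mem_insert u T), σ]
          · have hcu : c u ≠ c v := fun h' => huv (hs u h h')
            have : u ∉ insert v T := by simp [h, huv]
            simp [paramHom_inl h, paramHom_inl this, σ, ρ, hcu, huv]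
        · by_cases h : u ∈ T
          · simp [paramHom_inr_of_mem h, paramHom_inr_of_mem (Set.mem_insert_of_mem v h)]
          by_cases huv : u = v
          · subst huv
            simp [paramHom_inr h, paramHom_inr_of_mem (Set.mem_insert u T), σ, ρ]
          · have : u ∉ insert v T := by simp [h, huv]
            simp [paramHom_inr h, paramHom_inr this, σ, ρ, huv]
      rw [mem_labelPrime, hρ, AlgHom.comp_apply]
      have hf' : (σ.comp (paramHom K T c)) f = 0 := hf
      rw [hf', map_zero]
    · have hm : (X (Sum.inr v) : EdgeRing K V) ∈ I := by
        rw [h, X_inr_mem_labelPrime]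
        exact Set.mem_insert v T
      simp [I, RingHom.mem_ker, paramHom_inr hv, σ, X_ne_zero] at hm
  have e1 := Ideal.height_add_one_le_of_lt_of_isPrime h1
  have e2 := Ideal.height_add_one_le_of_lt_of_isPrime h2
  calc (labelPrime K T c).height + 2 = (labelPrime K T c).height + 1 + 1 := by
        rw [add_assoc, one_add_one_eq_two]
    _ ≤ I.height + 1 := by gcongr
    _ ≤ _ := e2

variable [Finite V]

lemma height_le_card (P : Ideal (EdgeRing K V)) (hP : P ≠ ⊤) :
    P.height ≤ ((2 * Nat.card V : ℕ) : ℕ∞) := by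
  have h := Ideal.height_le_ringKrullDim_of_ne_top hP
  rw [MvPolynomial.ringKrullDim_of_isNoetherianRing, ringKrullDim_eq_zero_of_field, zero_add,
    Nat.card_sum, ← two_mul] at h
  exact WithBot.coe_le_coe.mp h

/-- Kill the vertices outside `T` one by one. Each step raises the height by one, and by two when
the vertex is the last of its class, so the total rise is the number of vertices plus the number of
classes; the dimension 2|V| of the ring bounds the result. -/
lemma labelPrime_height_add_le (c : V → V) (T : Set V) :
    (labelPrime K T c).height + ((Tᶜ.ncard + (c '' Tᶜ).ncard : ℕ) : ℕ∞) ≤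
      ((2 * Nat.card V : ℕ) : ℕ∞) := by
  classical
  obtain ⟨n, hn⟩ : ∃ n, Tᶜ.ncard = n := ⟨_, rfl⟩
  induction n generalizing T with
  | zero =>
    have : Tᶜ = ∅ := (Set.ncard_eq_zero (Set.toFinite _)).mp hn
    rw [this]
    simpa using height_le_card (labelPrime K T c) (Ideal.IsPrime.ne_top inferInstance)
  | succ n ih =>
    obtain ⟨v, hv⟩ : (Tᶜ).Nonempty := by
      rw [Set.nonempty_iff_ne_empty]; rintro h; simp [h] at hn
    have hcompl : (insert v T)ᶜ = Tᶜ \ {v} := by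
      ext u; simp [not_or, and_comm]
    have hcard : (insert v T)ᶜ.ncard = n := by
      rw [hcompl, Set.ncard_sdiff_singleton_of_mem hv, hn]; rfl
    have h := ih (insert v T) hcard
    have himg : c '' Tᶜ = insert (c v) (c '' (insert v T)ᶜ) := by
      rw [hcompl, ← Set.image_insert_eq, Set.insert_sdiff_singleton, Set.insert_eq_of_mem hv]
    by_cases hs : c v ∈ c '' (insert v T)ᶜ
    · rw [himg, Set.insert_eq_of_mem hs]
      refine le_trans ?_ h
      have := labelPrime_height_insert (K := K) (c := c) hv
      calc _ = (labelPrime K T c).height + 1 + ((n + (c '' (insert v T)ᶜ).ncard : ℕ) : ℕ∞) := by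
            rw [hn]; push_cast; ring
        _ ≤ _ := by rw [hcard]; gcongr
    · rw [himg, Set.ncard_insert_of_notMem hs]
      refine le_trans ?_ h
      have := labelPrime_height_insert_of_singleton (K := K) (c := c) hv (by
        intro u hu huv
        by_contra hne
        exact hs ⟨u, by simp [hne]; exact hu, huv⟩)
      calc _ = (labelPrime K T c).height + 2 + ((n + (c '' (insert v T)ᶜ).ncard : ℕ) : ℕ∞) := by
            rw [hn]; push_cast; ring
        _ ≤ _ := by rw [hcard]; gcongr

lemma two_mul_ncard_le_labelPrime_height (T : Set V) :
    ((2 * T.ncard : ℕ) : ℕ∞) ≤ (labelPrime K T id).height := by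
  induction T, Set.toFinite T using Set.Finite.induction_on with
  | empty => simp
  | @insert v T hv _ ih =>
    rw [Set.ncard_insert_of_notMem hv]
    refine le_trans ?_ (labelPrime_height_insert_of_singleton hv fun u _ h => h)
    rw [mul_add]
    push_cast at ih ⊢
    gcongr

/-- This bounds the height from below by a chain from the discrete labelling, of height at least
2|T|, to `c`: vertices that are not representatives join their class one at a time, each giving a
strict inclusion. Outside `T` every vertex is either such a vertex or the representative of a class.
-/
lemma card_le_labelPrime_height (c : V → V) (hc : ∀ v, c (c v) = c v) (T : Set V)
    (hT : ∀ v, v ∉ T → c v ∉ T) :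
    ((T.ncard + Nat.card V : ℕ) : ℕ∞) ≤ (labelPrime K T c).height + (c '' Tᶜ).ncard := by
  classical
  obtain ⟨d, hd1, hd2⟩ : ∃ d : Set V → V → V, (∀ U, ∀ v ∈ U, d U v = c v) ∧
      ∀ U, ∀ v ∉ U, d U v = v :=
    ⟨fun U v => if v ∈ U then c v else v, fun U v h => if_pos h, fun U v h => if_neg h⟩
  have key : ∀ U : Set V, U ⊆ {v | v ∉ T ∧ c v ≠ v} →
      ((2 * T.ncard + U.ncard : ℕ) : ℕ∞) ≤
        (labelPrime K T (d U)).height := by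
    intro U
    induction U, Set.toFinite U using Set.Finite.induction_on with
    | empty =>
      intro _
      have : d ∅ = id := funext fun v => hd2 ∅ v (Set.notMem_empty v)
      rw [Set.ncard_empty, add_zero, this]
      exact two_mul_ncard_le_labelPrime_height (K := K) T
    | @insert v U hv _ ih =>
      intro hU
      have hvT := hU (Set.mem_insert v U)
      have h1 := ih fun u hu => hU (Set.mem_insert_of_mem v hu)
      rw [Set.ncard_insert_of_notMem hv]
      have hcv : c v ∉ insert v U := fun h => (hU h).2 (hc v)
      have hcv' : c v ∉ U := fun h => hcv (Set.mem_insert_of_mem v h)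
      have h2 : labelPrime K T (d U) <
          labelPrime K T (d (insert v U)) := by
        refine lt_of_le_of_ne (labelPrime_mono subset_rfl ?_) fun h => ?_
        · have hne : ∀ w, c w ≠ v := by
            rintro w rfl
            exact hvT.2 (hc w)
          -- As v is not fixed by the idempotent map `c`, it is not a value of `c`; so the new
          -- labelling is the old one followed by sending the label v to `c v`.
          have hg : ∀ u, d (insert v U) u = (fun x => if x = v then c v else x) (d U u) := by
            intro u
            by_cases h1 : u ∈ U
            · simp [hd1 _ _ h1, hd1 _ _ (Set.mem_insert_of_mem v h1), hne]
            · by_cases h2 : u = v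
              · subst h2; simp [hd2 _ _ h1, hd1 _ _ (Set.mem_insert u U)]
              · simp [hd2 _ _ h1, hd2 (insert v U) u (by simp [h1, h2]), h2]
          intro u w _ _ h
          rw [hg, hg, h]
        -- The minor of v and its representative separates the two primes: the two vertices share a
        -- label only after v has joined.
        · have hm : minor K v (c v) ∈
              labelPrime K T (d (insert v U)) := by
            rw [minor_mem_labelPrime]
            right; right
            rw [hd1 _ _ (Set.mem_insert v U), hd2 _ _ hcv]
          rw [← h, minor_mem_labelPrime] at hm
          rw [hd2 _ _ hv, hd2 _ _ hcv'] at hm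
          rcases hm with h | h | h
          · exact hvT.1 h
          · exact hT v hvT.1 h
          · exact hvT.2 h.symm
      refine le_trans ?_ (Ideal.height_add_one_le_of_lt_of_isPrime h2)
      rw [← add_assoc]
      push_cast at h1 ⊢
      gcongr
  have h1 := key _ subset_rfl
  have h2 : labelPrime K T (d {v | v ∉ T ∧ c v ≠ v}) ≤
      labelPrime K T c := by
    refine labelPrime_mono subset_rfl fun u v hu hv h => ?_
    have e : ∀ u, u ∉ T → d {v | v ∉ T ∧ c v ≠ v} u = c u := by
      intro u hu
      by_cases h : c u = u
      · rw [hd2 _ _ fun h' => h'.2 h, h]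
      · exact hd1 _ _ ⟨hu, h⟩
    rwa [e u hu, e v hv] at h
  have h3 := h1.trans (Ideal.height_mono h2)
  have h4 : Tᶜ = {v | v ∉ T ∧ c v ≠ v} ∪ c '' Tᶜ := by
    ext v
    simp only [Set.mem_compl_iff, Set.mem_union, Set.mem_ofPred_eq, Set.mem_image]
    constructor
    · intro h
      by_cases h' : c v = v
      · exact Or.inr ⟨v, h, h'⟩
      · exact Or.inl ⟨h, h'⟩
    · rintro (h | ⟨u, hu, rfl⟩)
      · exact h.1
      · exact hT u hu
  have h5 : Tᶜ.ncard = {v | v ∉ T ∧ c v ≠ v}.ncard + (c '' Tᶜ).ncard := by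
    conv_lhs => rw [h4]
    refine Set.ncard_union_eq (Set.disjoint_left.mpr ?_) (Set.toFinite _) (Set.toFinite _)
    rintro _ h ⟨u, _, rfl⟩
    exact h.2 (hc u)
  have h6 := Set.ncard_add_ncard_compl T
  calc ((T.ncard + Nat.card V : ℕ) : ℕ∞)
      = ((2 * T.ncard + {v | v ∉ T ∧ c v ≠ v}.ncard : ℕ) : ℕ∞) + (c '' Tᶜ).ncard := by
        rw [← Nat.cast_add]; congr 1; omega
    _ ≤ _ := by gcongr

lemma labelPrime_height (c : V → V) (hc : ∀ v, c (c v) = c v) (T : Set V)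
    (hT : ∀ v, v ∉ T → c v ∉ T) :
    (labelPrime K T c).height + (c '' Tᶜ).ncard = ((T.ncard + Nat.card V : ℕ) : ℕ∞) := by
  refine le_antisymm ?_ (card_le_labelPrime_height c hc T hT)
  have h := labelPrime_height_add_le (K := K) c T
  have h6 := Set.ncard_add_ncard_compl T
  have h7 : (labelPrime K T c).height ≠ ⊤ := by
    intro h'
    rw [h', top_add, top_le_iff] at h
    exact ENat.natCast_ne_top _ h
  obtain ⟨k, hk⟩ := ENat.ne_top_iff_exists.mp h7
  rw [← hk] at h ⊢
  norm_cast at h ⊢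
  omega

end BinomialEdgeIdeals
end WhiskeredBlocks

namespace WhiskeredBlocks

open MvPolynomial

/-! ### The binomial edge ideal as the intersection of the primes P_T. -/

section BinomialEdgeIdeals

variable {K : Type*} [Field K] {V : Type*}

/-! ### Labelling vertices by components -/

open Classical in
/-- A representative of the component of `v` in `G \ T`. -/
noncomputable def componentLabel (G : SimpleGraph V) (T : Set V) (v : V) : V :=
  if h : v ∈ Tᶜ then ((G.induce Tᶜ).connectedComponentMk ⟨v, h⟩).out.1 else v

lemma componentLabel_eq_iff {G : SimpleGraph V} {T : Set V} {u v : V} (hu : u ∈ Tᶜ)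
    (hv : v ∈ Tᶜ) : componentLabel G T u = componentLabel G T v ↔
      (G.induce Tᶜ).Reachable ⟨u, hu⟩ ⟨v, hv⟩ := by
  rw [componentLabel, componentLabel, dif_pos hu, dif_pos hv, ← SimpleGraph.ConnectedComponent.eq]
  constructor
  · intro h
    rw [← Quot.out_eq ((G.induce Tᶜ).connectedComponentMk ⟨u, hu⟩),
      ← Quot.out_eq ((G.induce Tᶜ).connectedComponentMk ⟨v, hv⟩), Subtype.ext h]
  · intro h
    rw [h]

lemma componentLabel_notMem {G : SimpleGraph V} {T : Set V} (v : V) (hv : v ∉ T) :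
    componentLabel G T v ∉ T := by
  rw [componentLabel, dif_pos (show v ∈ Tᶜ from hv)]
  exact ((G.induce Tᶜ).connectedComponentMk ⟨v, hv⟩).out.2

lemma componentLabel_componentLabel (G : SimpleGraph V) (T : Set V) (v : V) :
    componentLabel G T (componentLabel G T v) = componentLabel G T v := by
  by_cases hv : v ∈ T
  · have : componentLabel G T v = v := by rw [componentLabel, dif_neg (by simpa using hv)]
    rw [this, this]
  · rw [componentLabel_eq_iff (componentLabel_notMem v hv) hv, ← SimpleGraph.ConnectedComponent.eq]
    have h : componentLabel G T v = ((G.induce Tᶜ).connectedComponentMk ⟨v, hv⟩).out.1 := by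
      rw [componentLabel, dif_pos]
    simp only [h]
    exact Quot.out_eq _

lemma ncard_image_componentLabel (G : SimpleGraph V) (T : Set V) :
    (componentLabel G T '' Tᶜ).ncard = numComponents G T := by
  rw [numComponents, ← Nat.card_coe_set_eq]
  refine (Nat.card_congr (Equiv.ofBijective
    (fun x : (G.induce Tᶜ).ConnectedComponent =>
      (⟨x.out.1, x.out.1, x.out.2, ?_⟩ : componentLabel G T '' Tᶜ)) ⟨?_, ?_⟩)).symm
  · rw [componentLabel, dif_pos x.out.2]
    congr 2
    exact Quot.out_eq _
  · intro x y h
    have h' : x.out = y.out := Subtype.ext (congrArg (fun z : componentLabel G T '' Tᶜ => (z : V)) h)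
    have hx : (G.induce Tᶜ).connectedComponentMk x.out = x := Quot.out_eq x
    have hy : (G.induce Tᶜ).connectedComponentMk y.out = y := Quot.out_eq y
    rw [← hx, ← hy, h']
  · rintro ⟨_, v, hv, rfl⟩
    refine ⟨(G.induce Tᶜ).connectedComponentMk ⟨v, hv⟩, ?_⟩
    refine Subtype.ext (?_ : _ = componentLabel G T v)
    rw [componentLabel, dif_pos hv]

/-! ### Monomials under the parametrization -/

/-- The exponent of the image of a monomial under the parametrization. -/
noncomputable def paramExponent (c : V → V) : (V ⊕ V →₀ ℕ) →ₗ[ℕ] (V ⊕ V ⊕ V →₀ ℕ) :=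
  Finsupp.linearCombination ℕ (Sum.elim
    (fun v => Finsupp.single (Sum.inl v) 1 + Finsupp.single (Sum.inr (Sum.inl (c v))) 1)
    (fun v => Finsupp.single (Sum.inl v) 1 + Finsupp.single (Sum.inr (Sum.inr (c v))) 1))

lemma paramHom_monomial (c : V → V) (T : Set V) (q : V ⊕ V →₀ ℕ) (a : K)
    (h : ∀ v ∈ T, v ∉ vertexSupport q) :
    paramHom K T c (monomial q a) = monomial (paramExponent c q) a := by
  rw [paramHom, aeval_monomial, paramExponent, Finsupp.linearCombination_apply,
    monomial_finsupp_sum_index]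
  congr 1
  refine Finsupp.prod_congr fun i hi => ?_
  have hpow : ∀ e : V ⊕ V ⊕ V →₀ ℕ, monomial (q i • e) (1 : K) = monomial e 1 ^ q i := by
    intro e; rw [monomial_pow, one_pow]
  rw [hpow]
  congr 1
  rcases i with v | v
  · have hv : v ∉ T := fun h' => h v h' (Or.inl (Finsupp.mem_support_iff.mp hi))
    simp [hv, X, monomial_mul]
  · have hv : v ∉ T := fun h' => h v h' (Or.inr (Finsupp.mem_support_iff.mp hi))
    simp [hv, X, monomial_mul]

lemma paramHom_monomial_of_mem (c : V → V) {T : Set V} {q : V ⊕ V →₀ ℕ} (a : K) {v : V}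
    (hv : v ∈ T) (h : v ∈ vertexSupport q) :
    paramHom K T c (monomial q a) = 0 := by
  rw [paramHom, aeval_monomial]
  refine mul_eq_zero_of_right _ ?_
  rcases h with h | h
  · exact Finset.prod_eq_zero (Finsupp.mem_support_iff.mpr h) (by simp [hv, zero_pow h])
  · exact Finset.prod_eq_zero (Finsupp.mem_support_iff.mpr h) (by simp [hv, zero_pow h])

section Finite

variable [Fintype V]

lemma paramExponent_eq_sum (c : V → V) (q : V ⊕ V →₀ ℕ) :
    paramExponent c q =
      ∑ v, q (Sum.inl v) • (Finsupp.single (Sum.inl v) 1 +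
          Finsupp.single (Sum.inr (Sum.inl (c v))) 1) +
      ∑ v, q (Sum.inr v) • (Finsupp.single (Sum.inl v) 1 +
          Finsupp.single (Sum.inr (Sum.inr (c v))) 1) := by
  rw [paramExponent, Finsupp.linearCombination_apply, Finsupp.sum_fintype _ _ (by simp),
    Fintype.sum_sum_type]
  rfl

/-- The exponents of τ_v and b_l record the total degree at each vertex and the total y-degree in
each class; these are the only invariants of a fibre needed below. -/
lemma paramExponent_inl (c : V → V) (q : V ⊕ V →₀ ℕ) (v : V) :
    paramExponent c q (Sum.inl v) = q (Sum.inl v) + q (Sum.inr v) := by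
  classical
  rw [paramExponent_eq_sum]
  simp [Finsupp.single_apply]

open Classical in
lemma paramExponent_inr_inr (c : V → V) (q : V ⊕ V →₀ ℕ) (l : V) :
    paramExponent c q (Sum.inr (Sum.inr l)) = ∑ v with c v = l, q (Sum.inr v) := by
  rw [paramExponent_eq_sum]
  simp [Finsupp.single_apply, Finset.sum_filter]

/-- A standard monomial is the only monomial of at most its weight in its fibre. -/
lemma IsStandard.eq_of_paramExponent_eq {G : SimpleGraph V} {idx : V → ℕ}
    (hidx : Function.Injective idx) {m q : V ⊕ V →₀ ℕ} (hm : IsStandard G idx m) {T : Set V}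
    (hT : Tᶜ = vertexSupport m)
    (hq : paramExponent (componentLabel G T) q = paramExponent (componentLabel G T) m)
    (hw : weight idx q ≤ weight idx m) : q = m := by
  classical
  set c := componentLabel G T with hc
  have hdeg : ∀ v, q (Sum.inl v) + q (Sum.inr v) = m (Sum.inl v) + m (Sum.inr v) := by
    intro v
    rw [← paramExponent_inl c, ← paramExponent_inl c, hq]
  have hsum : ∀ l, ∑ v with c v = l, q (Sum.inr v) = ∑ v with c v = l, m (Sum.inr v) := by
    intro l
    rw [← paramExponent_inr_inr c, ← paramExponent_inr_inr c, hq]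
  have hst : ∀ i j, c i = c j → m (Sum.inl i) ≠ 0 → m (Sum.inr j) ≠ 0 → idx j ≤ idx i := by
    intro i j hij hi hj
    by_contra hlt
    push Not at hlt
    have hi' : i ∈ vertexSupport m := Or.inl hi
    have hj' : j ∈ vertexSupport m := Or.inr hj
    refine hm i j hi' hj' hi hj hlt ?_
    have key : ∀ (S : Set V) (hS : Tᶜ = S) (hi : i ∈ S) (hj : j ∈ S),
        (G.induce S).Reachable ⟨i, hi⟩ ⟨j, hj⟩ := by
      rintro _ rfl hi hj
      exact (componentLabel_eq_iff hi hj).mp hij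
    exact key _ hT hi' hj'
  -- Within a class, standardness puts all y-variables of `m` at indices at most `θ` and all
  -- x-variables at indices at least `θ`. Among monomials with the same degrees this packing has
  -- least weight: each (idx - θ)·d is nonnegative, while their sum is at most zero because d sums
  -- to zero on every class.
  let θ : V → ℕ := fun l => (Finset.univ.filter fun v => c v = l ∧ m (Sum.inr v) ≠ 0).sup idx
  have h1 : ∀ v, idx v < θ (c v) → m (Sum.inl v) = 0 := by
    intro v hv
    by_contra hne
    obtain ⟨j, hj, hvj⟩ := Finset.lt_sup_iff.mp hv
    rw [Finset.mem_filter] at hj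
    exact absurd (hst v j hj.2.1.symm hne hj.2.2) (not_le.mpr hvj)
  have h2 : ∀ v, θ (c v) < idx v → m (Sum.inr v) = 0 := by
    intro v hv
    by_contra hne
    exact absurd (Finset.le_sup (f := idx) (Finset.mem_filter.mpr
      ⟨Finset.mem_univ v, rfl, hne⟩)) (not_le.mpr hv)
  let d : V → ℤ := fun v => (q (Sum.inr v) : ℤ) - m (Sum.inr v)
  have hnn : ∀ v ∈ Finset.univ, 0 ≤ ((idx v : ℤ) - θ (c v)) * d v := by
    intro v _
    have hd := hdeg v
    rcases lt_trichotomy (idx v) (θ (c v)) with h | h | h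
    · have := h1 v h
      exact mul_nonneg_of_nonpos_of_nonpos (by omega) (by simp only [d]; omega)
    · rw [h]; simp
    · have := h2 v h
      exact mul_nonneg (by omega) (by simp only [d]; omega)
  have hθ : ∑ v, (θ (c v) : ℤ) * d v = 0 := by
    rw [← Finset.sum_fiberwise (s := Finset.univ) (g := c)]
    refine Finset.sum_eq_zero fun l _ => ?_
    have : ∀ v ∈ Finset.univ.filter (fun v => c v = l), (θ (c v) : ℤ) * d v = θ l * d v := by
      intro v hv
      rw [(Finset.mem_filter.mp hv).2]
    rw [Finset.sum_congr rfl this, ← Finset.mul_sum]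
    have h := hsum l
    have : ∑ v with c v = l, d v = 0 := by
      simp only [d, Finset.sum_sub_distrib]
      rw [sub_eq_zero]
      exact_mod_cast h
    rw [this, mul_zero]
  have hle : ∑ v, ((idx v : ℤ) - θ (c v)) * d v ≤ 0 := by
    simp only [sub_mul, Finset.sum_sub_distrib, hθ, sub_zero]
    simp only [d, mul_sub, Finset.sum_sub_distrib]
    rw [sub_nonpos]
    simp only [weight] at hw
    exact_mod_cast hw
  have hz := (Finset.sum_eq_zero_iff_of_nonneg hnn).mp (le_antisymm hle (Finset.sum_nonneg hnn))
  have hne : ∀ v, idx v ≠ θ (c v) → q (Sum.inr v) = m (Sum.inr v) := by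
    intro v hv
    rcases mul_eq_zero.mp (hz v (Finset.mem_univ v)) with h | h
    · omega
    · simp only [d] at h; omega
  -- By injectivity of `idx` at most one vertex per class sits exactly at the threshold, and its
  -- y-exponent is recovered from the class sum.
  have hall : ∀ v, q (Sum.inr v) = m (Sum.inr v) := by
    intro v
    by_cases hv : idx v = θ (c v)
    · have h := hsum (c v)
      have hmem : v ∈ Finset.univ.filter (fun u => c u = c v) := by simp
      rw [← Finset.add_sum_erase _ _ hmem, ← Finset.add_sum_erase _ _ hmem] at h
      have : ∑ u ∈ (Finset.univ.filter (fun u => c u = c v)).erase v, q (Sum.inr u) =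
          ∑ u ∈ (Finset.univ.filter (fun u => c u = c v)).erase v, m (Sum.inr u) := by
        refine Finset.sum_congr rfl fun u hu => hne u fun hu' => ?_
        rw [Finset.mem_erase, Finset.mem_filter] at hu
        rw [hu.2.2, ← hv] at hu'
        exact hu.1 (hidx hu')
      omega
    · exact hne v hv
  ext (v | v)
  · have := hall v
    have := hdeg v
    omega
  · exact hall v

/-- Take a monomial of `f` of greatest weight and let `T` be the complement of its vertex support.
No other monomial of `f` has the same image under the parametrization for this `T`, so its nonzero
coefficient survives. -/
lemma eq_zero_of_forall_mem_labelPrime {G : SimpleGraph V} {idx : V → ℕ}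
    (hidx : Function.Injective idx) {f : EdgeRing K V}
    (hf : ∀ m ∈ f.support, IsStandard G idx m)
    (h : ∀ T, f ∈ labelPrime K T (componentLabel G T)) : f = 0 := by
  classical
  by_contra hne
  obtain ⟨m, hm, hmax⟩ := Finset.exists_max_image f.support (weight idx)
    (MvPolynomial.support_nonempty.mpr hne)
  let T := (vertexSupport m)ᶜ
  have hT : Tᶜ = vertexSupport m := compl_compl _
  have h0 := mem_labelPrime.mp (h T)
  have h1 : coeff (paramExponent (componentLabel G T) m)
      (paramHom K T (componentLabel G T) f) = coeff m f := by
    conv_lhs => rw [f.as_sum, map_sum, coeff_sum]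
    rw [Finset.sum_eq_single m]
    · rw [paramHom_monomial _ T m _ (fun v hv => hv), coeff_monomial, if_pos rfl]
    · intro q hq hqm
      by_cases hd : ∀ v ∈ T, v ∉ vertexSupport q
      · rw [paramHom_monomial _ _ _ _ hd, coeff_monomial, if_neg]
        intro he
        exact hqm ((hf m hm).eq_of_paramExponent_eq hidx hT he (hmax q hq))
      · push Not at hd
        obtain ⟨v, hv, hv'⟩ := hd
        rw [paramHom_monomial_of_mem _ _ hv hv', coeff_zero]
    · intro hm'
      rw [notMem_support_iff.mp hm']
      simp
  rw [h0, coeff_zero] at h1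
  exact (mem_support_iff.mp hm) h1.symm

end Finite

lemma binomialEdgeIdeal_le_labelPrime (G : SimpleGraph V) (T : Set V) :
    binomialEdgeIdeal K G ≤ labelPrime K T (componentLabel G T) := by
  refine Ideal.span_le.mpr ?_
  rintro _ ⟨u, v, huv, rfl⟩
  change minor K u v ∈ labelPrime K T (componentLabel G T)
  rw [minor_mem_labelPrime]
  by_cases hu : u ∈ T
  · exact Or.inl hu
  by_cases hv : v ∈ T
  · exact Or.inr (Or.inl hv)
  refine Or.inr (Or.inr ((componentLabel_eq_iff hu hv).mpr ?_))
  exact SimpleGraph.Adj.reachable (by simpa using huv)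

/-- The binomial edge ideal is the intersection of the primes `P_T`. -/
theorem binomialEdgeIdeal_eq_iInf [Finite V] (G : SimpleGraph V) :
    binomialEdgeIdeal K G = ⨅ T, labelPrime K T (componentLabel G T) := by
  have := Fintype.ofFinite V
  refine le_antisymm (le_iInf fun T => binomialEdgeIdeal_le_labelPrime G T) fun f hf => ?_
  obtain ⟨idx, hidx⟩ : ∃ idx : V → ℕ, Function.Injective idx :=
    ⟨fun v => Finite.equivFin V v, fun u v h => (Finite.equivFin V).injective (Fin.ext h)⟩
  obtain ⟨f', h1, h2⟩ := exists_standard_representative G idx f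
  have h3 : f' = 0 := by
    refine eq_zero_of_forall_mem_labelPrime hidx h2 fun T => ?_
    have h4 := binomialEdgeIdeal_le_labelPrime G T h1
    have h5 := Ideal.mem_iInf.mp hf T
    simpa using sub_mem h5 h4
  simpa [h3] using h1

end BinomialEdgeIdeals
end WhiskeredBlocks

namespace WhiskeredBlocks

open MvPolynomial

/-! ### Minimal primes, associated primes and the criterion for unmixedness. -/

section BinomialEdgeIdeals

variable {K : Type*} [Field K] {V : Type*}

/-! ### Prime ideals containing the binomial edge ideal -/

/-- Over the fraction field of the quotient by `Q`, each vertex outside the chosen set has a nonzero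
vector (x_v, y_v). Adjacent vectors are proportional, hence so are all vectors in one component, and
the quotient map factors through the parametrization. -/
lemma labelPrime_le_of_binomialEdgeIdeal_le {G : SimpleGraph V} {Q : Ideal (EdgeRing K V)}
    [hQ : Q.IsPrime] (h : binomialEdgeIdeal K G ≤ Q) :
    labelPrime K {v | X (Sum.inl v) ∈ Q ∧ X (Sum.inr v) ∈ Q}
      (componentLabel G {v | X (Sum.inl v) ∈ Q ∧ X (Sum.inr v) ∈ Q}) ≤ Q := by
  classical
  set T : Set V := {v | X (Sum.inl v) ∈ Q ∧ X (Sum.inr v) ∈ Q} with hT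
  let L := FractionRing (EdgeRing K V ⧸ Q)
  let g : EdgeRing K V →ₐ[K] L :=
    (IsScalarTower.toAlgHom K (EdgeRing K V ⧸ Q) L).comp (Ideal.Quotient.mkₐ K Q)
  have hg : ∀ f, g f = 0 ↔ f ∈ Q := by
    intro f
    simp only [g, AlgHom.comp_apply, IsScalarTower.coe_toAlgHom', Ideal.Quotient.mkₐ_eq_mk]
    rw [map_eq_zero_iff _ (IsFractionRing.injective (EdgeRing K V ⧸ Q) L),
      Ideal.Quotient.eq_zero_iff_mem]
  let x : V → L := fun v => g (X (Sum.inl v))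
  let y : V → L := fun v => g (X (Sum.inr v))
  have hT' : ∀ v, v ∈ T ↔ x v = 0 ∧ y v = 0 := by
    intro v; simp only [x, y, hg, hT]; rfl
  have hadj : ∀ u v, G.Adj u v → x u * y v = x v * y u := by
    intro u v huv
    have := (hg _).mpr (h (minor_mem_of_adj (K := K) huv))
    simp only [minor, map_sub, map_mul] at this
    exact sub_eq_zero.mp this
  have hreach : ∀ u v : (Tᶜ : Set V), (G.induce Tᶜ).Reachable u v →
      x u * y v = x v * y u := by
    rintro u v ⟨w⟩
    induction w with
    | nil => rfl
    | @cons u v w huv p ih =>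
      have h1 := hadj u v (by simpa using huv)
      -- Proportionality is transitive only through a nonzero vector; one cancels whichever
      -- coordinate of the middle vertex is nonzero.
      have h2 : ¬ (x v = 0 ∧ y v = 0) := fun h => v.2 ((hT' v).mpr h)
      by_cases hx : x v = 0
      · have hy : y v ≠ 0 := fun hy => h2 ⟨hx, hy⟩
        apply mul_left_cancel₀ hy
        linear_combination y w * h1 + y u * ih
      · apply mul_left_cancel₀ hx
        linear_combination x w * h1 + x u * ih
  set c := componentLabel G T with hc
  have hker : RingHom.ker g = Q := by
    ext f; exact hg f
  have hprop : ∀ v ∉ T, x v * y (c v) = x (c v) * y v := by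
    intro v hv
    have hcv := componentLabel_notMem (G := G) v hv
    exact hreach ⟨v, hv⟩ ⟨c v, hcv⟩ ((componentLabel_eq_iff hv hcv).mp
      (componentLabel_componentLabel G T v).symm)
  have hcT : ∀ v ∉ T, ¬ (x (c v) = 0 ∧ y (c v) = 0) := fun v hv h =>
    componentLabel_notMem (G := G) v hv ((hT' _).mpr h)
  rw [← hker]
  refine labelPrime_le_ker g
    -- The parameter τ_v is the ratio of v to its representative, read off in a coordinate where the
    -- representative does not vanish.
    (fun v => if x (c v) = 0 then y v / y (c v) else x v / x (c v)) x y ?_ ?_ ?_ ?_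
  · exact fun v hv => (hg _).mpr hv.1
  · exact fun v hv => (hg _).mpr hv.2
  · intro v hv
    have h1 := hprop v hv
    change x v = _
    by_cases hx : x (c v) = 0
    · have hy : y (c v) ≠ 0 := fun hy => hcT v hv ⟨hx, hy⟩
      rw [if_pos hx, hx, mul_zero]
      rw [hx, zero_mul] at h1
      exact (mul_eq_zero.mp h1).resolve_right hy
    · rw [if_neg hx, div_mul_cancel₀ _ hx]
  · intro v hv
    have h1 := hprop v hv
    change y v = _
    by_cases hx : x (c v) = 0
    · have hy : y (c v) ≠ 0 := fun hy => hcT v hv ⟨hx, hy⟩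
      rw [if_pos hx, div_mul_cancel₀ _ hy]
    · rw [if_neg hx, div_mul_eq_mul_div, eq_div_iff hx]
      linear_combination -h1

lemma mem_of_labelPrime_le {T T' : Set V} {c c' : V → V}
    (h : labelPrime K T' c' ≤ labelPrime K T c) : T' ⊆ T := fun _ hv =>
  X_inl_mem_labelPrime.mp (h (X_inl_mem_labelPrime.mpr hv))

/-! ### Adding a vertex back -/

/-- If all neighbours of v outside `T` already lie in one component, a visit of a walk to v can be
bypassed. -/
lemma reachable_of_reachable_diff_singleton {G : SimpleGraph V} {T : Set V} {v : V}
    (hloc : ∀ u w (hu : u ∈ Tᶜ) (hw : w ∈ Tᶜ), G.Adj v u → G.Adj v w →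
      (G.induce Tᶜ).Reachable ⟨u, hu⟩ ⟨w, hw⟩)
    {a b : V} (ha : a ∈ Tᶜ) (hb : b ∈ Tᶜ) (ha' : a ∈ (T \ {v})ᶜ) (hb' : b ∈ (T \ {v})ᶜ)
    (hv : v ∈ T)
    (h : (G.induce (T \ {v})ᶜ).Reachable ⟨a, ha'⟩ ⟨b, hb'⟩) :
    (G.induce Tᶜ).Reachable ⟨a, ha⟩ ⟨b, hb⟩ := by
  have hsubst : ∀ {p q r : V}, p = q → G.Adj p r → G.Adj q r := by
    rintro _ _ _ rfl h; exact h
  -- The invariant has a second clause for a walk that currently stands at v, where it speaks of all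
  -- neighbours of v instead of v itself.
  have key : ∀ x y : ((T \ {v})ᶜ : Set V), (G.induce (T \ {v})ᶜ).Walk x y → y = ⟨b, hb'⟩ →
      (∀ hx : x.1 ∈ Tᶜ, (G.induce Tᶜ).Reachable ⟨x, hx⟩ ⟨b, hb⟩) ∧
      (x.1 = v → ∀ u (hu : u ∈ Tᶜ), G.Adj v u → (G.induce Tᶜ).Reachable ⟨u, hu⟩ ⟨b, hb⟩) := by
    intro x y w
    induction w with
    | nil =>
      rintro rfl
      exact ⟨fun _ => SimpleGraph.Reachable.refl _, fun hx => absurd hv (hx ▸ hb)⟩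
    | @cons x z y hxz p ih =>
      intro hy
      obtain ⟨h1, h2⟩ := ih hy
      have hadj : G.Adj x.1 z.1 := by simpa using hxz
      have hz : z.1 ∈ Tᶜ ∨ z.1 = v := by
        by_cases h : z.1 = v
        · exact Or.inr h
        · exact Or.inl fun hz => z.2 ⟨hz, h⟩
      constructor
      · intro hx
        rcases hz with hz | hz
        · refine SimpleGraph.Reachable.trans (SimpleGraph.Adj.reachable ?_) (h1 hz)
          simpa using hadj
        · exact h2 hz x.1 hx (hsubst hz hadj.symm)
      · intro hx u hu huv
        rcases hz with hz | hz
        · exact (hloc u z.1 hu hz huv (hsubst hx hadj)).trans (h1 hz)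
        · exact absurd (hx.trans hz.symm) hadj.ne
  obtain ⟨w⟩ := h
  exact (key _ _ w rfl).1 ha

/-- A vertex of `T` decreases the number of components when added back if and only if it has
neighbours in different components. -/
lemma numComponents_diff_lt_iff [Finite V] {G : SimpleGraph V} {T : Set V} {v : V} (hv : v ∈ T) :
    numComponents G (T \ {v}) < numComponents G T ↔
      ∃ u w, ∃ (hu : u ∈ Tᶜ) (hw : w ∈ Tᶜ), G.Adj v u ∧ G.Adj v w ∧
        ¬ (G.induce Tᶜ).Reachable ⟨u, hu⟩ ⟨w, hw⟩ := by
  have hsub : Tᶜ ⊆ (T \ {v})ᶜ := Set.compl_subset_compl.mpr Set.sdiff_subset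
  have hv' : v ∈ (T \ {v})ᶜ := by simp
  let φ : (G.induce Tᶜ).ConnectedComponent → (G.induce (T \ {v})ᶜ).ConnectedComponent :=
    SimpleGraph.ConnectedComponent.map (SimpleGraph.induceHomOfLE G hsub).toHom
  have hφ : ∀ a (ha : a ∈ Tᶜ), φ ((G.induce Tᶜ).connectedComponentMk ⟨a, ha⟩) =
      (G.induce (T \ {v})ᶜ).connectedComponentMk ⟨a, hsub ha⟩ := fun _ _ => rfl
  constructor
  · intro h
    by_contra hcon
    push Not at hcon
    refine absurd h (not_lt.mpr (Nat.card_le_card_of_injective φ ?_))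
    intro p q
    refine SimpleGraph.ConnectedComponent.ind₂ ?_ p q
    rintro ⟨a, ha⟩ ⟨b, hb⟩ hab
    rw [hφ, hφ, SimpleGraph.ConnectedComponent.eq] at hab
    rw [SimpleGraph.ConnectedComponent.eq]
    exact reachable_of_reachable_diff_singleton hcon ha hb _ _ hv hab
  · rintro ⟨u, w, hu, hw, hvu, hvw, hne⟩
    have hadj : ∀ a (ha : a ∈ Tᶜ), G.Adj v a →
        (G.induce (T \ {v})ᶜ).connectedComponentMk ⟨a, hsub ha⟩ =
        (G.induce (T \ {v})ᶜ).connectedComponentMk ⟨v, hv'⟩ := by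
      intro a ha h
      rw [SimpleGraph.ConnectedComponent.eq]
      exact SimpleGraph.Adj.reachable (by simpa using h.symm)
    -- The component of v is reached only because v has a neighbour outside `T`.
    have hsurj : Function.Surjective φ := by
      intro q
      induction q using SimpleGraph.ConnectedComponent.ind with
      | _ a =>
        obtain ⟨a, ha⟩ := a
        by_cases hav : a = v
        · subst hav
          exact ⟨_, (hφ u hu).trans (hadj u hu hvu)⟩
        · exact ⟨_, hφ a fun h => ha ⟨h, hav⟩⟩
    refine lt_of_le_of_ne (Nat.card_le_card_of_surjective φ hsurj) fun hcard => hne ?_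
    have hinj := (hsurj.bijective_of_nat_card_le hcard.symm.le).1
    rw [← SimpleGraph.ConnectedComponent.eq]
    apply hinj
    rw [hφ, hφ, hadj u hu hvu, hadj w hw hvw]

/-! ### Minimal primes and unmixedness -/

/-- A prime between J_G and P_T contains some P_S with S ⊆ T. If v ∈ T \ S, then v reconnects two of
its neighbours from different components of G \ T, and their minor lies in P_S but not in P_T. -/
lemma labelPrime_mem_minimalPrimes [Finite V] {G : SimpleGraph V} {T : Set V}
    (hT : IsCutset G T) :
    labelPrime K T (componentLabel G T) ∈ (binomialEdgeIdeal K G).minimalPrimes := by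
  refine ⟨⟨inferInstance, binomialEdgeIdeal_le_labelPrime G T⟩, ?_⟩
  rintro Q ⟨hQ, hJ⟩ hle
  have h1 := labelPrime_le_of_binomialEdgeIdeal_le hJ
  set S : Set V := {v | X (Sum.inl v) ∈ Q ∧ X (Sum.inr v) ∈ Q}
  have hST : S ⊆ T := mem_of_labelPrime_le (h1.trans hle)
  have : S = T := by
    refine Set.Subset.antisymm hST fun v hv => ?_
    by_contra hvS
    obtain ⟨u, w, hu, hw, hvu, hvw, hne⟩ := (numComponents_diff_lt_iff hv).mp (hT v hv)
    have huS : u ∈ Sᶜ := fun h => hu (hST h)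
    have hwS : w ∈ Sᶜ := fun h => hw (hST h)
    have hm : minor K u w ∈ labelPrime K S (componentLabel G S) := by
      rw [minor_mem_labelPrime]
      refine Or.inr (Or.inr ((componentLabel_eq_iff huS hwS).mpr ?_))
      have h1 : (G.induce Sᶜ).Adj ⟨u, huS⟩ ⟨v, hvS⟩ := by simpa using hvu.symm
      have h2 : (G.induce Sᶜ).Adj ⟨v, hvS⟩ ⟨w, hwS⟩ := by simpa using hvw
      exact h1.reachable.trans h2.reachable
    have hm' := hle (h1 hm)
    rw [minor_mem_labelPrime] at hm'
    rcases hm' with h | h | h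
    · exact hu h
    · exact hw h
    · exact hne ((componentLabel_eq_iff hu hw).mp h)
  rwa [this] at h1

/-- A minimal prime equals P_T for the set `T` of vertices both of whose variables it contains. A
vertex of `T` that merges no components when restored could be dropped, which would give a strictly
smaller prime. -/
lemma exists_cutset_of_mem_minimalPrimes [Finite V] {G : SimpleGraph V}
    {P : Ideal (EdgeRing K V)} (hP : P ∈ (binomialEdgeIdeal K G).minimalPrimes) :
    ∃ T, IsCutset G T ∧ P = labelPrime K T (componentLabel G T) := by
  obtain ⟨⟨hprime, hJ⟩, hmin⟩ := hP
  have h1 := labelPrime_le_of_binomialEdgeIdeal_le hJ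
  set T : Set V := {v | X (Sum.inl v) ∈ P ∧ X (Sum.inr v) ∈ P}
  have hPT : P = labelPrime K T (componentLabel G T) :=
    le_antisymm (hmin ⟨inferInstance, binomialEdgeIdeal_le_labelPrime G T⟩ h1) h1
  refine ⟨T, fun v hv => ?_, hPT⟩
  by_contra hcon
  rw [numComponents_diff_lt_iff hv] at hcon
  push Not at hcon
  have hle : labelPrime K (T \ {v}) (componentLabel G (T \ {v})) ≤
      labelPrime K T (componentLabel G T) := by
    refine labelPrime_mono Set.sdiff_subset fun a b ha hb hab => ?_
    have ha' : a ∈ (T \ {v})ᶜ := fun h => ha h.1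
    have hb' : b ∈ (T \ {v})ᶜ := fun h => hb h.1
    exact (componentLabel_eq_iff ha hb).mpr (reachable_of_reachable_diff_singleton hcon ha hb
      ha' hb' hv ((componentLabel_eq_iff ha' hb').mp hab))
  have hge := hmin ⟨inferInstance, binomialEdgeIdeal_le_labelPrime G (T \ {v})⟩ (hPT ▸ hle)
  rw [hPT] at hge
  exact (mem_of_labelPrime_le hge hv).2 rfl

/-- This is radicality. Let P = (J : f) and let Q ⊆ P be a prime over J. If f ∈ Q then f² ∈ J, so f
∈ J and P is the whole ring; otherwise r·f ∈ J ⊆ Q puts every r ∈ P into Q. -/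
lemma associatedPrimes_binomialEdgeIdeal [Finite V] (G : SimpleGraph V) :
    associatedPrimes (EdgeRing K V) (EdgeRing K V ⧸ binomialEdgeIdeal K G) =
      (binomialEdgeIdeal K G).minimalPrimes := by
  apply Set.Subset.antisymm
  · intro P hP
    obtain ⟨hprime, x, hx⟩ := Submodule.isAssociatedPrime_iff.mp hP
    obtain ⟨f, rfl⟩ := Ideal.Quotient.mk_surjective x
    have hmem : ∀ r, r ∈ P ↔ r * f ∈ binomialEdgeIdeal K G := by
      intro r
      rw [hx, Submodule.mem_colon_singleton, Submodule.mem_bot, ← Ideal.Quotient.eq_zero_iff_mem,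
        map_mul]
      rfl
    refine ⟨⟨hprime, fun r hr => (hmem r).mpr (Ideal.mul_mem_right _ _ hr)⟩, ?_⟩
    rintro Q ⟨hQ, hJQ⟩ hQP r hr
    refine (hQ.mem_or_mem (hJQ ((hmem r).mp hr))).resolve_right fun hfQ => hprime.ne_top ?_
    have hff := (hmem f).mp (hQP hfQ)
    rw [Ideal.eq_top_iff_one, hmem, one_mul]
    rw [binomialEdgeIdeal_eq_iInf, Ideal.mem_iInf] at hff ⊢
    exact fun T => (Ideal.IsPrime.mem_or_mem inferInstance (hff T)).elim id id
  · have h := Module.associatedPrimes.minimalPrimes_annihilator_subset_associatedPrimes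
      (EdgeRing K V) (EdgeRing K V ⧸ binomialEdgeIdeal K G)
    rwa [Ideal.annihilator_quotient] at h

/-- The binomial edge ideal is unmixed if and only if `c_G(T) = |T| + c_G(∅)` for all cutsets. -/
theorem isUnmixed_binomialEdgeIdeal_iff [Finite V] (G : SimpleGraph V) :
    IsUnmixed (binomialEdgeIdeal K G) ↔
      ∀ T, IsCutset G T → numComponents G T = T.ncard + numComponents G ∅ := by
  have hheight : ∀ T, (labelPrime K T (componentLabel G T)).height + numComponents G T =
      ((T.ncard + Nat.card V : ℕ) : ℕ∞) := by
    intro T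
    rw [← ncard_image_componentLabel]
    exact labelPrime_height _ (componentLabel_componentLabel G T) T componentLabel_notMem
  have hiff : ∀ T, (labelPrime K T (componentLabel G T)).height =
      (labelPrime K ∅ (componentLabel G ∅)).height ↔
        numComponents G T = T.ncard + numComponents G ∅ := by
    intro T
    have h1 := hheight T
    have h2 := hheight ∅
    rw [Set.ncard_empty, zero_add] at h2
    obtain ⟨a, ha⟩ : ∃ a : ℕ, (a : ℕ∞) = (labelPrime K T (componentLabel G T)).height :=
      ENat.ne_top_iff_exists.mp fun h => by
        rw [h, top_add] at h1; exact ENat.natCast_ne_top _ h1.symm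
    obtain ⟨b, hb⟩ : ∃ b : ℕ, (b : ℕ∞) = (labelPrime K ∅ (componentLabel G ∅)).height :=
      ENat.ne_top_iff_exists.mp fun h => by
        rw [h, top_add] at h2; exact ENat.natCast_ne_top _ h2.symm
    rw [← ha] at h1
    rw [← hb] at h2
    rw [← ha, ← hb]
    norm_cast at *
    omega
  -- The empty set is a cutset vacuously, so P_∅ is a minimal prime, against whose height all others
  -- are compared.
  have hempty : IsCutset G ∅ := fun v hv => absurd hv (Set.notMem_empty v)
  rw [IsUnmixed, associatedPrimes_binomialEdgeIdeal]
  constructor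
  · intro h T hT
    exact (hiff T).mp (h _ (labelPrime_mem_minimalPrimes hT) _ (labelPrime_mem_minimalPrimes hempty))
  · intro h P hP Q hQ
    obtain ⟨T, hT, rfl⟩ := exists_cutset_of_mem_minimalPrimes hP
    obtain ⟨S, hS, rfl⟩ := exists_cutset_of_mem_minimalPrimes hQ
    rw [(hiff T).mpr (h T hT), (hiff S).mpr (h S hS)]

end BinomialEdgeIdeals
end WhiskeredBlocks

namespace WhiskeredBlocks

/-! ### Component counts under contractions, isomorphisms and added whiskers. -/

section Components

variable {V V' : Type*}

/-! ### Counting components -/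

lemma numComponents_eq_card_of_label {X : Type*} {G : SimpleGraph V} {T : Set V}
    (f : (Tᶜ : Set V) → X) (hsurj : Function.Surjective f)
    (h : ∀ u v, f u = f v ↔ (G.induce Tᶜ).Reachable u v) : numComponents G T = Nat.card X := by
  refine Nat.card_congr (Equiv.ofBijective
    (SimpleGraph.ConnectedComponent.lift f fun u v p _ => (h u v).mpr p.reachable) ⟨?_, ?_⟩)
  · intro p q
    refine SimpleGraph.ConnectedComponent.ind₂ (fun u v huv => ?_) p q
    exact SimpleGraph.ConnectedComponent.eq.mpr ((h u v).mp huv)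
  · intro x
    obtain ⟨u, rfl⟩ := hsurj x
    exact ⟨(G.induce Tᶜ).connectedComponentMk u, rfl⟩

/-- A contraction with connected fibres preserves the number of components. -/
lemma numComponents_eq_of_contraction {G : SimpleGraph V} {G' : SimpleGraph V'} {T : Set V}
    {T' : Set V'} (f : V → V') (hT : ∀ v, v ∈ T ↔ f v ∈ T')
    (hadj : ∀ u v, u ∉ T → v ∉ T → G.Adj u v → f u = f v ∨ G'.Adj (f u) (f v))
    (hsurj : ∀ a ∉ T', ∃ v, f v = a)
    (hlift : ∀ a b, a ∉ T' → b ∉ T' → G'.Adj a b → ∃ u v, f u = a ∧ f v = b ∧ G.Adj u v)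
    (hfib : ∀ u v (hu : u ∈ Tᶜ) (hv : v ∈ Tᶜ), f u = f v →
      (G.induce Tᶜ).Reachable ⟨u, hu⟩ ⟨v, hv⟩) :
    numComponents G T = numComponents G' T' := by
  have hmem : ∀ u : (Tᶜ : Set V), f u ∈ T'ᶜ := fun u h => u.2 ((hT u).mpr h)
  have hfwd : ∀ u v : (Tᶜ : Set V), (G.induce Tᶜ).Reachable u v →
      (G'.induce T'ᶜ).Reachable ⟨f u, hmem u⟩ ⟨f v, hmem v⟩ := by
    rintro u v ⟨w⟩
    induction w with
    | nil => exact SimpleGraph.Reachable.refl _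
    | @cons u v w h p ih =>
      refine SimpleGraph.Reachable.trans ?_ ih
      rcases hadj u v u.2 v.2 (by simpa using h) with h | h
      · simp only [h]
        exact SimpleGraph.Reachable.refl _
      · exact SimpleGraph.Adj.reachable (by simpa using h)
  have hbwd : ∀ a b : (T'ᶜ : Set V'), (G'.induce T'ᶜ).Reachable a b →
      ∀ u v : (Tᶜ : Set V), f u = a → f v = b → (G.induce Tᶜ).Reachable u v := by
    rintro a b ⟨w⟩
    induction w with
    | nil =>
      intro u v hu hv
      exact hfib u v u.2 v.2 (hu.trans hv.symm)
    | @cons a b c h p ih =>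
      intro u v hu hv
      obtain ⟨x, y, hx, hy, hxy⟩ := hlift a b a.2 b.2 (by simpa using h)
      have hxT : x ∈ Tᶜ := fun h' => a.2 (hx ▸ (hT x).mp h')
      have hyT : y ∈ Tᶜ := fun h' => b.2 (hy ▸ (hT y).mp h')
      refine (hfib u x u.2 hxT (hu.trans hx.symm)).trans
        (SimpleGraph.Reachable.trans (SimpleGraph.Adj.reachable ?_) (ih ⟨y, hyT⟩ v hy hv))
      simpa using hxy
  rw [numComponents_eq_card_of_label (X := (G'.induce T'ᶜ).ConnectedComponent)
    (fun u => (G'.induce T'ᶜ).connectedComponentMk ⟨f u, hmem u⟩)]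
  · rfl
  · intro q
    induction q using SimpleGraph.ConnectedComponent.ind with
    | _ a =>
      obtain ⟨v, hv⟩ := hsurj a a.2
      exact ⟨⟨v, fun h => a.2 (hv ▸ (hT v).mp h)⟩, by simp only [hv]⟩
  · intro u v
    rw [SimpleGraph.ConnectedComponent.eq]
    exact ⟨fun h => hbwd _ _ h u v rfl rfl, hfwd u v⟩

lemma numComponents_iso {G : SimpleGraph V} {G' : SimpleGraph V'} (e : G ≃g G') (T : Set V) :
    numComponents G' (e '' T) = numComponents G T := by
  refine (numComponents_eq_of_contraction e (fun v => ?_) (fun u v _ _ h => Or.inr ?_)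
    (fun a _ => ⟨e.symm a, by simp⟩) (fun a b _ _ h => ⟨e.symm a, e.symm b, by simp, by simp, ?_⟩)
    fun u v _ _ h => ?_).symm
  · simp
  · exact e.map_adj_iff.mpr h
  · exact e.symm.map_adj_iff.mpr h
  · have := e.injective h
    subst this
    exact SimpleGraph.Reachable.refl _

lemma isCutset_iso {G : SimpleGraph V} {G' : SimpleGraph V'} (e : G ≃g G') (T : Set V) :
    IsCutset G' (e '' T) ↔ IsCutset G T := by
  simp only [IsCutset, Set.forall_mem_image]
  refine forall₂_congr fun v _ => ?_
  rw [← numComponents_iso e T, ← numComponents_iso e (T \ {v}), Set.image_sdiff e.injective,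
    Set.image_singleton]

lemma isCutpoint_iso {G : SimpleGraph V} {G' : SimpleGraph V'} (e : G ≃g G') (v : V) :
    IsCutpoint G' (e v) ↔ IsCutpoint G v := by
  rw [IsCutpoint, IsCutpoint, ← isCutset_iso e, Set.image_singleton]

lemma exists_image_eq (e : V ≃ V') (T' : Set V') : ∃ T, e '' T = T' :=
  ⟨e ⁻¹' T', Set.image_preimage_eq _ e.surjective⟩

/-! ### Whiskers -/

/-- A whisker at a removed vertex becomes an isolated point; every other whisker stays in the
component of the vertex that carries it. -/
lemma numComponents_addWhiskers [Finite V] (B : SimpleGraph V) (W S : Set V) :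
    numComponents (addWhiskers B W) (Sum.inl '' S) = numComponents B S + (S ∩ W).ncard := by
  classical
  have hl : ∀ {v : V}, Sum.inl v ∈ (Sum.inl '' S : Set (V ⊕ W))ᶜ ↔ v ∈ Sᶜ := by simp
  have hr : ∀ w : W, Sum.inr w ∈ (Sum.inl '' S : Set (V ⊕ W))ᶜ := by simp
  let X := (B.induce Sᶜ).ConnectedComponent ⊕ (S ∩ W : Set V)
  have hX : Nat.card X = numComponents B S + (S ∩ W).ncard := by
    rw [Nat.card_sum, Nat.card_coe_set_eq]; rfl
  let f : ((Sum.inl '' S : Set (V ⊕ W))ᶜ : Set (V ⊕ W)) → X := fun x =>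
    match x with
    | ⟨Sum.inl v, hv⟩ => Sum.inl ((B.induce Sᶜ).connectedComponentMk ⟨v, hl.mp hv⟩)
    | ⟨Sum.inr w, _⟩ => if h : w.1 ∈ S then Sum.inr ⟨w.1, h, w.2⟩
        else Sum.inl ((B.induce Sᶜ).connectedComponentMk ⟨w.1, h⟩)
  rw [← hX]
  have hlift : ∀ u v : (Sᶜ : Set V), (B.induce Sᶜ).Reachable u v →
      ((addWhiskers B W).induce (Sum.inl '' S)ᶜ).Reachable ⟨Sum.inl u.1, hl.mpr u.2⟩
        ⟨Sum.inl v.1, hl.mpr v.2⟩ := by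
    intro u v h
    exact h.map (G' := (addWhiskers B W).induce (Sum.inl '' S)ᶜ)
      ⟨fun u => ⟨Sum.inl u.1, hl.mpr u.2⟩, fun {a b} hab => by simpa [addWhiskers] using hab⟩
  have hpend : ∀ (w : W) (h : w.1 ∈ Sᶜ),
      ((addWhiskers B W).induce (Sum.inl '' S)ᶜ).Reachable ⟨Sum.inr w, hr w⟩
        ⟨Sum.inl w.1, hl.mpr h⟩ := fun w h => SimpleGraph.Adj.reachable (by simp [addWhiskers])
  refine numComponents_eq_card_of_label f ?_ ?_
  · rintro (q | ⟨v, hv, hvW⟩)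
    · induction q using SimpleGraph.ConnectedComponent.ind with
      | _ a => exact ⟨⟨Sum.inl a.1, hl.mpr a.2⟩, rfl⟩
    · exact ⟨⟨Sum.inr ⟨v, hvW⟩, hr _⟩, dif_pos hv⟩
  · intro x y
    constructor
    · rcases x with ⟨u | w, hx⟩ <;> rcases y with ⟨v | w', hy⟩
      · intro h
        exact hlift _ _ (SimpleGraph.ConnectedComponent.eq.mp (Sum.inl_injective h))
      · intro h
        by_cases hw : w'.1 ∈ S
        · simp [f, hw] at h
        · simp only [f, hw, dif_neg, not_false_iff] at h
          exact (hlift _ _ (SimpleGraph.ConnectedComponent.eq.mp (Sum.inl_injective h))).trans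
            (hpend w' hw).symm
      · intro h
        by_cases hw : w.1 ∈ S
        · simp [f, hw] at h
        · simp only [f, hw, dif_neg, not_false_iff] at h
          exact (hpend w hw).trans
            (hlift _ _ (SimpleGraph.ConnectedComponent.eq.mp (Sum.inl_injective h)))
      · intro h
        by_cases hw : w.1 ∈ S <;> by_cases hw' : w'.1 ∈ S
        · simp only [f, hw, hw', dif_pos] at h
          have := congrArg Subtype.val (Sum.inr_injective h)
          have : w = w' := Subtype.ext this
          subst this
          exact SimpleGraph.Reachable.refl _
        · simp [f, hw, hw'] at h
        · simp [f, hw, hw'] at h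
        · simp only [f, hw, hw', dif_neg, not_false_iff] at h
          exact ((hpend w hw).trans (hlift _ _ (SimpleGraph.ConnectedComponent.eq.mp
            (Sum.inl_injective h)))).trans (hpend w' hw').symm
    · rintro ⟨p⟩
      induction p with
      | nil => rfl
      | @cons x y z h p ih =>
        rw [← ih]
        rcases x with ⟨u | w, hx⟩ <;> rcases y with ⟨v | w', hy⟩
        · refine congrArg Sum.inl (SimpleGraph.ConnectedComponent.eq.mpr
            (SimpleGraph.Adj.reachable ?_))
          simpa [addWhiskers] using h
        · have huw : u = w'.1 := by simpa [addWhiskers] using h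
          subst huw
          have : f ⟨Sum.inr w', hy⟩ = Sum.inl ((B.induce Sᶜ).connectedComponentMk
            ⟨w'.1, hl.mp hx⟩) := dif_neg (hl.mp hx)
          exact this.symm
        · have huw : v = w.1 := by simpa [addWhiskers] using h
          subst huw
          exact dif_neg (hl.mp hy)
        · simp [addWhiskers] at h

/-- `S` is a cutset of the graph obtained from `B` by adding whiskers at `W`. -/
def IsWhiskerCutset (B : SimpleGraph V) (W S : Set V) : Prop :=
  ∀ v ∈ S, numComponents B (S \ {v}) + ((S \ {v}) ∩ W).ncard < numComponents B S + (S ∩ W).ncard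

lemma isCutset_addWhiskers [Finite V] (B : SimpleGraph V) (W S : Set V) :
    IsCutset (addWhiskers B W) (Sum.inl '' S) ↔ IsWhiskerCutset B W S := by
  simp only [IsCutset, IsWhiskerCutset, Set.forall_mem_image]
  refine forall₂_congr fun v _ => ?_
  rw [← Set.image_singleton, ← Set.image_sdiff Sum.inl_injective, numComponents_addWhiskers,
    numComponents_addWhiskers]

/-- A pendant vertex has a single neighbour and so cannot reconnect two components; cutsets
therefore live on the original vertices. -/
lemma exists_eq_image_of_isCutset_addWhiskers [Finite V] {B : SimpleGraph V} {W : Set V}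
    {T : Set (V ⊕ W)} (hT : IsCutset (addWhiskers B W) T) : ∃ S, T = Sum.inl '' S := by
  refine ⟨Sum.inl ⁻¹' T, Set.Subset.antisymm ?_ (Set.image_preimage_subset _ _)⟩
  rintro (v | w) hv
  · exact ⟨v, hv, rfl⟩
  · obtain ⟨a, b, ha, hb, hwa, hwb, hne⟩ := (numComponents_diff_lt_iff hv).mp (hT _ hv)
    exfalso
    rcases a with a | a <;> rcases b with b | b <;> simp only [addWhiskers] at hwa hwb
    subst hwa
    subst hwb
    exact hne (SimpleGraph.Reachable.refl _)

/-- The combinatorial form of unmixedness. -/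
def IsCombinatoriallyUnmixed (G : SimpleGraph V) : Prop :=
  ∀ T, IsCutset G T → numComponents G T = T.ncard + numComponents G ∅

lemma isCombinatoriallyUnmixed_iso {G : SimpleGraph V} {G' : SimpleGraph V'} (e : G ≃g G') :
    IsCombinatoriallyUnmixed G ↔ IsCombinatoriallyUnmixed G' := by
  constructor
  · intro h T' hT'
    obtain ⟨T, rfl⟩ := exists_image_eq e.toEquiv T'
    have := h T ((isCutset_iso e T).mp hT')
    have h0 := numComponents_iso e ∅
    rw [Set.image_empty] at h0
    change numComponents G' (e '' T) = (e '' T).ncard + _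
    rw [numComponents_iso e, Set.ncard_image_of_injective _ e.injective, h0, this]
  · intro h T hT
    have := h _ ((isCutset_iso e T).mpr hT)
    have h0 := numComponents_iso e ∅
    rw [Set.image_empty] at h0
    rwa [numComponents_iso e, Set.ncard_image_of_injective _ e.injective, h0] at this

lemma isAccessible_iso {K : Type*} [Field K] [Finite V] [Finite V'] {G : SimpleGraph V}
    {G' : SimpleGraph V'} (e : G ≃g G') (h : IsAccessible K G) : IsAccessible K G' := by
  refine ⟨(isUnmixed_binomialEdgeIdeal_iff G').mpr ((isCombinatoriallyUnmixed_iso e).mp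
    ((isUnmixed_binomialEdgeIdeal_iff G).mp h.1)), fun T' hT' hne => ?_⟩
  obtain ⟨T, rfl⟩ := exists_image_eq e.toEquiv T'
  obtain ⟨t, ht, hcut⟩ := h.2 T ((isCutset_iso e T).mp hT') (Set.image_nonempty.mp hne)
  refine ⟨e t, ⟨t, ht, rfl⟩, ?_⟩
  have := (isCutset_iso e (T \ {t})).mpr hcut
  rw [Set.image_sdiff e.injective, Set.image_singleton] at this
  exact this

/-- Adding whiskers is compatible with isomorphisms. -/
def addWhiskersIso {B : SimpleGraph V} {B' : SimpleGraph V'} (e : B ≃g B') {W : Set V}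
    {W' : Set V'} (hW : ∀ v, v ∈ W ↔ e v ∈ W') : addWhiskers B W ≃g addWhiskers B' W' where
  toEquiv := Equiv.sumCongr e.toEquiv (e.toEquiv.subtypeEquiv hW)
  map_rel_iff' := by
    rintro (a | ⟨a, ha⟩) (b | ⟨b, hb⟩) <;>
      simp [addWhiskers, Equiv.subtypeEquiv]
    exact e.map_adj_iff

end Components

end WhiskeredBlocks

namespace WhiskeredBlocks

/-! ### Component counts as Boolean list programs, and finite codes of graphs. -/

section Lists

/-! ### Counting components of graphs given by lists of edges -/

/-- Boolean membership in a list of natural numbers. -/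
def memB (x : ℕ) (l : List ℕ) : Bool := l.any (Nat.beq x)

/-- The elements of `A` that are not in `T`. -/
def removeB (A T : List ℕ) : List ℕ := A.filter fun x => !memB x T

/-- The number of elements of `T` that are in `W`. -/
def interLength (W T : List ℕ) : ℕ := (T.filter fun x => memB x W).length

/-- Merge the labels of the ends of an edge. -/
def mergeLabel (l : List ℕ) (e : ℕ × ℕ) : List ℕ :=
  l.map fun x => bif Nat.beq x (l.getD e.1 0) then l.getD e.2 0 else x

/-- The number of different entries of a list. -/
def dedupLength : List ℕ → ℕ
  | [] => 0
  | x :: l => bif memB x l then dedupLength l else dedupLength l + 1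

/-- The labels after merging along all edges with both ends in `A`. -/
def finalLabels (N : ℕ) (E : List (ℕ × ℕ)) (A : List ℕ) : List ℕ :=
  (E.filter fun e => memB e.1 A && memB e.2 A).foldl mergeLabel (List.range N)

/-- The number of components of the graph induced on `A` by the edges in `E`. -/
def compCount (N : ℕ) (E : List (ℕ × ℕ)) (A : List ℕ) : ℕ :=
  dedupLength (A.map fun v => (finalLabels N E A).getD v 0)

/-- The graph on `ℕ` with the given edges. -/
def listGraph (E : List (ℕ × ℕ)) : SimpleGraph ℕ := SimpleGraph.fromRel fun a b => (a, b) ∈ E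

lemma memB_iff {x : ℕ} {l : List ℕ} : memB x l = true ↔ x ∈ l := by
  simp [memB, Nat.beq_eq]

lemma mem_removeB {A T : List ℕ} {x : ℕ} : x ∈ removeB A T ↔ x ∈ A ∧ x ∉ T := by
  simp [removeB, ← memB_iff]

lemma dedupLength_eq (l : List ℕ) : dedupLength l = l.toFinset.card := by
  induction l with
  | nil => rfl
  | cons x l ih =>
    by_cases h : x ∈ l
    · rw [dedupLength, memB_iff.mpr h, cond_true, ih, List.toFinset_cons,
        Finset.insert_eq_of_mem (List.mem_toFinset.mpr h)]
    · have : memB x l = false := by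
        rw [← Bool.not_eq_true, memB_iff]; exact h
      rw [dedupLength, this, cond_false, ih, List.toFinset_cons,
        Finset.card_insert_of_notMem (by simpa using h)]

lemma mergeLabel_getD {l : List ℕ} {e : ℕ × ℕ} {i : ℕ} (hi : i < l.length) :
    (mergeLabel l e).getD i 0 =
      if l.getD i 0 = l.getD e.1 0 then l.getD e.2 0 else l.getD i 0 := by
  rw [mergeLabel, List.getD_eq_getElem _ _ (by simpa using hi), List.getElem_map,
    List.getD_eq_getElem _ _ hi]
  by_cases h : l[i] = l.getD e.1 0
  · rw [if_pos h, Nat.beq_eq.mpr h, cond_true]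
  · have h' : Nat.beq l[i] (l.getD e.1 0) = false := by
      rw [← Bool.not_eq_true, Nat.beq_eq]; exact h
    rw [if_neg h, h', cond_false]

/-- The last three clauses say that equality of final labels is the equivalence relation generated
by the initial labels and the edges. Its minimality is stated against every relation `R`, which lets
the induction pass to the rest of the list directly. -/
lemma foldl_mergeLabel {N : ℕ} (E : List (ℕ × ℕ)) : ∀ l : List ℕ, l.length = N →
    (∀ e ∈ E, e.1 < N ∧ e.2 < N) →
    (E.foldl mergeLabel l).length = N ∧
    (∀ i j, i < N → j < N → l.getD i 0 = l.getD j 0 →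
      (E.foldl mergeLabel l).getD i 0 = (E.foldl mergeLabel l).getD j 0) ∧
    (∀ e ∈ E, (E.foldl mergeLabel l).getD e.1 0 = (E.foldl mergeLabel l).getD e.2 0) ∧
    ∀ R : ℕ → ℕ → Prop, Equivalence R → (∀ i j, i < N → j < N → l.getD i 0 = l.getD j 0 → R i j) →
      (∀ e ∈ E, R e.1 e.2) → ∀ i j, i < N → j < N →
        (E.foldl mergeLabel l).getD i 0 = (E.foldl mergeLabel l).getD j 0 → R i j := by
  induction E with
  | nil => intro l hl _; simpa using hl
  | cons e E ih =>
    intro l hl hE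
    have hlen : (mergeLabel l e).length = N := by simpa [mergeLabel] using hl
    obtain ⟨h1, h2, h3, h4⟩ := ih (mergeLabel l e) hlen fun e' he' =>
      hE e' (List.mem_cons_of_mem e he')
    have he := hE e List.mem_cons_self
    have hm : ∀ i, i < N → (mergeLabel l e).getD i 0 =
        if l.getD i 0 = l.getD e.1 0 then l.getD e.2 0 else l.getD i 0 := fun i hi =>
      mergeLabel_getD (hl ▸ hi)
    rw [List.foldl_cons]
    refine ⟨h1, fun i j hi hj h => h2 i j hi hj ?_, ?_, ?_⟩
    · rw [hm i hi, hm j hj, h]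
    · intro e' he'
      rcases List.mem_cons.mp he' with rfl | he'
      · refine h2 _ _ he.1 he.2 ?_
        rw [hm _ he.1, hm _ he.2, if_pos rfl]
        split_ifs <;> rfl
      · exact h3 e' he'
    · intro R hR hlR hER
      refine h4 R hR (fun i j hi hj h => ?_) fun e' he' => hER e' (List.mem_cons_of_mem e he')
      rw [hm i hi, hm j hj] at h
      have hee := hER e List.mem_cons_self
      split_ifs at h with ha hb hb
      · exact hR.trans (hlR _ _ hi he.1 ha) (hR.symm (hlR _ _ hj he.1 hb))
      · exact hR.trans (hR.trans (hlR _ _ hi he.1 ha) hee) (hlR _ _ he.2 hj h)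
      · exact hR.symm (hR.trans (hR.trans (hlR _ _ hj he.1 hb) hee) (hlR _ _ he.2 hi h.symm))
      · exact hlR _ _ hi hj h

lemma numComponents_listGraph {N : ℕ} {E : List (ℕ × ℕ)} {A : List ℕ}
    (hE : ∀ e ∈ E, e.1 < N ∧ e.2 < N) (hA : ∀ a ∈ A, a < N) :
    numComponents (listGraph E) {v | v ∉ A} = compCount N E A := by
  have hmem : ∀ u : ({v | v ∉ A}ᶜ : Set ℕ), u.1 ∈ A := fun u => not_not.mp u.2
  obtain ⟨-, -, h3, h4⟩ := foldl_mergeLabel (N := N)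
    (E.filter fun e => memB e.1 A && memB e.2 A) (List.range N) List.length_range
    fun e he => hE e (List.mem_of_mem_filter he)
  have hE' : ∀ e, e ∈ E.filter (fun e => memB e.1 A && memB e.2 A) ↔
      e ∈ E ∧ e.1 ∈ A ∧ e.2 ∈ A := by
    intro e; rw [List.mem_filter, Bool.and_eq_true, memB_iff, memB_iff]
  let L : ℕ → ℕ := fun v => (finalLabels N E A).getD v 0
  have hX : Nat.card ((A.map L).toFinset : Set ℕ) = compCount N E A := by
    rw [Nat.card_coe_set_eq, Set.ncard_coe_finset, compCount, dedupLength_eq]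
  rw [← hX]
  refine numComponents_eq_card_of_label
    (fun u => (⟨L u, List.mem_toFinset.mpr (List.mem_map_of_mem (hmem u))⟩ :
      ((A.map L).toFinset : Set ℕ))) ?_ ?_
  · rintro ⟨x, hx⟩
    obtain ⟨a, ha, rfl⟩ := List.mem_map.mp (List.mem_toFinset.mp hx)
    exact ⟨⟨a, fun h => h ha⟩, rfl⟩
  · intro u v
    rw [Subtype.mk.injEq]
    constructor
    · intro h
      -- The disjunct a = b makes the relation reflexive on all of `ℕ`, including the numbers
      -- outside `A`.
      let R : ℕ → ℕ → Prop := fun a b => a = b ∨ ∃ (ha : a ∈ A) (hb : b ∈ A),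
        ((listGraph E).induce {v | v ∉ A}ᶜ).Reachable ⟨a, fun h => h ha⟩ ⟨b, fun h => h hb⟩
      have hR : Equivalence R := by
        refine ⟨fun a => Or.inl rfl, ?_, ?_⟩
        · rintro a b (h | ⟨ha, hb, h⟩)
          · exact Or.inl h.symm
          · exact Or.inr ⟨hb, ha, h.symm⟩
        · rintro a b c (rfl | ⟨ha, hb, h⟩) (rfl | ⟨hb', hc, h'⟩)
          · exact Or.inl rfl
          · exact Or.inr ⟨hb', hc, h'⟩
          · exact Or.inr ⟨ha, hb, h⟩
          · exact Or.inr ⟨ha, hc, h.trans h'⟩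
      have := h4 R hR ?_ ?_ u v (hA _ (hmem u)) (hA _ (hmem v)) h
      · rcases this with h | ⟨_, _, h⟩
        · rw [Subtype.ext h]
        · exact h
      · intro i j hi hj hij
        left
        rw [List.getD_eq_getElem _ _ (by simpa using hi),
          List.getD_eq_getElem _ _ (by simpa using hj)] at hij
        simpa using hij
      · intro e he
        obtain ⟨he, h1, h2⟩ := (hE' e).mp he
        by_cases h : e.1 = e.2
        · exact Or.inl h
        · refine Or.inr ⟨h1, h2, SimpleGraph.Adj.reachable ?_⟩
          simp [listGraph, h, he]
    · rintro ⟨p⟩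
      induction p with
      | nil => rfl
      | @cons x y z h p ih =>
        rw [← ih]
        have h' : (listGraph E).Adj x.1 y.1 := by simpa using h
        rw [listGraph, SimpleGraph.fromRel_adj] at h'
        rcases h'.2 with h' | h'
        · exact h3 (x.1, y.1) ((hE' _).mpr ⟨h', hmem x, hmem y⟩)
        · exact (h3 (y.1, x.1) ((hE' _).mpr ⟨h', hmem y, hmem x⟩)).symm

/-! ### Coded graphs -/

variable {V : Type*}

/-- `f` contracts the graph `B` onto the graph with vertices `A` and edges `E`; the fibres over `F`
are single vertices. -/
structure IsCoding (B : SimpleGraph V) (f : V → ℕ) (N : ℕ) (E : List (ℕ × ℕ)) (A F : List ℕ) :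
    Prop where
  edge_lt : ∀ e ∈ E, e.1 < N ∧ e.2 < N
  lt : ∀ a ∈ A, a < N
  mem : ∀ v, f v ∈ A
  surj : ∀ a ∈ A, ∃ v, f v = a
  adj : ∀ u v, B.Adj u v → f u = f v ∨ (f u, f v) ∈ E ∨ (f v, f u) ∈ E
  lift : ∀ e ∈ E, ∃ u v, f u = e.1 ∧ f v = e.2 ∧ B.Adj u v
  fib : ∀ u v, f u = f v → ∃ w : B.Walk u v, ∀ x ∈ w.support, f x = f u
  sub : ∀ a ∈ F, a ∈ A
  inj : ∀ u v, f u ∈ F → f u = f v → u = v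

namespace IsCoding

variable {B : SimpleGraph V} {f : V → ℕ} {N : ℕ} {E : List (ℕ × ℕ)} {A F : List ℕ}

/-- Deleting a union of fibres commutes with contracting the fibres, since the fibres that remain
are connected. -/
lemma numComponents_eq (h : IsCoding B f N E A F) (T : List ℕ) :
    numComponents B {v | f v ∈ T} = compCount N E (removeB A T) := by
  rw [← numComponents_listGraph h.edge_lt fun a ha => h.lt a (mem_removeB.mp ha).1]
  refine numComponents_eq_of_contraction f ?_ ?_ ?_ ?_ ?_
  · intro v
    have := h.mem v
    simp only [Set.mem_ofPred_eq, mem_removeB]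
    tauto
  · intro u v _ _ huv
    rw [listGraph, SimpleGraph.fromRel_adj]
    have := h.adj u v huv
    tauto
  · intro a ha
    exact h.surj a (mem_removeB.mp (not_not.mp ha)).1
  · intro a b _ _ hab
    rw [listGraph, SimpleGraph.fromRel_adj] at hab
    rcases hab.2 with hab | hab
    · exact h.lift _ hab
    · obtain ⟨u, v, hu, hv, huv⟩ := h.lift _ hab
      exact ⟨v, u, hv, hu, huv.symm⟩
  · intro u v hu hv huv
    obtain ⟨w, hw⟩ := h.fib u v huv
    have hwT : ∀ x ∈ w.support, x ∈ ({v | f v ∈ T}ᶜ : Set V) := by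
      intro x hx hxT
      change f x ∈ T at hxT
      rw [hw x hx] at hxT
      exact hu hxT
    exact ⟨w.induce _ hwT⟩

lemma ncard_eq (h : IsCoding B f N E A F) {T : List ℕ} (hT : T.Nodup) (hTF : ∀ a ∈ T, a ∈ F)
    {S : Set V} (hS : ∀ v, v ∈ S ↔ f v ∈ T) : S.ncard = T.length := by
  have hinj : Set.InjOn f S := fun u hu v _ huv => h.inj u v (hTF _ ((hS u).mp hu)) huv
  rw [← hinj.ncard_image, ← List.toFinset_card_of_nodup hT, ← Set.ncard_coe_finset]
  congr 1
  ext a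
  simp only [Set.mem_image, List.coe_toFinset, Set.mem_ofPred_eq]
  constructor
  · rintro ⟨v, hv, rfl⟩
    exact (hS v).mp hv
  · intro ha
    obtain ⟨v, rfl⟩ := h.surj a (h.sub a (hTF a ha))
    exact ⟨v, (hS v).mpr ha, rfl⟩

lemma ncard_inter_eq (h : IsCoding B f N E A F) {T : List ℕ} (hT : T.Nodup)
    (hTF : ∀ a ∈ T, a ∈ F) {W : Set V} {w : List ℕ} (hw : ∀ v, f v ∈ F → (v ∈ W ↔ f v ∈ w)) :
    ({v | f v ∈ T} ∩ W).ncard = interLength w T := by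
  refine h.ncard_eq (hT.filter _) (fun a ha => hTF a (List.mem_of_mem_filter ha)) fun v => ?_
  rw [List.mem_filter, memB_iff, Set.mem_inter_iff, Set.mem_ofPred_eq]
  exact and_congr_right fun hv => hw v (hTF _ hv)

end IsCoding

/-- Boolean test for cutsets of a coded graph with whiskers. -/
def cutB (N : ℕ) (E : List (ℕ × ℕ)) (A W T : List ℕ) : Bool :=
  T.all fun v => Nat.blt
    (compCount N E (removeB A (removeB T [v])) + interLength W (removeB T [v]))
    (compCount N E (removeB A T) + interLength W T)

/-- Boolean test for the number of components required by unmixedness. -/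
def tightB (N : ℕ) (E : List (ℕ × ℕ)) (A W T : List ℕ) : Bool :=
  Nat.beq (compCount N E (removeB A T) + interLength W T) (T.length + 1)

/-- Boolean test for the unmixedness condition at `T`. -/
def unmixedB (N : ℕ) (E : List (ℕ × ℕ)) (A W T : List ℕ) : Bool :=
  !cutB N E A W T || tightB N E A W T

namespace IsCoding

variable {B : SimpleGraph V} {f : V → ℕ} {N : ℕ} {E : List (ℕ × ℕ)} {A F : List ℕ}

lemma cutB_iff (h : IsCoding B f N E A F) {T : List ℕ} (hT : T.Nodup)
    (hTF : ∀ a ∈ T, a ∈ F) {W : Set V} {w : List ℕ} (hw : ∀ v, f v ∈ F → (v ∈ W ↔ f v ∈ w)) :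
    cutB N E A w T = true ↔ IsWhiskerCutset B W {v | f v ∈ T} := by
  -- Removing one vertex amounts to removing one code because the fibres over `F` are single
  -- vertices.
  have key : ∀ v, ({v | f v ∈ T} : Set V) \ {v} = {u | f u ∈ removeB T [f v]} ∨ f v ∉ T := by
    intro v
    by_cases hv : f v ∈ T
    · left
      ext u
      simp only [Set.mem_sdiff, Set.mem_ofPred_eq, Set.mem_singleton_iff, mem_removeB,
        List.mem_singleton]
      refine and_congr_right fun hu => not_congr ⟨fun h => h ▸ rfl, fun hfu => ?_⟩
      exact h.inj u v (hTF _ hu) hfu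
    · exact Or.inr hv
  rw [cutB, List.all_eq_true, IsWhiskerCutset]
  have e0 := h.numComponents_eq T
  have e1 := h.ncard_inter_eq hT hTF hw
  have e2 : ∀ v, f v ∈ T → (numComponents B ({v | f v ∈ T} \ {v}) +
      (({v | f v ∈ T} \ {v}) ∩ W).ncard = compCount N E (removeB A (removeB T [f v])) +
        interLength w (removeB T [f v])) := by
    intro v hv
    have hT' : (removeB T [f v]).Nodup := hT.filter _
    rw [(key v).resolve_right (not_not.mpr hv), h.numComponents_eq, h.ncard_inter_eq hT'
      (fun a ha => hTF a (mem_removeB.mp ha).1) hw]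
  constructor
  · intro hc v hv
    rw [e2 v hv, e0, e1]
    exact Nat.le_of_ble_eq_true (hc _ hv)
  · intro hc a ha
    obtain ⟨v, rfl⟩ := h.surj a (h.sub a (hTF a ha))
    have := hc v ha
    rw [e2 v ha, e0, e1] at this
    exact Nat.ble_eq_true_of_le this

lemma tightB_iff (h : IsCoding B f N E A F) {T : List ℕ} (hT : T.Nodup)
    (hTF : ∀ a ∈ T, a ∈ F) {W : Set V} {w : List ℕ} (hw : ∀ v, f v ∈ F → (v ∈ W ↔ f v ∈ w)) :
    tightB N E A w T = true ↔ numComponents B {v | f v ∈ T} + ({v | f v ∈ T} ∩ W).ncard =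
      ({v | f v ∈ T} : Set V).ncard + 1 := by
  rw [tightB, Nat.beq_eq, h.numComponents_eq T, h.ncard_inter_eq hT hTF hw,
    h.ncard_eq hT hTF (S := {v | f v ∈ T}) fun v => Iff.rfl]

end IsCoding

lemma numComponents_empty_of_connected {B : SimpleGraph V} (hB : B.Connected) :
    numComponents B ∅ = 1 := by
  obtain ⟨v⟩ := hB.nonempty
  rw [numComponents_eq_card_of_label (X := Unit) (fun _ => ())]
  · simp
  · exact fun _ => ⟨⟨v, by simp⟩, rfl⟩
  · rintro ⟨u, hu⟩ ⟨v, hv⟩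
    obtain ⟨w⟩ := hB.preconnected u v
    exact ⟨fun _ => ⟨w.induce _ fun x _ => Set.notMem_empty x⟩, fun _ => rfl⟩

/-- A connected block with whiskers has one component before any removal; this is the `+ 1` in
`tightB`. -/
lemma IsCoding.unmixedB_eq_true [Finite V] {B : SimpleGraph V} {f : V → ℕ} {N : ℕ}
    {E : List (ℕ × ℕ)} {A F : List ℕ} (h : IsCoding B f N E A F) (hB : B.Connected)
    {W : Set V} {w : List ℕ} (hw : ∀ v, f v ∈ F → (v ∈ W ↔ f v ∈ w))
    (hu : IsCombinatoriallyUnmixed (addWhiskers B W)) {T : List ℕ} (hT : T.Nodup)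
    (hTF : ∀ a ∈ T, a ∈ F) : unmixedB N E A w T = true := by
  rw [unmixedB, Bool.or_eq_true, Bool.not_eq_true', ← Bool.not_eq_true, ← imp_iff_not_or,
    h.cutB_iff hT hTF hw, h.tightB_iff hT hTF hw]
  intro hc
  have h1 := hu _ ((isCutset_addWhiskers B W _).mpr hc)
  have h2 := numComponents_addWhiskers B W ∅
  rw [Set.image_empty, Set.empty_inter, Set.ncard_empty, numComponents_empty_of_connected hB]
    at h2
  rw [numComponents_addWhiskers, Set.ncard_image_of_injective _ Sum.inl_injective, h2] at h1
  exact h1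

end Lists
end WhiskeredBlocks

namespace WhiskeredBlocks

/-! ### Lines of a block, and its reconstruction as a subdivision of K₄. -/

section Lines

variable {β : Type*} {B : SimpleGraph β}

/-! ### Lines -/

namespace IsLine

variable {a b : β} {L : B.Walk a b}

lemma not_isPivotal (h : IsLine B L) {s : ℕ} (h0 : 0 < s) (hs : s < L.length) :
    ¬ IsPivotal B (L.getVert s) := by
  refine h.2.2.2 _ (L.getVert_mem_support s) (fun h' => ?_) fun h' => ?_
  · have := h.1.getVert_injOn (show s ∈ {i | i ≤ L.length} from hs.le)
      (show 0 ∈ {i | i ≤ L.length} from Nat.zero_le _) (h'.trans L.getVert_zero.symm)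
    omega
  · have := h.1.getVert_injOn (show s ∈ {i | i ≤ L.length} from hs.le)
      (show L.length ∈ {i | i ≤ L.length} from le_refl L.length) (h'.trans L.getVert_length.symm)
    omega

lemma eq_or_eq_of_isPivotal (h : IsLine B L) {v : β} (hv : v ∈ L.support) (hp : IsPivotal B v) :
    v = a ∨ v = b := by
  by_contra hcon
  rw [not_or] at hcon
  exact h.2.2.2 v hv hcon.1 hcon.2 hp

/-- The two neighbours along the path already exhaust the degree of an interior vertex, as a third
one would make it pivotal. -/
lemma eq_or_eq_of_adj [Finite β] (h : IsLine B L) {s : ℕ} (h0 : 0 < s) (hs : s < L.length) {y : β}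
    (hy : B.Adj (L.getVert s) y) : y = L.getVert (s - 1) ∨ y = L.getVert (s + 1) := by
  by_contra hcon
  rw [not_or] at hcon
  refine h.not_isPivotal h0 hs ?_
  have h1 : B.Adj (L.getVert s) (L.getVert (s - 1)) := by
    have := L.adj_getVert_succ (i := s - 1) (by omega)
    rw [Nat.sub_add_cancel h0] at this
    exact this.symm
  have h2 : B.Adj (L.getVert s) (L.getVert (s + 1)) := L.adj_getVert_succ hs
  have hne : L.getVert (s - 1) ≠ L.getVert (s + 1) := by
    intro h'
    have := h.1.getVert_injOn (show s - 1 ∈ {i | i ≤ L.length} by simp; omega)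
      (show s + 1 ∈ {i | i ≤ L.length} from hs) h'
    omega
  rw [IsPivotal, deg]
  have hsub : ({L.getVert (s - 1), L.getVert (s + 1), y} : Set β) ⊆
      B.neighborSet (L.getVert s) := by
    rintro x (rfl | rfl | rfl)
    · exact h1
    · exact h2
    · exact hy
  have hcard := Set.ncard_eq_three.mpr
    ⟨_, _, _, hne, fun h => hcon.1 h.symm, fun h => hcon.2 h.symm,
      rfl (a := ({L.getVert (s - 1), L.getVert (s + 1), y} : Set β))⟩
  rw [← hcard]
  exact Set.ncard_le_ncard hsub (Set.toFinite _)

lemma exists_interior (h : IsLine B L) {v : β} (hv : v ∈ L.support) (hp : ¬ IsPivotal B v) :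
    ∃ s, 0 < s ∧ s < L.length ∧ L.getVert s = v := by
  obtain ⟨s, hs, hle⟩ := SimpleGraph.Walk.mem_support_iff_exists_getVert.mp hv
  refine ⟨s, ?_, ?_, hs⟩
  · rcases Nat.eq_zero_or_pos s with rfl | h0
    · rw [L.getVert_zero] at hs
      exact absurd (hs ▸ h.2.1) hp
    · exact h0
  · rcases hle.lt_or_eq with h1 | rfl
    · exact h1
    · rw [L.getVert_length] at hs
      exact absurd (hs ▸ h.2.2.1) hp

lemma mem_support_of_adj [Finite β] (h : IsLine B L) {v y : β} (hv : v ∈ L.support)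
    (hp : ¬ IsPivotal B v) (hy : B.Adj v y) : y ∈ L.support := by
  obtain ⟨s, h0, hs, rfl⟩ := h.exists_interior hv hp
  rcases h.eq_or_eq_of_adj h0 hs hy with rfl | rfl <;> exact L.getVert_mem_support _

/-- A line that meets another line in an interior vertex ends on it. -/
lemma end_mem_support [Finite β] (h : IsLine B L) {c d : β} {M : B.Walk c d} (hM : IsLine B M)
    {t : ℕ} (h0 : 0 < t) (ht : t < M.length) (hmem : M.getVert t ∈ L.support) :
    d = a ∨ d = b := by
  have key : ∀ n, t + n ≤ M.length → M.getVert (t + n) ∈ L.support := by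
    intro n
    induction n with
    | zero => exact fun _ => hmem
    | succ n ih =>
      intro hn
      exact h.mem_support_of_adj (ih (by omega)) (hM.not_isPivotal (by omega) (by omega))
        (M.adj_getVert_succ (by omega))
  have := key (M.length - t) (by omega)
  rw [Nat.add_sub_cancel' ht.le, M.getVert_length] at this
  exact h.eq_or_eq_of_isPivotal this hM.2.2.1

lemma reverse (h : IsLine B L) : IsLine B L.reverse :=
  ⟨h.1.reverse, h.2.2.1, h.2.1, fun v hv h1 h2 => h.2.2.2 v (by simpa using hv) h2 h1⟩

lemma start_mem_support [Finite β] (h : IsLine B L) {c d : β} {M : B.Walk c d} (hM : IsLine B M)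
    {t : ℕ} (h0 : 0 < t) (ht : t < M.length) (hmem : M.getVert t ∈ L.support) :
    c = a ∨ c = b := by
  refine h.end_mem_support hM.reverse (t := M.length - t) (by omega) (by simp; omega) ?_
  rwa [SimpleGraph.Walk.getVert_reverse, Nat.sub_sub_self ht.le]

end IsLine

/-! ### Pivotal vertices with chosen lines -/

/-- Four pivotal vertices with chosen lines between them. -/
structure IsK4Lines (B : SimpleGraph β) (p : Fin 4 → β) (L : ∀ i j, B.Walk (p i) (p j)) :
    Prop where
  inj : Function.Injective p
  piv : ∀ v, IsPivotal B v ↔ v ∈ Set.range p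
  deg_eq : ∀ i, deg B (p i) = 3
  line : ∀ i j, i ≠ j → IsLine B (L i j)
  rev : ∀ i j, i ≠ j → L j i = (L i j).reverse

lemma IsSubdividedK4Block.exists_lines (h : IsSubdividedK4Block B) :
    ∃ p L, IsK4Lines B p L := by
  classical
  obtain ⟨p, hinj, hpiv, hdeg, hl, -⟩ := h.lines
  choose M hM using hl
  refine ⟨p, fun i j => if h : i < j then M i j h.ne else if h' : j < i then
    (M j i h'.ne).reverse else (SimpleGraph.Walk.nil : B.Walk (p i) (p i)).copy rfl
      (congrArg p (le_antisymm (not_lt.mp h') (not_lt.mp h))), hinj, hpiv, hdeg, ?_, ?_⟩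
  · intro i j hij
    rcases lt_or_gt_of_ne hij with h | h
    · simp only [h, dif_pos]
      exact hM _ _ _
    · simp only [h, not_lt_of_gt h, dif_pos, dif_neg, not_false_iff]
      exact (hM _ _ _).reverse
  · intro i j hij
    rcases lt_or_gt_of_ne hij with h | h
    · simp [h, not_lt_of_gt h]
    · simp [h, not_lt_of_gt h]

namespace IsK4Lines

variable {p : Fin 4 → β} {L : ∀ i j, B.Walk (p i) (p j)}

lemma perm (h : IsK4Lines B p L) (σ : Equiv.Perm (Fin 4)) :
    IsK4Lines B (p ∘ σ) fun i j => L (σ i) (σ j) where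
  inj := h.inj.comp σ.injective
  piv v := by rw [h.piv, σ.surjective.range_comp]
  deg_eq i := h.deg_eq _
  line i j hij := h.line _ _ (σ.injective.ne hij)
  rev i j hij := h.rev _ _ (σ.injective.ne hij)

lemma length_comm (h : IsK4Lines B p L) {i j : Fin 4} (hij : i ≠ j) :
    (L j i).length = (L i j).length := by
  rw [h.rev i j hij, SimpleGraph.Walk.length_reverse]

lemma length_pos (h : IsK4Lines B p L) {i j : Fin 4} (hij : i ≠ j) : 0 < (L i j).length := by
  rw [Nat.pos_iff_ne_zero]
  intro h0
  exact hij (h.inj (SimpleGraph.Walk.eq_of_length_eq_zero h0))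

lemma isPivotal (h : IsK4Lines B p L) (i : Fin 4) : IsPivotal B (p i) :=
  (h.piv _).mpr ⟨i, rfl⟩

/-- From a shared interior vertex, both directions must be followed along the other line until a
pivotal vertex is met, so the ends agree. -/
lemma pair_eq [Finite β] (h : IsK4Lines B p L) {i j i' j' : Fin 4} (hij : i ≠ j)
    (hij' : i' ≠ j') {t : ℕ} (h0 : 0 < t) (ht : t < (L i' j').length)
    (hmem : (L i' j').getVert t ∈ (L i j).support) : (i' = i ∨ i' = j) ∧ (j' = i ∨ j' = j) := by
  have h1 := (h.line i j hij).start_mem_support (h.line _ _ hij') h0 ht hmem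
  have h2 := (h.line i j hij).end_mem_support (h.line _ _ hij') h0 ht hmem
  simpa [h.inj.eq_iff] using And.intro h1 h2

lemma getVert_one_injective [Finite β] (h : IsK4Lines B p L) {i j j' : Fin 4} (hj : i ≠ j)
    (hj' : i ≠ j') (heq : (L i j).getVert 1 = (L i j').getVert 1) : j = j' := by
  have h1 := h.length_pos hj
  have h2 := h.length_pos hj'
  rcases Nat.lt_or_ge 1 (L i j).length with h3 | h3
  · have := (h.pair_eq hj' hj one_pos h3 (heq ▸ SimpleGraph.Walk.getVert_mem_support _ _)).2
    rcases this with h4 | h4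
    · exact absurd h4.symm hj
    · exact h4
  rcases Nat.lt_or_ge 1 (L i j').length with h4 | h4
  · have := (h.pair_eq hj hj' one_pos h4 (heq ▸ SimpleGraph.Walk.getVert_mem_support _ _)).2
    rcases this with h4 | h4
    · exact absurd h4.symm hj'
    · exact h4.symm
  · rw [SimpleGraph.Walk.getVert_of_length_le _ h3, SimpleGraph.Walk.getVert_of_length_le _ h4]
      at heq
    exact h.inj heq

/-- The three lines leaving a pivotal vertex start with distinct edges, and the degree is three, so
nothing else is adjacent to it. -/
lemma exists_getVert_one_eq [Finite β] (h : IsK4Lines B p L) {i : Fin 4} {y : β}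
    (hy : B.Adj (p i) y) : ∃ j, i ≠ j ∧ y = (L i j).getVert 1 := by
  classical
  let S : Finset (Fin 4) := Finset.univ.erase i
  let g : Fin 4 → β := fun j => (L i j).getVert 1
  have hinj : Set.InjOn g (S : Set (Fin 4)) := by
    intro j hj j' hj' heq
    have hj1 : i ≠ j := by simpa [S, eq_comm] using hj
    have hj2 : i ≠ j' := by simpa [S, eq_comm] using hj'
    exact h.getVert_one_injective hj1 hj2 heq
  have hcard : (g '' (S : Set (Fin 4))).ncard = 3 := by
    rw [hinj.ncard_image, Set.ncard_coe_finset, Finset.card_erase_of_mem (Finset.mem_univ i)]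
    simp
  have hsub : g '' (S : Set (Fin 4)) ⊆ B.neighborSet (p i) := by
    rintro _ ⟨j, hj, rfl⟩
    have hj1 : i ≠ j := by simpa [S, eq_comm] using hj
    have := (L i j).adj_getVert_succ (h.length_pos hj1)
    rwa [SimpleGraph.Walk.getVert_zero] at this
  have heq := Set.eq_of_subset_of_ncard_le hsub (by
    rw [hcard]; exact (h.deg_eq i).le) (Set.toFinite _)
  have hmem : y ∈ g '' (S : Set (Fin 4)) := heq ▸ hy
  obtain ⟨j, hj, rfl⟩ := hmem
  exact ⟨j, by simpa [S, eq_comm] using hj, rfl⟩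

end IsK4Lines

/-! ### Subdivisions of `K₄` with given lengths -/

/-- The first end of an edge of `K₄`. -/
def edgeSrc : Fin 6 → Fin 4 := ![0, 0, 0, 1, 1, 2]

/-- The second end of an edge of `K₄`. -/
def edgeTgt : Fin 6 → Fin 4 := ![1, 2, 3, 2, 3, 3]

lemma edgeSrc_ne_edgeTgt : ∀ e, edgeSrc e ≠ edgeTgt e := by decide

lemma edge_eq_of_ends : ∀ e e' : Fin 6, (edgeSrc e' = edgeSrc e ∨ edgeSrc e' = edgeTgt e) →
    (edgeTgt e' = edgeSrc e ∨ edgeTgt e' = edgeTgt e) → e = e' := by decide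

lemma exists_edge : ∀ i j : Fin 4, i ≠ j →
    ∃ e, (edgeSrc e = i ∧ edgeTgt e = j) ∨ (edgeSrc e = j ∧ edgeTgt e = i) := by decide

/-- The vertices of the subdivision of `K₄` with lines of lengths `k`. -/
abbrev SubVertex (k : Fin 6 → ℕ) : Type := Fin 4 ⊕ Σ e : Fin 6, Fin (k e - 1)

/-- The vertex at position `s` on the line `e`. -/
def linePos (k : Fin 6 → ℕ) (e : Fin 6) (s : ℕ) : SubVertex k :=
  if h0 : s = 0 then Sum.inl (edgeSrc e)
  else if h : s < k e then Sum.inr ⟨e, s - 1, by omega⟩ else Sum.inl (edgeTgt e)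

/-- The subdivision of `K₄` with lines of lengths `k`. -/
def subdivision (k : Fin 6 → ℕ) : SimpleGraph (SubVertex k) :=
  SimpleGraph.fromRel fun u v => ∃ e s, s < k e ∧ u = linePos k e s ∧ v = linePos k e (s + 1)

lemma linePos_zero (k : Fin 6 → ℕ) (e : Fin 6) : linePos k e 0 = Sum.inl (edgeSrc e) := rfl

lemma linePos_interior {k : Fin 6 → ℕ} {e : Fin 6} {s : ℕ} (h0 : 0 < s) (h : s < k e) :
    linePos k e s = Sum.inr ⟨e, s - 1, by omega⟩ := by
  rw [linePos, dif_neg h0.ne', dif_pos h]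

lemma linePos_end {k : Fin 6 → ℕ} (e : Fin 6) (h : 0 < k e) :
    linePos k e (k e) = Sum.inl (edgeTgt e) := by
  rw [linePos, dif_neg h.ne', dif_neg (lt_irrefl _)]

lemma inr_eq_linePos {k : Fin 6 → ℕ} (e : Fin 6) (s : Fin (k e - 1)) :
    (Sum.inr ⟨e, s⟩ : SubVertex k) = linePos k e (s + 1) := by
  rw [linePos_interior (Nat.succ_pos _) (by omega)]
  rfl

namespace IsK4Lines

variable {p : Fin 4 → β} {L : ∀ i j, B.Walk (p i) (p j)}

/-- The lengths of the lines. -/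
def lengths (L : ∀ i j, B.Walk (p i) (p j)) (e : Fin 6) : ℕ := (L (edgeSrc e) (edgeTgt e)).length

/-- The vertex of `B` corresponding to a vertex of the subdivision. -/
def toVertex (L : ∀ i j, B.Walk (p i) (p j)) : SubVertex (lengths L) → β
  | Sum.inl i => p i
  | Sum.inr ⟨e, s⟩ => (L (edgeSrc e) (edgeTgt e)).getVert (s + 1)

lemma toVertex_linePos (h : IsK4Lines B p L) (e : Fin 6) {s : ℕ} (hs : s ≤ lengths L e) :
    toVertex L (linePos (lengths L) e s) = (L (edgeSrc e) (edgeTgt e)).getVert s := by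
  have hpos : 0 < lengths L e := h.length_pos (edgeSrc_ne_edgeTgt e)
  rcases Nat.eq_zero_or_pos s with rfl | h0
  · rw [linePos_zero, SimpleGraph.Walk.getVert_zero]; rfl
  · rcases hs.lt_or_eq with h1 | rfl
    · rw [linePos_interior h0 h1]
      change SimpleGraph.Walk.getVert _ (s - 1 + 1) = _
      rw [Nat.sub_add_cancel h0]
    · rw [linePos_end e hpos]
      exact (SimpleGraph.Walk.getVert_length _).symm

/-- Interior vertices are never pivotal, interiors of different lines are disjoint by `pair_eq`, and
a single line is a path. -/
lemma toVertex_injective [Finite β] (h : IsK4Lines B p L) : Function.Injective (toVertex L) := by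
  have hni : ∀ (e : Fin 6) (s : Fin (lengths L e - 1)),
      ¬ IsPivotal B ((L (edgeSrc e) (edgeTgt e)).getVert (s + 1)) := by
    intro e s
    refine (h.line _ _ (edgeSrc_ne_edgeTgt e)).not_isPivotal (Nat.succ_pos _) ?_
    have := s.2
    change _ < lengths L e
    omega
  rintro (i | ⟨e, s⟩) (j | ⟨e', s'⟩) heq
  · exact congrArg Sum.inl (h.inj heq)
  · have hi := h.isPivotal i
    rw [show p i = _ from heq] at hi
    exact absurd hi (hni e' s')
  · have hj := h.isPivotal j
    rw [show p j = _ from heq.symm] at hj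
    exact absurd hj (hni e s)
  · have hs := s.2
    have hs' := s'.2
    have h1 : (s' : ℕ) + 1 < (L (edgeSrc e') (edgeTgt e')).length := by
      change _ < lengths L e'; omega
    have h2 : (s : ℕ) + 1 < (L (edgeSrc e) (edgeTgt e)).length := by
      change _ < lengths L e; omega
    change (L (edgeSrc e) (edgeTgt e)).getVert (s + 1) =
      (L (edgeSrc e') (edgeTgt e')).getVert (s' + 1) at heq
    have hp := h.pair_eq (edgeSrc_ne_edgeTgt e) (edgeSrc_ne_edgeTgt e') (Nat.succ_pos _) h1
      (heq ▸ SimpleGraph.Walk.getVert_mem_support _ _)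
    have := edge_eq_of_ends e e' hp.1 hp.2
    subst this
    have := (h.line _ _ (edgeSrc_ne_edgeTgt e)).1.getVert_injOn
      (show (s : ℕ) + 1 ∈ {i | i ≤ (L (edgeSrc e) (edgeTgt e)).length} from h2.le)
      (show (s' : ℕ) + 1 ∈ {i | i ≤ (L (edgeSrc e) (edgeTgt e)).length} from h1.le) heq
    have : s = s' := Fin.ext (by omega)
    rw [this]

/-- Neighbours of vertices on the lines come from the subdivision. -/
lemma exists_adj_of_adj [Finite β] (h : IsK4Lines B p L) (u : SubVertex (lengths L)) {y : β}
    (hy : B.Adj (toVertex L u) y) :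
    ∃ v, toVertex L v = y ∧ (subdivision (lengths L)).Adj u v := by
  have hpos : ∀ e, 0 < lengths L e := fun e => h.length_pos (edgeSrc_ne_edgeTgt e)
  have hsuff : (∃ e s, s < lengths L e ∧ ((u = linePos _ e s ∧
      toVertex L (linePos _ e (s + 1)) = y) ∨ (u = linePos _ e (s + 1) ∧
      toVertex L (linePos _ e s) = y))) →
      ∃ v, toVertex L v = y ∧ (subdivision (lengths L)).Adj u v := by
    rintro ⟨e, s, hs, ⟨rfl, rfl⟩ | ⟨rfl, rfl⟩⟩
    · refine ⟨_, rfl, ?_⟩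
      rw [subdivision, SimpleGraph.fromRel_adj]
      exact ⟨fun h' => hy.ne (congrArg _ h'), Or.inl ⟨e, s, hs, rfl, rfl⟩⟩
    · refine ⟨_, rfl, ?_⟩
      rw [subdivision, SimpleGraph.fromRel_adj]
      exact ⟨fun h' => hy.ne (congrArg _ h'), Or.inr ⟨e, s, hs, rfl, rfl⟩⟩
  apply hsuff
  rcases u with i | ⟨e, s⟩
  · obtain ⟨j, hij, rfl⟩ := h.exists_getVert_one_eq hy
    obtain ⟨e, ⟨rfl, rfl⟩ | ⟨rfl, rfl⟩⟩ := exists_edge i j hij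
    · exact ⟨e, 0, hpos e, Or.inl ⟨rfl, h.toVertex_linePos e (hpos e)⟩⟩
    · refine ⟨e, lengths L e - 1, Nat.sub_lt (hpos e) one_pos, Or.inr ⟨?_, ?_⟩⟩
      · rw [show lengths L e - 1 + 1 = lengths L e from Nat.sub_add_cancel (hpos e),
          linePos_end e (hpos e)]
      · rw [h.toVertex_linePos e (Nat.sub_le _ _), h.rev _ _ hij.symm,
          SimpleGraph.Walk.getVert_reverse]
        rfl
  · have hs := s.2
    have h2 : (s : ℕ) + 1 < (L (edgeSrc e) (edgeTgt e)).length := by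
      change _ < lengths L e; omega
    have h2' : (s : ℕ) + 1 < lengths L e := h2
    rcases (h.line _ _ (edgeSrc_ne_edgeTgt e)).eq_or_eq_of_adj (Nat.succ_pos _) h2 hy with h3 | h3
    · refine ⟨e, s, by omega, Or.inr ⟨inr_eq_linePos e s, ?_⟩⟩
      rw [h.toVertex_linePos e (by omega), h3]
      rfl
    · refine ⟨e, s + 1, h2, Or.inl ⟨inr_eq_linePos e s, ?_⟩⟩
      rw [h.toVertex_linePos e (by omega), h3]

lemma toVertex_adj [Finite β] (h : IsK4Lines B p L) {u v : SubVertex (lengths L)} :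
    B.Adj (toVertex L u) (toVertex L v) ↔ (subdivision (lengths L)).Adj u v := by
  constructor
  · intro huv
    obtain ⟨v', hv', hadj⟩ := h.exists_adj_of_adj u huv
    rwa [← h.toVertex_injective hv']
  · intro huv
    have key : ∀ e s, s < lengths L e → B.Adj (toVertex L (linePos _ e s))
        (toVertex L (linePos _ e (s + 1))) := by
      intro e s hs
      rw [h.toVertex_linePos e hs.le, h.toVertex_linePos e hs]
      exact SimpleGraph.Walk.adj_getVert_succ _ hs
    rw [subdivision, SimpleGraph.fromRel_adj] at huv
    rcases huv.2 with ⟨e, s, hs, rfl, rfl⟩ | ⟨e, s, hs, rfl, rfl⟩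
    · exact key e s hs
    · exact (key e s hs).symm

/-- The image contains `p 0` and is closed under adjacency by `exists_adj_of_adj`, hence
connectedness makes it everything. -/
lemma toVertex_surjective [Finite β] (h : IsK4Lines B p L) (hB : B.Connected) :
    Function.Surjective (toVertex L) := by
  intro v
  obtain ⟨w⟩ := hB.preconnected (p 0) v
  have key : ∀ x y : β, B.Walk x y → x ∈ Set.range (toVertex L) → y ∈ Set.range (toVertex L) := by
    intro x y w
    induction w with
    | nil => exact id
    | cons hxy _ ih =>
      rintro ⟨u, rfl⟩
      obtain ⟨u', hu', -⟩ := h.exists_adj_of_adj u hxy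
      exact ih ⟨u', hu'⟩
  exact key _ _ w ⟨Sum.inl 0, rfl⟩

/-- A block with chosen lines is a subdivision of `K₄`. -/
noncomputable def iso [Finite β] (h : IsK4Lines B p L) (hB : B.Connected) :
    subdivision (lengths L) ≃g B where
  toEquiv := Equiv.ofBijective (toVertex L) ⟨h.toVertex_injective, h.toVertex_surjective hB⟩
  map_rel_iff' := h.toVertex_adj

end IsK4Lines

end Lines
end WhiskeredBlocks

namespace WhiskeredBlocks

/-! ### Contraction of lines of any length to codes of bounded length. -/

section Patterns

/-! ### Codes for subdivisions of `K₄` -/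

/-- The edges of a line with `m` edges between `i` and `j`, with interior vertices `a`, `b`. -/
def lineEdges (i j a b m : ℕ) : List (ℕ × ℕ) :=
  bif Nat.beq m 1 then [(i, j)] else bif Nat.beq m 2 then [(i, a), (a, j)]
    else [(i, a), (a, b), (b, j)]

/-- The interior vertices of a line with `m` edges. -/
def lineVertices (a b m : ℕ) : List ℕ :=
  bif Nat.beq m 1 then [] else bif Nat.beq m 2 then [a] else [a, b]

/-- The edges of a subdivision of `K₄` with lines of at most three edges. -/
def patternEdges (m : Fin 6 → ℕ) : List (ℕ × ℕ) :=
  [0, 1, 2, 3, 4, 5].flatMap fun e : Fin 6 =>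
    lineEdges (edgeSrc e) (edgeTgt e) (4 + e) (10 + e) (m e)

/-- The vertices of a subdivision of `K₄` with lines of at most three edges. -/
def patternVertices (m : Fin 6 → ℕ) : List ℕ :=
  [0, 1, 2, 3] ++ [0, 1, 2, 3, 4, 5].flatMap fun e : Fin 6 => lineVertices (4 + e) (10 + e) (m e)

/-- Lines of lengths `k` can be contracted to lines of lengths `m`. -/
def IsPattern (m k : Fin 6 → ℕ) : Prop :=
  ∀ e, (m e = 1 ∧ k e = 1) ∨ (m e = 2 ∧ 2 ≤ k e) ∨ (m e = 3 ∧ 3 ≤ k e)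

/-- The code of a vertex of a subdivision. -/
def subCode (m k : Fin 6 → ℕ) : SubVertex k → ℕ
  | Sum.inl i => i
  | Sum.inr ⟨e, s⟩ => if s.val = 0 ∨ m e ≤ 2 then 4 + e else 10 + e

@[simp] lemma lineEdges_one (i j a b : ℕ) : lineEdges i j a b 1 = [(i, j)] := rfl

@[simp] lemma lineEdges_two (i j a b : ℕ) : lineEdges i j a b 2 = [(i, a), (a, j)] := rfl

@[simp] lemma lineEdges_three (i j a b : ℕ) : lineEdges i j a b 3 = [(i, a), (a, b), (b, j)] := rfl

@[simp] lemma lineVertices_one (a b : ℕ) : lineVertices a b 1 = [] := rfl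

@[simp] lemma lineVertices_two (a b : ℕ) : lineVertices a b 2 = [a] := rfl

@[simp] lemma lineVertices_three (a b : ℕ) : lineVertices a b 3 = [a, b] := rfl

lemma mem_edgeList (e : Fin 6) : e ∈ ([0, 1, 2, 3, 4, 5] : List (Fin 6)) := by
  revert e; decide

lemma mem_patternEdges {m : Fin 6 → ℕ} {x : ℕ × ℕ} :
    x ∈ patternEdges m ↔
      ∃ e : Fin 6, x ∈ lineEdges (edgeSrc e) (edgeTgt e) (4 + e) (10 + e) (m e) := by
  rw [patternEdges, List.mem_flatMap]
  exact ⟨fun ⟨e, _, h⟩ => ⟨e, h⟩, fun ⟨e, h⟩ => ⟨e, mem_edgeList e, h⟩⟩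

lemma mem_patternVertices {m : Fin 6 → ℕ} {x : ℕ} :
    x ∈ patternVertices m ↔ x < 4 ∨ ∃ e : Fin 6, x ∈ lineVertices (4 + e) (10 + e) (m e) := by
  rw [patternVertices, List.mem_append, List.mem_flatMap]
  refine or_congr ?_ ⟨fun ⟨e, _, h⟩ => ⟨e, h⟩, fun ⟨e, h⟩ => ⟨e, mem_edgeList e, h⟩⟩
  simp only [List.mem_cons, List.not_mem_nil, or_false]
  omega

section

variable {m k : Fin 6 → ℕ}

lemma IsPattern.pos (h : IsPattern m k) (e : Fin 6) : 0 < k e := by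
  rcases h e with h | h | h <;> omega

lemma subCode_linePos_interior {e : Fin 6} {s : ℕ} (h0 : 0 < s) (hs : s < k e) :
    subCode m k (linePos k e s) = if s = 1 ∨ m e ≤ 2 then 4 + e.val else 10 + e.val := by
  rw [linePos_interior h0 hs, subCode]
  congr 1
  simp only [eq_iff_iff]
  refine or_congr_left ?_
  omega

lemma subCode_linePos_end {e : Fin 6} (h : 0 < k e) :
    subCode m k (linePos k e (k e)) = edgeTgt e := by
  rw [linePos_end e h]; rfl

lemma subdivision_adj_linePos {e : Fin 6} {s : ℕ} (hs : s < k e)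
    (hne : linePos k e s ≠ linePos k e (s + 1)) :
    (subdivision k).Adj (linePos k e s) (linePos k e (s + 1)) := by
  rw [subdivision, SimpleGraph.fromRel_adj]
  exact ⟨hne, Or.inl ⟨e, s, hs, rfl, rfl⟩⟩

lemma linePos_injective {e : Fin 6} {s t : ℕ} (hs : s ≤ k e) (ht : t ≤ k e)
    (h : linePos k e s = linePos k e t) : s = t := by
  have hne := edgeSrc_ne_edgeTgt e
  simp only [linePos] at h
  split_ifs at h <;> simp_all <;> omega

lemma linePos_adj {e : Fin 6} {s : ℕ} (hs : s < k e) :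
    (subdivision k).Adj (linePos k e s) (linePos k e (s + 1)) :=
  subdivision_adj_linePos hs fun h => by have := linePos_injective hs.le hs h; omega

lemma exists_walk_linePos (e : Fin 6) (s n : ℕ) (h : s + n ≤ k e) :
    ∃ w : (subdivision k).Walk (linePos k e s) (linePos k e (s + n)),
      ∀ x ∈ w.support, ∃ t, s ≤ t ∧ t ≤ s + n ∧ x = linePos k e t := by
  induction n with
  | zero =>
    refine ⟨SimpleGraph.Walk.nil, fun x hx => ⟨s, le_rfl, le_rfl, ?_⟩⟩
    simpa using hx
  | succ n ih =>
    obtain ⟨w, hw⟩ := ih (by omega)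
    refine ⟨w.concat (linePos_adj (s := s + n) (by omega)), fun x hx => ?_⟩
    rw [SimpleGraph.Walk.support_concat, List.mem_append] at hx
    rcases hx with hx | hx
    · obtain ⟨t, h1, h2, h3⟩ := hw x hx
      exact ⟨t, h1, by omega, h3⟩
    · exact ⟨s + (n + 1), by omega, le_rfl, by simpa using hx⟩

/-- Each fibre of the code is a single vertex or a stretch of consecutive interior vertices of one
line, hence connected. -/
lemma exists_walk_of_subCode_eq {u v : SubVertex k} (h : subCode m k u = subCode m k v) :
    ∃ w : (subdivision k).Walk u v, ∀ x ∈ w.support, subCode m k x = subCode m k u := by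
  have hrev : ∀ {u v : SubVertex k}, subCode m k u = subCode m k v →
      (∃ w : (subdivision k).Walk u v, ∀ x ∈ w.support, subCode m k x = subCode m k u) →
      ∃ w : (subdivision k).Walk v u, ∀ x ∈ w.support, subCode m k x = subCode m k v := by
    rintro u v h ⟨w, hw⟩
    exact ⟨w.reverse, fun x hx => (hw x (by simpa using hx)).trans h⟩
  have key : ∀ (e : Fin 6) (s t : Fin (k e - 1)), s.val ≤ t.val →
      subCode m k (Sum.inr ⟨e, s⟩) = subCode m k (Sum.inr ⟨e, t⟩) →
      ∃ w : (subdivision k).Walk (Sum.inr ⟨e, s⟩) (Sum.inr ⟨e, t⟩),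
        ∀ x ∈ w.support, subCode m k x = subCode m k (Sum.inr ⟨e, s⟩) := by
    intro e s t hst h
    have hs := s.2
    have ht := t.2
    have e1 := inr_eq_linePos e s
    have e2 : (Sum.inr ⟨e, t⟩ : SubVertex k) = linePos k e (s + 1 + (t - s)) := by
      rw [inr_eq_linePos e t]; congr 1; omega
    obtain ⟨w, hw⟩ := exists_walk_linePos (k := k) e (s + 1) (t - s) (by omega)
    rw [e1, e2] at h ⊢
    refine ⟨w, fun x hx => ?_⟩
    obtain ⟨r, h1, h2, rfl⟩ := hw x hx
    rw [subCode_linePos_interior (by omega) (by omega)] at h ⊢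
    rw [subCode_linePos_interior (by omega) (by omega)] at h ⊢
    split_ifs at h ⊢ <;> omega
  rcases u with i | ⟨e, s⟩ <;> rcases v with j | ⟨e', s'⟩
  · have : i = j := Fin.ext h
    subst this
    exact ⟨SimpleGraph.Walk.nil, fun x hx => by rw [show x = _ by simpa using hx]⟩
  · exfalso
    simp only [subCode] at h
    split_ifs at h <;> omega
  · exfalso
    simp only [subCode] at h
    split_ifs at h <;> omega
  · have hee : e = e' := by
      simp only [subCode] at h
      apply Fin.ext
      split_ifs at h <;> omega
    subst hee
    rcases le_total s.val s'.val with hle | hle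
    · exact key e s s' hle h
    · exact hrev h.symm (key e s' s hle h.symm)

/-- The code 4 + e stands for one vertex only if the line has exactly two edges or if the rest of
its interior has been split off to 10 + e. The codes 10 + e may hide arbitrarily many vertices and
are not admitted to `F`. All codes are at most 10 + 5, whence the bound 16. -/
lemma isCoding_subdivision (h : IsPattern m k) {F : List ℕ}
    (hF : ∀ a ∈ F, a < 4 ∨ ∃ e : Fin 6, a = 4 + e ∧ (m e = 3 ∨ k e = 2)) :
    IsCoding (subdivision k) (subCode m k) 16 (patternEdges m) (patternVertices m) F where
  edge_lt := by
    intro x hx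
    obtain ⟨e, hx⟩ := mem_patternEdges.mp hx
    have h1 := (edgeSrc e).2
    have h2 := (edgeTgt e).2
    have h3 := e.2
    rcases h e with h | h | h <;> simp [h.1] at hx
    · subst hx; simp; omega
    · rcases hx with rfl | rfl <;> simp <;> omega
    · rcases hx with rfl | rfl | rfl <;> simp <;> omega
  lt := by
    intro a ha
    rcases mem_patternVertices.mp ha with ha | ⟨e, ha⟩
    · omega
    · have h3 := e.2
      rcases h e with h | h | h <;> simp [h.1] at ha <;> omega
  mem := by
    rintro (i | ⟨e, s⟩)
    · exact mem_patternVertices.mpr (Or.inl i.2)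
    · refine mem_patternVertices.mpr (Or.inr ⟨e, ?_⟩)
      have hs := s.2
      rcases h e with h | h | h
      · omega
      · simp [h.1, subCode]
      · simp only [lineVertices_three, h.1, subCode]
        split_ifs <;> simp
  surj := by
    intro a ha
    rcases mem_patternVertices.mp ha with ha | ⟨e, ha⟩
    · exact ⟨Sum.inl ⟨a, ha⟩, rfl⟩
    · rcases h e with h | h | h <;> simp [h.1] at ha
      · subst ha
        exact ⟨Sum.inr ⟨e, ⟨0, by omega⟩⟩, by simp [subCode]⟩
      · rcases ha with rfl | rfl
        · exact ⟨Sum.inr ⟨e, ⟨0, by omega⟩⟩, by simp [subCode]⟩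
        · exact ⟨Sum.inr ⟨e, ⟨1, by omega⟩⟩, by simp [subCode, h.1]⟩
  adj := by
    have key : ∀ e s, s < k e → subCode m k (linePos k e s) = subCode m k (linePos k e (s + 1)) ∨
        (subCode m k (linePos k e s), subCode m k (linePos k e (s + 1))) ∈ patternEdges m := by
      intro e s hs
      rw [mem_patternEdges]
      rcases Nat.eq_zero_or_pos s with rfl | h0
      · right
        refine ⟨e, ?_⟩
        rw [linePos_zero]
        by_cases h1 : k e = 1
        · have h2 : linePos k e (0 + 1) = linePos k e (k e) := by rw [h1]
          rw [h2, subCode_linePos_end (h.pos e)]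
          rcases h e with h | h | h
          · simp [h.1, subCode]
          · omega
          · omega
        · rw [subCode_linePos_interior (by omega) (by omega)]
          rcases h e with h | h | h
          · omega
          · simp [h.1, subCode]
          · simp [h.1, subCode]
      · rw [subCode_linePos_interior h0 hs]
        rcases (Nat.succ_le_of_lt hs).lt_or_eq with h1 | h1
        · rw [subCode_linePos_interior (s := s + 1) (by omega) h1]
          rcases h e with h | h | h
          · omega
          · left; simp [h.1]
          · by_cases hs1 : s = 1
            · right
              exact ⟨e, by simp [h.1, hs1]⟩
            · left
              simp [hs1, h0.ne']
        · right
          refine ⟨e, ?_⟩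
          rw [show s + 1 = k e from h1, subCode_linePos_end (h.pos e)]
          rcases h e with h | h | h
          · omega
          · simp [h.1]
          · have hs1 : s ≠ 1 := by omega
            simp [h.1, hs1]
    intro u v huv
    rw [subdivision, SimpleGraph.fromRel_adj] at huv
    rcases huv.2 with ⟨e, s, hs, rfl, rfl⟩ | ⟨e, s, hs, rfl, rfl⟩
    · rcases key e s hs with h | h
      · exact Or.inl h
      · exact Or.inr (Or.inl h)
    · rcases key e s hs with h | h
      · exact Or.inl h.symm
      · exact Or.inr (Or.inr h)
  lift := by
    intro x hx
    obtain ⟨e, hx⟩ := mem_patternEdges.mp hx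
    have hadj : ∀ s, s < k e → subCode m k (linePos k e s) = x.1 →
        subCode m k (linePos k e (s + 1)) = x.2 →
        ∃ u v, subCode m k u = x.1 ∧ subCode m k v = x.2 ∧ (subdivision k).Adj u v :=
      fun s hs h1 h2 => ⟨_, _, h1, h2, linePos_adj hs⟩
    have hend : subCode m k (linePos k e (k e - 1 + 1)) = edgeTgt e := by
      rw [show k e - 1 + 1 = k e from Nat.sub_add_cancel (h.pos e), subCode_linePos_end (h.pos e)]
    rcases h e with h | h | h <;> simp [h.1] at hx
    · subst hx
      refine hadj 0 (by omega) rfl ?_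
      rw [← hend]; congr 2; omega
    · rcases hx with rfl | rfl
      · refine hadj 0 (by omega) rfl ?_
        rw [subCode_linePos_interior (by omega) (by omega)]
        simp
      · refine hadj (k e - 1) (by omega) ?_ hend
        rw [subCode_linePos_interior (by omega) (by omega)]
        simp [h.1]
    · rcases hx with rfl | rfl | rfl
      · refine hadj 0 (by omega) rfl ?_
        rw [subCode_linePos_interior (by omega) (by omega)]
        simp
      · refine hadj 1 (by omega) ?_ ?_
        · rw [subCode_linePos_interior (by omega) (by omega)]
          simp
        · rw [subCode_linePos_interior (by omega) (by omega)]
          simp [h.1]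
      · refine hadj (k e - 1) (by omega) ?_ hend
        rw [subCode_linePos_interior (by omega) (by omega)]
        have : k e - 1 ≠ 1 := by omega
        simp [h.1, this]
  fib := fun u v huv => exists_walk_of_subCode_eq huv
  sub := by
    intro a ha
    rw [mem_patternVertices]
    rcases hF a ha with h1 | ⟨e, rfl, h1⟩
    · exact Or.inl h1
    · refine Or.inr ⟨e, ?_⟩
      rcases h e with h | h | h
      · omega
      · simp [h.1]
      · simp [h.1]
  inj := by
    rintro (i | ⟨e, s⟩) (j | ⟨e', s'⟩) hu huv
    · exact congrArg Sum.inl (Fin.ext huv)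
    · exfalso
      simp only [subCode] at huv
      split_ifs at huv <;> omega
    · exfalso
      simp only [subCode] at huv
      split_ifs at huv <;> omega
    · have hee : e = e' := by
        simp only [subCode] at huv
        apply Fin.ext
        split_ifs at huv <;> omega
      subst hee
      have hs := s.2
      have hs' := s'.2
      have : s.val = s'.val := by
        rcases hF _ hu with h1 | ⟨e', h1, h2⟩
        · simp only [subCode] at h1
          split_ifs at h1 <;> omega
        · have hee : e = e' := by
            simp only [subCode] at h1
            apply Fin.ext
            split_ifs at h1 <;> omega
          subst hee
          rcases h2 with h2 | h2
          · simp only [subCode] at huv h1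
            rw [h2] at huv h1
            split_ifs at huv h1 <;> omega
          · omega
      rw [Fin.ext this]

end

end Patterns
end WhiskeredBlocks

namespace WhiskeredBlocks

/-! ### Finite checks over all sets of whiskers. -/

section Forward

/-! ### Unmixed subdivisions of `K₄` -/

/-- The function on the edges of `K₄` with the given values. -/
def pattern (l : List ℕ) : Fin 6 → ℕ := fun e => l.getD e 0

/-- Sets that violate unmixedness when the lines `01` and `02` are subdivided. -/
def violatingSets : List (List ℕ) :=
  [[0, 1, 2], [1, 3, 5], [2, 3, 4], [0, 2, 3], [0, 1], [0, 2], [3, 4, 5], [0, 1, 3], [2, 3]]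

set_option maxRecDepth 100000 in
theorem exists_violatingSet : ∀ a ∈ [2, 3], ∀ b ∈ [2, 3], ∀ c ∈ [1, 2], ∀ d ∈ [1, 2],
    ∀ e ∈ [1, 2], ∀ f ∈ [1, 2], ∀ w ∈ [0, 1, 2, 3, 4, 5].sublists, ∃ T ∈ violatingSets,
      unmixedB 16 (patternEdges (pattern [a, b, c, d, e, f]))
        (patternVertices (pattern [a, b, c, d, e, f])) w T = false := by
  decide +kernel

-- The code 4 sits next to the end 0, so the two ends play different roles. For both values of `m`
-- the conclusion contradicts its mirror image under the exchange of 0 and 1; this excludes lines of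
-- three or more edges.
set_option maxRecDepth 100000 in
theorem whiskers_of_long_line : ∀ m ∈ [1, 2], ∀ w ∈ [0, 1, 2, 3, 4].sublists,
    (∀ T ∈ [0, 1, 2, 3, 4].sublists, unmixedB 16 (patternEdges (pattern [3, 1, 1, 1, 1, m]))
      (patternVertices (pattern [3, 1, 1, 1, 1, m])) w T = true) →
    (m = 1 → (0 ∈ w ∧ 1 ∉ w ∧ ¬ (2 ∈ w ∧ 3 ∈ w)) ∨ (0 ∉ w ∧ 1 ∈ w ∧ 2 ∈ w ∧ 3 ∈ w)) ∧
      (m = 2 → 0 ∉ w ∧ 1 ∈ w) := by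
  decide +kernel

-- The two disjunctions permit a relabelling after which 0 and 2 carry whiskers; the last clause
-- classifies that normalized case.
set_option maxRecDepth 100000 in
theorem whiskers_of_one_subdivided : ∀ w ∈ [0, 1, 2, 3, 4].sublists,
    (∀ T ∈ [0, 1, 2, 3, 4].sublists, unmixedB 16 (patternEdges (pattern [2, 1, 1, 1, 1, 1]))
      (patternVertices (pattern [2, 1, 1, 1, 1, 1])) w T = true) →
    (0 ∈ w ∨ 1 ∈ w) ∧ (2 ∈ w ∨ 3 ∈ w) ∧
      (0 ∈ w → 2 ∈ w → w = [0, 2, 3] ∨ w = [0, 2, 4]) := by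
  decide +kernel

set_option maxRecDepth 100000 in
theorem whiskers_of_two_subdivided : ∀ w ∈ [0, 1, 2, 3, 4, 9].sublists,
    (∀ T ∈ [0, 1, 2, 3, 4, 9].sublists, unmixedB 16 (patternEdges (pattern [2, 1, 1, 1, 1, 2]))
      (patternVertices (pattern [2, 1, 1, 1, 1, 2])) w T = true) →
    (0 ∈ w ∨ 1 ∈ w) ∧ (2 ∈ w ∨ 3 ∈ w) ∧ (0 ∈ w → 2 ∈ w → w = [0, 2]) := by
  decide +kernel

end Forward
end WhiskeredBlocks

namespace WhiskeredBlocks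

/-! ### Bounds on the lengths of the lines of an unmixed block. -/

section Lengths

variable {β : Type*} {B : SimpleGraph β}

lemma IsCoding.exists_list {f : β → ℕ} {N : ℕ} {E : List (ℕ × ℕ)} {A F : List ℕ}
    (h : IsCoding B f N E A F) (W : Set β) :
    ∃ w ∈ F.sublists, ∀ v, f v ∈ F → (v ∈ W ↔ f v ∈ w) := by
  classical
  refine ⟨F.filter fun a => ∃ v ∈ W, f v = a, List.mem_sublists.mpr List.filter_sublist,
    fun v hv => ?_⟩
  rw [List.mem_filter, decide_eq_true_iff]
  constructor
  · exact fun hW => ⟨hv, v, hW, rfl⟩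
  · rintro ⟨-, u, hu, huv⟩
    rwa [h.inj v u hv huv.symm]

namespace IsK4Lines

variable {p : Fin 4 → β} {L : ∀ i j, B.Walk (p i) (p j)}

/-- The set of whiskers of an unmixed block passes the tests for unmixedness. -/
lemma exists_unmixed_list [Finite β] (h : IsK4Lines B p L) (hB : B.Connected) {W : Set β}
    (hu : IsCombinatoriallyUnmixed (addWhiskers B W)) {m : Fin 6 → ℕ}
    (hm : IsPattern m (lengths L)) {F : List ℕ} (hnd : F.Nodup)
    (hF : ∀ a ∈ F, a < 4 ∨ ∃ e : Fin 6, a = 4 + e ∧ (m e = 3 ∨ lengths L e = 2)) :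
    ∃ w ∈ F.sublists, (∀ v, subCode m (lengths L) v ∈ F →
      (toVertex L v ∈ W ↔ subCode m (lengths L) v ∈ w)) ∧
      ∀ T ∈ F.sublists, unmixedB 16 (patternEdges m) (patternVertices m) w T = true := by
  have hc := isCoding_subdivision hm hF
  obtain ⟨w, hw, hwW⟩ := hc.exists_list (toVertex L ⁻¹' W)
  have hu' : IsCombinatoriallyUnmixed (addWhiskers (subdivision (lengths L)) (toVertex L ⁻¹' W)) :=
    (isCombinatoriallyUnmixed_iso (addWhiskersIso (h.iso hB) fun v => Iff.rfl)).mpr hu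
  refine ⟨w, hw, hwW, fun T hT => ?_⟩
  have hT' := List.mem_sublists.mp hT
  exact hc.unmixedB_eq_true ((h.iso hB).connected_iff.mpr hB) hwW hu' (hnd.sublist hT')
    fun a ha => hT'.subset ha

lemma isPattern_iff {m k : Fin 6 → ℕ} : IsPattern m k ↔
    ∀ e ∈ ([0, 1, 2, 3, 4, 5] : List (Fin 6)),
      (m e = 1 ∧ k e = 1) ∨ (m e = 2 ∧ 2 ≤ k e) ∨ (m e = 3 ∧ 3 ≤ k e) :=
  ⟨fun h e _ => h e, fun h e => h e (mem_edgeList e)⟩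

lemma not_subdivided_adjacent [Finite β] (h : IsK4Lines B p L) (hB : B.Connected) {W : Set β}
    (hu : IsCombinatoriallyUnmixed (addWhiskers B W)) :
    ¬ (2 ≤ (L 0 1).length ∧ 2 ≤ (L 0 2).length) := by
  rintro ⟨h0, h1⟩
  have key : ∀ i j, i ≠ j → ∃ a ∈ [1, 2],
      (a = 1 ∧ (L i j).length = 1) ∨ (a = 2 ∧ 2 ≤ (L i j).length) := by
    intro i j hij
    have := h.length_pos hij
    rcases Nat.lt_or_eq_of_le this with h2 | h2
    · exact ⟨2, by simp, Or.inr ⟨rfl, by omega⟩⟩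
    · exact ⟨1, by simp, Or.inl ⟨rfl, by omega⟩⟩
  -- The two lines at `p 0` keep length 2 exactly or are cut off at 3; either way their first
  -- interior vertex keeps a code of its own. The other four lines only need to be known as
  -- subdivided or not.
  have key' : ∀ n, 2 ≤ n → ∃ a ∈ [2, 3], (a = 2 ∧ n = 2) ∨ (a = 3 ∧ 3 ≤ n) := by
    intro n hn
    rcases hn.lt_or_eq with h2 | h2
    · exact ⟨3, by simp, Or.inr ⟨rfl, by omega⟩⟩
    · exact ⟨2, by simp, Or.inl ⟨rfl, by omega⟩⟩
  obtain ⟨a, ha, ha'⟩ := key' _ h0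
  obtain ⟨b, hb, hb'⟩ := key' _ h1
  obtain ⟨c, hc, hc'⟩ := key 0 3 (by decide)
  obtain ⟨d, hd, hd'⟩ := key 1 2 (by decide)
  obtain ⟨e, he, he'⟩ := key 1 3 (by decide)
  obtain ⟨f, hf, hf'⟩ := key 2 3 (by decide)
  have hp : IsPattern (pattern [a, b, c, d, e, f]) (lengths L) := by
    rw [isPattern_iff]
    simp only [List.forall_mem_cons, List.not_mem_nil, false_imp_iff, implies_true, and_true]
    change ((a = 1 ∧ (L 0 1).length = 1) ∨ (a = 2 ∧ 2 ≤ (L 0 1).length) ∨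
        (a = 3 ∧ 3 ≤ (L 0 1).length)) ∧ ((b = 1 ∧ (L 0 2).length = 1) ∨
        (b = 2 ∧ 2 ≤ (L 0 2).length) ∨ (b = 3 ∧ 3 ≤ (L 0 2).length)) ∧
      ((c = 1 ∧ (L 0 3).length = 1) ∨ (c = 2 ∧ 2 ≤ (L 0 3).length) ∨
        (c = 3 ∧ 3 ≤ (L 0 3).length)) ∧ ((d = 1 ∧ (L 1 2).length = 1) ∨
        (d = 2 ∧ 2 ≤ (L 1 2).length) ∨ (d = 3 ∧ 3 ≤ (L 1 2).length)) ∧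
      ((e = 1 ∧ (L 1 3).length = 1) ∨ (e = 2 ∧ 2 ≤ (L 1 3).length) ∨
        (e = 3 ∧ 3 ≤ (L 1 3).length)) ∧ ((f = 1 ∧ (L 2 3).length = 1) ∨
        (f = 2 ∧ 2 ≤ (L 2 3).length) ∨ (f = 3 ∧ 3 ≤ (L 2 3).length))
    refine ⟨?_, ?_, ?_, ?_, ?_, ?_⟩ <;> omega
  obtain ⟨w, hw, -, hT⟩ := h.exists_unmixed_list hB hu hp (F := [0, 1, 2, 3, 4, 5]) (by decide) (by
    intro x hx
    by_cases h4 : x < 4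
    · exact Or.inl h4
    · right
      have : x = 4 ∨ x = 5 := by simp at hx; omega
      rcases this with rfl | rfl
      · refine ⟨0, rfl, ?_⟩
        change a = 3 ∨ (L 0 1).length = 2
        omega
      · refine ⟨1, rfl, ?_⟩
        change b = 3 ∨ (L 0 2).length = 2
        omega)
  obtain ⟨T, hTm, hf⟩ := exists_violatingSet a ha b hb c hc d hd e he f hf w hw
  have hsub : ∀ T ∈ violatingSets, T ∈ [0, 1, 2, 3, 4, 5].sublists := by decide
  have := hT T (hsub T hTm)
  rw [hf] at this
  exact Bool.false_ne_true this

lemma exists_perm : ∀ i j k : Fin 4, i ≠ j → i ≠ k → j ≠ k →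
    ∃ σ : Equiv.Perm (Fin 4), σ 0 = i ∧ σ 1 = j ∧ σ 2 = k := by
  decide +kernel

lemma length_eq_one_of_adjacent [Finite β] (h : IsK4Lines B p L) (hB : B.Connected) {W : Set β}
    (hu : IsCombinatoriallyUnmixed (addWhiskers B W)) {i j k : Fin 4} (hij : i ≠ j) (hik : i ≠ k)
    (hjk : j ≠ k) (h2 : 2 ≤ (L i j).length) : (L i k).length = 1 := by
  obtain ⟨σ, rfl, rfl, rfl⟩ := exists_perm i j k hij hik hjk
  have h1 := (h.perm σ).not_subdivided_adjacent hB hu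
  have h3 := h.length_pos hik
  have h4 : ¬ 2 ≤ (L (σ 0) (σ 2)).length := fun h5 => h1 ⟨h2, h5⟩
  omega

lemma whiskers_of_long [Finite β] (h : IsK4Lines B p L) (hB : B.Connected) {W : Set β}
    (hu : IsCombinatoriallyUnmixed (addWhiskers B W)) (h0 : 3 ≤ (L 0 1).length) :
    ((L 2 3).length = 1 → (p 0 ∈ W ∧ p 1 ∉ W ∧ ¬ (p 2 ∈ W ∧ p 3 ∈ W)) ∨
      (p 0 ∉ W ∧ p 1 ∈ W ∧ p 2 ∈ W ∧ p 3 ∈ W)) ∧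
    (2 ≤ (L 2 3).length → p 0 ∉ W ∧ p 1 ∈ W) := by
  have hc : (L 1 0).length = (L 0 1).length := h.length_comm (by decide)
  have h02 := h.length_eq_one_of_adjacent hB hu (i := 0) (j := 1) (k := 2) (by decide) (by decide)
    (by decide) (by omega)
  have h03 := h.length_eq_one_of_adjacent hB hu (i := 0) (j := 1) (k := 3) (by decide) (by decide)
    (by decide) (by omega)
  have h12 := h.length_eq_one_of_adjacent hB hu (i := 1) (j := 0) (k := 2) (by decide) (by decide)
    (by decide) (by omega)
  have h13 := h.length_eq_one_of_adjacent hB hu (i := 1) (j := 0) (k := 3) (by decide) (by decide)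
    (by decide) (by omega)
  have h23 := h.length_pos (i := 2) (j := 3) (by decide)
  obtain ⟨m, hm, hm'⟩ : ∃ m ∈ [1, 2], (m = 1 ∧ (L 2 3).length = 1) ∨
      (m = 2 ∧ 2 ≤ (L 2 3).length) := by
    rcases Nat.lt_or_eq_of_le h23 with h2 | h2
    · exact ⟨2, by simp, Or.inr ⟨rfl, by omega⟩⟩
    · exact ⟨1, by simp, Or.inl ⟨rfl, by omega⟩⟩
  have hp : IsPattern (pattern [3, 1, 1, 1, 1, m]) (lengths L) := by
    rw [isPattern_iff]
    simp only [List.forall_mem_cons, List.not_mem_nil, false_imp_iff, implies_true, and_true]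
    refine ⟨Or.inr (Or.inr ⟨rfl, h0⟩), Or.inl ⟨rfl, h02⟩, Or.inl ⟨rfl, h03⟩, Or.inl ⟨rfl, h12⟩,
      Or.inl ⟨rfl, h13⟩, ?_⟩
    rcases hm' with hm' | hm'
    · exact Or.inl hm'
    · exact Or.inr (Or.inl hm')
  obtain ⟨w, hw, hwW, hT⟩ := h.exists_unmixed_list hB hu hp (F := [0, 1, 2, 3, 4]) (by decide) (by
    intro x hx
    by_cases h4 : x < 4
    · exact Or.inl h4
    · have : x = 4 := by simp at hx; omega
      exact Or.inr ⟨0, this, Or.inl rfl⟩)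
  have hv : ∀ i : Fin 4, p i ∈ W ↔ i.val ∈ w := fun i => hwW (Sum.inl i) (by
    change i.val ∈ [0, 1, 2, 3, 4]
    revert i; decide)
  obtain ⟨r1, r2⟩ := whiskers_of_long_line m hm w hw hT
  rw [hv 0, hv 1, hv 2, hv 3]
  exact ⟨fun h => r1 (by omega), fun h => r2 (by omega)⟩

/-- The constraints from `whiskers_of_long` for the two orientations of the line cannot hold
together. -/
lemma length_le_two [Finite β] (h : IsK4Lines B p L) (hB : B.Connected) {W : Set β}
    (hu : IsCombinatoriallyUnmixed (addWhiskers B W)) : (L 0 1).length ≤ 2 := by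
  by_contra! h0
  have r := h.whiskers_of_long hB hu h0
  have r' := (h.perm (Equiv.swap 0 1)).whiskers_of_long hB hu
    (h0.trans_eq (h.length_comm (i := 0) (j := 1) (by decide)).symm)
  change ((L 2 3).length = 1 → (p 1 ∈ W ∧ p 0 ∉ W ∧ ¬ (p 2 ∈ W ∧ p 3 ∈ W)) ∨
      (p 1 ∉ W ∧ p 0 ∈ W ∧ p 2 ∈ W ∧ p 3 ∈ W)) ∧
    (2 ≤ (L 2 3).length → p 1 ∉ W ∧ p 0 ∈ W) at r'
  have h23 := h.length_pos (i := 2) (j := 3) (by decide)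
  rcases Nat.lt_or_eq_of_le h23 with h2 | h2
  · exact (r.2 h2).1 (r'.2 h2).2
  · have a := r.1 h2.symm
    have b := r'.1 h2.symm
    tauto

end IsK4Lines

end Lengths
end WhiskeredBlocks

namespace WhiskeredBlocks

/-! ### Identification of the remaining blocks with the members of the family. -/

section Classification

variable {β : Type*} {B : SimpleGraph β}

/-- Here all fibres are single vertices, so the coding is an isomorphism onto its code. -/
lemma IsCoding.exists_iso {f : β → ℕ} {N n : ℕ} {E : List (ℕ × ℕ)} {A : List ℕ}
    (h : IsCoding B f N E A A) {G : SimpleGraph (Fin n)} {a : Fin n → ℕ}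
    (ha : Function.Injective a) (hA : ∀ x, x ∈ A ↔ ∃ i, a i = x)
    (hG : ∀ i j, G.Adj i j ↔ i ≠ j ∧ ((a i, a j) ∈ E ∨ (a j, a i) ∈ E)) :
    ∃ e : G ≃g B, ∀ i, f (e i) = a i := by
  choose g hg using fun i => h.surj (a i) ((hA _).mpr ⟨i, rfl⟩)
  have huniq : ∀ v i, f v = a i → v = g i := fun v i hv =>
    h.inj v (g i) (h.mem v) (hv.trans (hg i).symm)
  have hinj : Function.Injective g := fun i j hij => ha (by rw [← hg i, ← hg j, hij])
  have hsurj : Function.Surjective g := by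
    intro v
    obtain ⟨i, hi⟩ := (hA _).mp (h.mem v)
    exact ⟨i, (huniq v i hi.symm).symm⟩
  refine ⟨⟨Equiv.ofBijective g ⟨hinj, hsurj⟩, ?_⟩, hg⟩
  intro i j
  change B.Adj (g i) (g j) ↔ _
  rw [hG]
  constructor
  · intro hadj
    have hne : i ≠ j := fun hij => hadj.ne (congrArg g hij)
    have := h.adj _ _ hadj
    rw [hg, hg] at this
    exact ⟨hne, this.resolve_left (ha.ne hne)⟩
  · rintro ⟨-, hE | hE⟩
    · obtain ⟨u, v, hu, hv, huv⟩ := h.lift _ hE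
      rwa [huniq u i hu, huniq v j hv] at huv
    · obtain ⟨u, v, hu, hv, huv⟩ := h.lift _ hE
      rw [huniq u j hu, huniq v i hv] at huv
      exact huv.symm

lemma InFamilyK4.of_iso {V V' : Type*} {H : SimpleGraph V} {H' : SimpleGraph V'} (e : H ≃g H')
    (h : InFamilyK4 H') : InFamilyK4 H := by
  rcases h with ⟨W, ⟨e'⟩⟩ | ⟨⟨e'⟩⟩ | ⟨⟨e'⟩⟩ | ⟨⟨e'⟩⟩
  · exact Or.inl ⟨W, ⟨e.trans e'⟩⟩
  · exact Or.inr (Or.inl ⟨e.trans e'⟩)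
  · exact Or.inr (Or.inr (Or.inl ⟨e.trans e'⟩))
  · exact Or.inr (Or.inr (Or.inr ⟨e.trans e'⟩))

lemma top_adj_iff : ∀ i j : Fin 4, (⊤ : SimpleGraph (Fin 4)).Adj i j ↔ i ≠ j ∧
    (((![0, 1, 2, 3] : Fin 4 → ℕ) i, (![0, 1, 2, 3] : Fin 4 → ℕ) j) ∈
      patternEdges (pattern [1, 1, 1, 1, 1, 1]) ∨
    ((![0, 1, 2, 3] : Fin 4 → ℕ) j, (![0, 1, 2, 3] : Fin 4 → ℕ) i) ∈
      patternEdges (pattern [1, 1, 1, 1, 1, 1])) := by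
  simp only [SimpleGraph.top_adj]
  decide +kernel

lemma k4Sub1_adj_iff : ∀ i j, K4Sub1.Adj i j ↔ i ≠ j ∧
    (((![0, 1, 2, 3, 4] : Fin 5 → ℕ) i, (![0, 1, 2, 3, 4] : Fin 5 → ℕ) j) ∈
      patternEdges (pattern [2, 1, 1, 1, 1, 1]) ∨
    ((![0, 1, 2, 3, 4] : Fin 5 → ℕ) j, (![0, 1, 2, 3, 4] : Fin 5 → ℕ) i) ∈
      patternEdges (pattern [2, 1, 1, 1, 1, 1])) := by
  simp only [K4Sub1, SimpleGraph.fromEdgeSet_adj, Set.mem_insert_iff, Set.mem_singleton_iff]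
  decide +kernel

/-- The vertex f of `K4Sub2` has code 9 = 4 + 5, the interior vertex of the line numbered 5, which
joins 2 and 3. -/
lemma k4Sub2_adj_iff : ∀ i j, K4Sub2.Adj i j ↔ i ≠ j ∧
    (((![0, 1, 2, 3, 4, 9] : Fin 6 → ℕ) i, (![0, 1, 2, 3, 4, 9] : Fin 6 → ℕ) j) ∈
      patternEdges (pattern [2, 1, 1, 1, 1, 2]) ∨
    ((![0, 1, 2, 3, 4, 9] : Fin 6 → ℕ) j, (![0, 1, 2, 3, 4, 9] : Fin 6 → ℕ) i) ∈
      patternEdges (pattern [2, 1, 1, 1, 1, 2])) := by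
  simp only [K4Sub2, SimpleGraph.fromEdgeSet_adj, Set.mem_insert_iff, Set.mem_singleton_iff]
  decide +kernel

namespace IsK4Lines

variable {p : Fin 4 → β} {L : ∀ i j, B.Walk (p i) (p j)}

/-- A block with lines of at most two edges is isomorphic to any graph with the same coding. -/
lemma exists_iso_addWhiskers [Finite β] (h : IsK4Lines B p L) (hB : B.Connected) {W : Set β}
    (hu : IsCombinatoriallyUnmixed (addWhiskers B W)) {m : Fin 6 → ℕ}
    (hm : lengths L = m) (hm2 : ∀ e, m e = 1 ∨ m e = 2) (hnd : (patternVertices m).Nodup)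
    {n : ℕ} {G : SimpleGraph (Fin n)} {a : Fin n → ℕ} (ha : Function.Injective a)
    (hA : ∀ x, x ∈ patternVertices m ↔ ∃ i, a i = x)
    (hG : ∀ i j, G.Adj i j ↔ i ≠ j ∧
      ((a i, a j) ∈ patternEdges m ∨ (a j, a i) ∈ patternEdges m)) :
    ∃ w ∈ (patternVertices m).sublists, (∀ i : Fin 4, p i ∈ W ↔ i.val ∈ w) ∧
      (∀ T ∈ (patternVertices m).sublists,
        unmixedB 16 (patternEdges m) (patternVertices m) w T = true) ∧
      Nonempty (addWhiskers B W ≃g addWhiskers G {i | a i ∈ w}) := by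
  have hp : IsPattern m (lengths L) := by
    intro e
    rw [hm]
    have := hm2 e
    omega
  have hF : ∀ x ∈ patternVertices m, x < 4 ∨ ∃ e : Fin 6, x = 4 + e ∧
      (m e = 3 ∨ lengths L e = 2) := by
    intro x hx
    rw [hm]
    rcases mem_patternVertices.mp hx with hx | ⟨e, hx⟩
    · exact Or.inl hx
    · rcases hm2 e with he | he
      · simp [he] at hx
      · rw [he, lineVertices_two, List.mem_singleton] at hx
        exact Or.inr ⟨e, hx, Or.inr he⟩
  obtain ⟨w, hw, hwW, hT⟩ := h.exists_unmixed_list hB hu hp hnd hF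
  have hc := isCoding_subdivision hp hF
  obtain ⟨e, he⟩ := hc.exists_iso ha hA hG
  refine ⟨w, hw, fun i => hwW (Sum.inl i) (hc.mem _), hT,
    ⟨(addWhiskersIso (e.trans (h.iso hB)) fun i => ?_).symm⟩⟩
  rw [Set.mem_ofPred_eq, ← he i]
  exact (hwW _ (hc.mem _)).symm

lemma lengths_eq {l : List ℕ} (h : (L 0 1).length = l.getD 0 0 ∧ (L 0 2).length = l.getD 1 0 ∧
    (L 0 3).length = l.getD 2 0 ∧ (L 1 2).length = l.getD 3 0 ∧ (L 1 3).length = l.getD 4 0 ∧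
    (L 2 3).length = l.getD 5 0) : lengths L = pattern l := by
  have : ∀ e ∈ ([0, 1, 2, 3, 4, 5] : List (Fin 6)), lengths L e = pattern l e := by
    simp only [List.forall_mem_cons, List.not_mem_nil, false_imp_iff, implies_true, and_true]
    exact h
  exact funext fun e => this e (mem_edgeList e)

lemma inFamilyK4_of_subdivided [Finite β] (h : IsK4Lines B p L) (hB : B.Connected) {W : Set β}
    (hu : IsCombinatoriallyUnmixed (addWhiskers B W)) (h0 : 2 ≤ (L 0 1).length) :
    (p 0 ∈ W ∨ p 1 ∈ W) ∧ (p 2 ∈ W ∨ p 3 ∈ W) ∧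
      (p 0 ∈ W → p 2 ∈ W → InFamilyK4 (addWhiskers B W)) := by
  have hc : (L 1 0).length = (L 0 1).length := h.length_comm (by decide)
  have h02 := h.length_eq_one_of_adjacent hB hu (i := 0) (j := 1) (k := 2) (by decide) (by decide)
    (by decide) (by omega)
  have h03 := h.length_eq_one_of_adjacent hB hu (i := 0) (j := 1) (k := 3) (by decide) (by decide)
    (by decide) (by omega)
  have h12 := h.length_eq_one_of_adjacent hB hu (i := 1) (j := 0) (k := 2) (by decide) (by decide)
    (by decide) (by omega)
  have h13 := h.length_eq_one_of_adjacent hB hu (i := 1) (j := 0) (k := 3) (by decide) (by decide)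
    (by decide) (by omega)
  have h01 := h.length_le_two hB hu
  have h23 : (L 2 3).length ≤ 2 :=
    (h.perm ((Equiv.swap 0 2).trans (Equiv.swap 1 3))).length_le_two hB hu
  have h23' := h.length_pos (i := 2) (j := 3) (by decide)
  rcases Nat.lt_or_eq_of_le h23 with h4 | h4
  · obtain ⟨w, hw, hp, hT, e⟩ := h.exists_iso_addWhiskers hB hu
      (lengths_eq (l := [2, 1, 1, 1, 1, 1])
        ⟨le_antisymm h01 h0, h02, h03, h12, h13, show _ = 1 by omega⟩)
      (by decide) (by decide) (G := K4Sub1) (a := ![0, 1, 2, 3, 4]) (by decide)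
      (by
        intro x
        rw [show patternVertices (pattern [2, 1, 1, 1, 1, 1]) = [0, 1, 2, 3, 4] by decide]
        simp [Fin.exists_fin_succ, eq_comm])
      k4Sub1_adj_iff
    obtain ⟨r1, r2, r3⟩ := whiskers_of_one_subdivided w hw hT
    rw [hp, hp, hp, hp]
    refine ⟨r1, r2, fun q0 q2 => ?_⟩
    rcases r3 q0 q2 with rfl | rfl
    · have hset : {i | (![0, 1, 2, 3, 4] : Fin 5 → ℕ) i ∈ ([0, 2, 3] : List ℕ)} = ({0, 2, 3} : Set (Fin 5)) := by
        ext i; fin_cases i <;> simp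
      rw [hset] at e
      exact Or.inr (Or.inr (Or.inl e))
    · have hset : {i | (![0, 1, 2, 3, 4] : Fin 5 → ℕ) i ∈ ([0, 2, 4] : List ℕ)} = ({0, 2, 4} : Set (Fin 5)) := by
        ext i; fin_cases i <;> simp
      rw [hset] at e
      exact Or.inr (Or.inr (Or.inr e))
  · obtain ⟨w, hw, hp, hT, e⟩ := h.exists_iso_addWhiskers hB hu
      (lengths_eq (l := [2, 1, 1, 1, 1, 2]) ⟨le_antisymm h01 h0, h02, h03, h12, h13, h4⟩)
      (by decide) (by decide) (G := K4Sub2) (a := ![0, 1, 2, 3, 4, 9]) (by decide)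
      (by
        intro x
        rw [show patternVertices (pattern [2, 1, 1, 1, 1, 2]) = [0, 1, 2, 3, 4, 9] by decide]
        simp [Fin.exists_fin_succ, eq_comm])
      k4Sub2_adj_iff
    obtain ⟨r1, r2, r3⟩ := whiskers_of_two_subdivided w hw hT
    rw [hp, hp, hp, hp]
    refine ⟨r1, r2, fun q0 q2 => ?_⟩
    obtain rfl := r3 q0 q2
    have hset : {i | (![0, 1, 2, 3, 4, 9] : Fin 6 → ℕ) i ∈ ([0, 2] : List ℕ)} = ({0, 2} : Set (Fin 6)) := by
      ext i; fin_cases i <;> simp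
    rw [hset] at e
    exact Or.inr (Or.inl e)

lemma exists_perm_pair : ∀ i j : Fin 4, i ≠ j → ∃ σ : Equiv.Perm (Fin 4), σ 0 = i ∧ σ 1 = j := by
  decide +kernel

lemma inFamilyK4 [Finite β] (h : IsK4Lines B p L) (hB : B.Connected) {W : Set β}
    (hu : IsCombinatoriallyUnmixed (addWhiskers B W)) : InFamilyK4 (addWhiskers B W) := by
  by_cases hl : ∃ i j, i ≠ j ∧ 2 ≤ (L i j).length
  · obtain ⟨i, j, hij, hl⟩ := hl
    obtain ⟨σ, rfl, rfl⟩ := exists_perm_pair i j hij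
    have key : ∀ τ : Equiv.Perm (Fin 4), 2 ≤ (L (σ (τ 0)) (σ (τ 1))).length →
        p (σ (τ 0)) ∈ W → p (σ (τ 2)) ∈ W → InFamilyK4 (addWhiskers B W) := fun τ hτ =>
      (((h.perm σ).perm τ).inFamilyK4_of_subdivided hB hu hτ).2.2
    have hl' : 2 ≤ (L (σ 1) (σ 0)).length := hl.trans_eq (h.length_comm hij).symm
    obtain ⟨q0 | q0, q2 | q2, -⟩ := (h.perm σ).inFamilyK4_of_subdivided hB hu hl
    · exact key 1 hl q0 q2
    · exact key (Equiv.swap 2 3) hl q0 q2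
    · exact key (Equiv.swap 0 1) hl' q0 q2
    · exact key ((Equiv.swap 0 1).trans (Equiv.swap 2 3)) hl' q0 q2
  · push Not at hl
    have h1 : ∀ i j, i ≠ j → (L i j).length = 1 := by
      intro i j hij
      have := h.length_pos hij
      have := hl i j hij
      omega
    obtain ⟨w, hw, hp, hT, e⟩ := h.exists_iso_addWhiskers hB hu
      (lengths_eq (l := [1, 1, 1, 1, 1, 1])
        ⟨h1 _ _ (by decide), h1 _ _ (by decide), h1 _ _ (by decide), h1 _ _ (by decide),
          h1 _ _ (by decide), h1 _ _ (by decide)⟩)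
      (by decide) (by decide) (G := ⊤) (a := ![0, 1, 2, 3]) (by decide)
      (by
        intro x
        rw [show patternVertices (pattern [1, 1, 1, 1, 1, 1]) = [0, 1, 2, 3] by decide]
        simp [Fin.exists_fin_succ, eq_comm])
      top_adj_iff
    exact Or.inl ⟨_, e⟩

end IsK4Lines

end Classification
end WhiskeredBlocks

namespace WhiskeredBlocks

/-! ### Realizing a subdivision of K₄ with whiskers inside an ambient graph. -/

section Realization

variable {V V' : Type*} {G : SimpleGraph V} {G' : SimpleGraph V'}

/-! ### Isomorphic blocks -/

lemma deg_iso (e : G ≃g G') (v : V) : deg G' (e v) = deg G v := by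
  rw [deg, deg, ← Set.ncard_image_of_injective _ e.injective]
  congr 1
  ext u
  obtain ⟨u, rfl⟩ := e.surjective u
  simp [e.map_adj_iff]

lemma isPivotal_iso (e : G ≃g G') (v : V) : IsPivotal G' (e v) ↔ IsPivotal G v := by
  rw [IsPivotal, IsPivotal, deg_iso]

lemma IsLine.map (e : G ≃g G') {a b : V} {L : G.Walk a b} (h : IsLine G L) :
    IsLine G' (L.map e.toHom) := by
  refine ⟨h.1.map e.injective, (isPivotal_iso e a).mpr h.2.1,
    (isPivotal_iso e b).mpr h.2.2.1, fun v hv ha hb hp => ?_⟩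
  rw [SimpleGraph.Walk.support_map] at hv
  obtain ⟨u, hu, rfl⟩ := List.mem_map.mp hv
  exact h.2.2.2 u hu (fun h' => ha (congrArg e h')) (fun h' => hb (congrArg e h'))
    ((isPivotal_iso e u).mp hp)

lemma IsSubdividedK4Block.of_iso (e : G ≃g G') (h : IsSubdividedK4Block G) :
    IsSubdividedK4Block G' where
  connected := e.connected_iff.mp h.connected
  noCutpoint v := by
    obtain ⟨v, rfl⟩ := e.surjective v
    rw [isCutpoint_iso]
    exact h.noCutpoint v
  cycleRank_eq := by
    rw [← h.cycleRank_eq, cycleRank, cycleRank, Nat.card_congr e.mapEdgeSet.symm,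
      Nat.card_congr e.toEquiv.symm]
  lines := by
    obtain ⟨p, hinj, hpiv, hdeg, hl, hE⟩ := h.lines
    refine ⟨e ∘ p, e.injective.comp hinj, fun v => ?_, fun i => ?_, fun i j hij => ?_, ?_⟩
    · obtain ⟨v, rfl⟩ := e.surjective v
      rw [isPivotal_iso, hpiv, Set.range_comp, e.injective.mem_set_image]
    · exact (deg_iso e _).trans (hdeg i)
    · obtain ⟨L, hL⟩ := hl i j hij
      exact ⟨L.map e.toHom, hL.map e⟩
    · intro x hx
      obtain ⟨⟨y, hy⟩, hxy⟩ := e.mapEdgeSet.surjective ⟨x, hx⟩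
      obtain ⟨i, j, hij, L, hL, hyL⟩ := hE y hy
      refine ⟨i, j, hij, L.map e.toHom, hL.map e, ?_⟩
      rw [SimpleGraph.Walk.edges_map]
      exact List.mem_map.mpr ⟨y, hyL, congrArg Subtype.val hxy⟩

/-! ### Blocks with pendant vertices -/

lemma exists_adj_of_reachable {u v : V} (h : G.Reachable u v) (hne : u ≠ v) : ∃ x, G.Adj u x := by
  obtain ⟨w⟩ := h
  exact ⟨w.snd, w.adj_snd (SimpleGraph.Walk.not_nil_of_ne hne)⟩

lemma isCutpoint_of_pendant [Finite V] {b u v : V} (hv : G.Adj b v) (hu : G.Adj b u) (huv : v ≠ u)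
    (hpend : ∀ x, G.Adj v x → x = b) : IsCutpoint G b := by
  intro c hc
  obtain rfl : c = b := hc
  refine (numComponents_diff_lt_iff (Set.mem_singleton c)).mpr ⟨v, u, hv.ne', hu.ne', hv, hu, fun hr => ?_⟩
  obtain ⟨x, hx⟩ := exists_adj_of_reachable hr fun h => huv (congrArg Subtype.val h)
  exact x.2 (hpend _ hx)

/-- In a larger connected set an extra vertex hangs on a single vertex b of `B`, and b also has a
neighbour in `B`; so b is a cutpoint of the larger set. -/
lemma isBlock_of_pendant [Finite V] {B : Set V} (hB : (G.induce B).Connected)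
    (hcut : ∀ v : B, ¬ IsCutpoint (G.induce B) v) (hnt : B.Nontrivial)
    (hpend : ∀ v, v ∉ B → ∃ b ∈ B, ∀ u, G.Adj v u → u = b) : IsBlock G B := by
  refine ⟨⟨hB, hcut⟩, ?_⟩
  rintro s ⟨hs, hscut⟩ hBs
  by_contra hsB
  obtain ⟨v, hv, hvB⟩ := Set.not_subset.mp hsB
  obtain ⟨b, hb, hvb⟩ := hpend v hvB
  have hne : v ≠ b := fun h => hvB (h ▸ hb)
  obtain ⟨b', hb', hbb'⟩ := hnt.exists_ne b
  have hadj : G.Adj v b := by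
    obtain ⟨x, hx⟩ := exists_adj_of_reachable (hs.preconnected ⟨v, hv⟩ ⟨b, hBs hb⟩)
      fun h => hne (congrArg Subtype.val h)
    have hx' : G.Adj v x := hx
    rwa [hvb _ hx'] at hx'
  obtain ⟨u, hu, hbu⟩ : ∃ u ∈ B, G.Adj b u := by
    obtain ⟨x, hx⟩ := exists_adj_of_reachable (hB.preconnected ⟨b, hb⟩ ⟨b', hb'⟩)
      fun h => hbb' (congrArg Subtype.val h).symm
    exact ⟨x, x.2, hx⟩
  have huv : u ≠ v := fun h => hvB (h ▸ hu)
  exact hscut ⟨b, hBs hb⟩ (isCutpoint_of_pendant (v := ⟨v, hv⟩) (u := ⟨u, hBs hu⟩) hadj.symm hbu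
    (fun h => huv (congrArg Subtype.val h).symm) fun x hx => Subtype.ext (hvb _ hx))

lemma connected_addWhiskers {W : Set V} (hG : G.Connected) : (addWhiskers G W).Connected := by
  obtain ⟨v⟩ := hG.nonempty
  let f : G →g addWhiskers G W := ⟨Sum.inl, id⟩
  have key : ∀ x, (addWhiskers G W).Reachable (Sum.inl v) x := by
    have h1 : ∀ u, (addWhiskers G W).Reachable (Sum.inl v) (Sum.inl u) := fun u =>
      (hG.preconnected v u).map f
    rintro (u | u)
    · exact h1 u
    · refine (h1 u).trans (SimpleGraph.Adj.reachable ?_)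
      rfl
  have : Nonempty (V ⊕ W) := ⟨Sum.inl v⟩
  exact ⟨fun x y => (key x).symm.trans (key y)⟩

/-- Removing v from the block leaves exactly one component, so the count goes up precisely when a
whisker at v is set free. -/
lemma isCutpoint_addWhiskers [Finite V] [Nontrivial V] {W : Set V} (hG : G.Connected)
    (hcut : ∀ v, ¬ IsCutpoint G v) (v : V) :
    IsCutpoint (addWhiskers G W) (Sum.inl v) ↔ v ∈ W := by
  have h1 : IsCutpoint (addWhiskers G W) (Sum.inl v) ↔ IsWhiskerCutset G W {v} := by
    rw [IsCutpoint, ← Set.image_singleton, isCutset_addWhiskers]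
  have h2 : ¬ numComponents G ∅ < numComponents G {v} := by
    intro h
    refine hcut v ?_
    rintro _ rfl
    rwa [sdiff_self]
  obtain ⟨u, hu⟩ := exists_ne v
  -- A second vertex is needed here: a one-vertex block would leave no component, and its whisker
  -- would not create a cutpoint.
  have h3 : 0 < numComponents G {v} := by
    have : Nonempty (({v}ᶜ : Set V)) := ⟨⟨u, hu⟩⟩
    exact Nat.card_pos
  rw [numComponents_empty_of_connected hG] at h2
  rw [h1, IsWhiskerCutset]
  simp only [Set.mem_singleton_iff, forall_eq, sdiff_self, Set.bot_eq_empty, Set.empty_inter,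
    Set.ncard_empty, numComponents_empty_of_connected hG]
  by_cases hv : v ∈ W
  · rw [Set.inter_eq_left.mpr (Set.singleton_subset_iff.mpr hv), Set.ncard_singleton]
    exact ⟨fun _ => hv, fun _ => by omega⟩
  · rw [Set.singleton_inter_eq_empty.mpr hv, Set.ncard_empty]
    exact ⟨fun h => absurd h h2, fun h => absurd h hv⟩

/-- Accessible subdivisions of `K₄` with whiskers are blocks with whiskers. -/
lemma exists_blockWithWhiskers {K : Type*} [Field K] [Finite V] [Finite V'] {W : Set V}
    (hG : IsSubdividedK4Block G) (hacc : IsAccessible K (addWhiskers G W))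
    {H : SimpleGraph V'} (e : H ≃g addWhiskers G W) :
    IsAccessible K H ∧ ∃ (n : ℕ) (G : SimpleGraph (Fin n)) (B : Set (Fin n)), G.Connected ∧
      IsUnmixed (binomialEdgeIdeal K G) ∧ IsBlock G B ∧ IsSubdividedK4Block (G.induce B) ∧
      Nonempty (H ≃g blockWithWhiskers G B) := by
  refine ⟨isAccessible_iso e.symm hacc, ?_⟩
  obtain ⟨n, ⟨ε⟩⟩ := Finite.exists_equiv_fin (V ⊕ W)
  -- The ambient graph is a copy of the whiskered graph itself, and the block is the image of the
  -- original vertices, whose cutpoints are exactly `W`.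
  let D : SimpleGraph (Fin n) := (addWhiskers G W).map ε.toEmbedding
  let φ : addWhiskers G W ≃g D := SimpleGraph.Iso.map ε _
  have hinj : Function.Injective fun v : V => φ (Sum.inl v) := φ.injective.comp Sum.inl_injective
  let ψ : G ≃g D.induce (Set.range fun v : V => φ (Sum.inl v)) :=
    ⟨Equiv.ofInjective _ hinj, fun {a b} => φ.map_adj_iff (v := Sum.inl a) (w := Sum.inl b)⟩
  have hblock := hG.of_iso ψ
  have hnt : Nontrivial V := by
    obtain ⟨p, hp, -⟩ := hG.lines
    exact hp.nontrivial
  refine ⟨n, D, Set.range fun v : V => φ (Sum.inl v),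
    φ.connected_iff.mp (connected_addWhiskers hG.connected), (isAccessible_iso φ hacc).1, ?_,
    hblock, ⟨e.trans (addWhiskersIso ψ fun v => ?_)⟩⟩
  · refine isBlock_of_pendant hblock.connected hblock.noCutpoint ?_ fun v hv => ?_
    · obtain ⟨a, b, hab⟩ := hnt
      exact ⟨_, ⟨a, rfl⟩, _, ⟨b, rfl⟩, hinj.ne hab⟩
    · obtain ⟨v | w, rfl⟩ := φ.surjective v
      · exact absurd ⟨v, rfl⟩ hv
      · refine ⟨_, ⟨w, rfl⟩, fun u hu => ?_⟩
        obtain ⟨u | u, rfl⟩ := φ.surjective u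
        · exact congrArg _ (congrArg _ (φ.map_adj_iff.mp hu))
        · exact absurd (φ.map_adj_iff.mp hu) id
  · rw [← isCutpoint_addWhiskers hG.connected hG.noCutpoint (W := W), ← isCutpoint_iso φ]
    rfl

end Realization
end WhiskeredBlocks

namespace WhiskeredBlocks

/-! ### The members of the family are accessible and come from blocks of class (D). -/

section Members

/-! ### Members of the family -/

/-- The edges of `K₄`. -/
def edgesK4 : List (ℕ × ℕ) := [(0, 1), (0, 2), (0, 3), (1, 2), (1, 3), (2, 3)]

/-- The edges of `K4Sub1`. -/
def edgesK4Sub1 : List (ℕ × ℕ) := [(0, 4), (4, 1), (0, 2), (0, 3), (1, 2), (1, 3), (2, 3)]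

/-- The edges of `K4Sub2`. -/
def edgesK4Sub2 : List (ℕ × ℕ) := [(0, 4), (4, 1), (0, 2), (0, 3), (1, 2), (1, 3), (2, 5), (5, 3)]

/-- The edges of `B` are given by the list `E`. -/
def HasEdgeList {n : ℕ} (B : SimpleGraph (Fin n)) (E : List (ℕ × ℕ)) : Prop :=
  (∀ e ∈ E, e.1 < n ∧ e.2 < n ∧ e.1 ≠ e.2) ∧
    ∀ i j, B.Adj i j ↔ (i.val, j.val) ∈ E ∨ (j.val, i.val) ∈ E

lemma hasEdgeList_top : HasEdgeList (⊤ : SimpleGraph (Fin 4)) edgesK4 := by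
  refine ⟨by decide, ?_⟩
  simp only [SimpleGraph.top_adj]
  decide +kernel

lemma hasEdgeList_k4Sub1 : HasEdgeList K4Sub1 edgesK4Sub1 := by
  refine ⟨by decide, ?_⟩
  simp only [K4Sub1, SimpleGraph.fromEdgeSet_adj, Set.mem_insert_iff, Set.mem_singleton_iff]
  decide +kernel

lemma hasEdgeList_k4Sub2 : HasEdgeList K4Sub2 edgesK4Sub2 := by
  refine ⟨by decide, ?_⟩
  simp only [K4Sub2, SimpleGraph.fromEdgeSet_adj, Set.mem_insert_iff, Set.mem_singleton_iff]
  decide +kernel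

namespace HasEdgeList

variable {n : ℕ} {B : SimpleGraph (Fin n)} {E : List (ℕ × ℕ)}

lemma isCoding (h : HasEdgeList B E) : IsCoding B Fin.val n E (List.range n) (List.range n) where
  edge_lt e he := ⟨(h.1 e he).1, (h.1 e he).2.1⟩
  lt a ha := List.mem_range.mp ha
  mem v := List.mem_range.mpr v.2
  surj a ha := ⟨⟨a, List.mem_range.mp ha⟩, rfl⟩
  adj u v huv := Or.inr ((h.2 u v).mp huv)
  lift e he := ⟨⟨e.1, (h.1 e he).1⟩, ⟨e.2, (h.1 e he).2.1⟩, rfl, rfl, (h.2 _ _).mpr (Or.inl he)⟩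
  fib u v huv := by
    obtain rfl := Fin.ext huv
    exact ⟨SimpleGraph.Walk.nil, by simp⟩
  sub a ha := ha
  inj u v _ huv := Fin.ext huv

lemma connected (h : HasEdgeList B E) (hn : compCount n E (List.range n) = 1) : B.Connected := by
  have h1 := h.isCoding.numComponents_eq []
  have h2 : removeB (List.range n) [] = List.range n := by simp [removeB, memB]
  rw [h2, hn, show {v : Fin n | v.val ∈ ([] : List ℕ)} = ∅ by simp, numComponents,
    Nat.card_eq_one_iff_unique] at h1
  obtain ⟨hs, ⟨c⟩⟩ := h1
  have hne : Nonempty (Fin n) := ⟨c.out.1⟩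
  refine ⟨fun u v => ?_⟩
  have := SimpleGraph.ConnectedComponent.exact (Subsingleton.elim
    ((B.induce (∅ : Set (Fin n))ᶜ).connectedComponentMk ⟨u, Set.notMem_empty u⟩)
    ((B.induce (∅ : Set (Fin n))ᶜ).connectedComponentMk ⟨v, Set.notMem_empty v⟩))
  exact this.map (SimpleGraph.Embedding.induce _).toHom

/-- A cutpoint is a cutset with one element, so the whisker test is run with no whiskers at all. -/
lemma not_isCutpoint (h : HasEdgeList B E)
    (hn : ∀ v < n, cutB n E (List.range n) [] [v] = false) (v : Fin n) : ¬ IsCutpoint B v := by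
  have h1 := h.isCoding.cutB_iff (T := [v.val]) (List.nodup_singleton _) (by simp) (W := ∅)
    (w := []) (by simp)
  rw [hn v v.2] at h1
  have h2 : {u : Fin n | u.val ∈ [v.val]} = {v} := by ext u; simp [Fin.ext_iff]
  rw [h2] at h1
  intro hv
  refine Bool.false_ne_true (h1.mpr fun u hu => ?_)
  simpa using hv u hu

lemma deg_eq (h : HasEdgeList B E) (v : Fin n) : deg B v =
    ((Finset.univ : Finset (Fin n)).filter fun u : Fin n =>
      (v.val, u.val) ∈ E ∨ (u.val, v.val) ∈ E).card := by
  rw [deg, ← Set.ncard_coe_finset]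
  congr 1
  ext u
  simp [h.2]

/-- Cutsets lie in the block and are coded by sublists of `List.range n`, so both halves of
accessibility become a finite test. -/
lemma isAccessible {K : Type*} [Field K] (h : HasEdgeList B E) (hB : B.Connected)
    {W : Set (Fin n)} {w : List ℕ} (hW : ∀ v, v ∈ W ↔ v.val ∈ w)
    (hcheck : ∀ T ∈ (List.range n).sublists, cutB n E (List.range n) w T = true →
      tightB n E (List.range n) w T = true ∧
        (T = [] ∨ ∃ t ∈ T, cutB n E (List.range n) w (removeB T [t]) = true)) :
    IsAccessible K (addWhiskers B W) := by
  have hc := h.isCoding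
  have hw : ∀ v : Fin n, v.val ∈ List.range n → (v ∈ W ↔ v.val ∈ w) := fun v _ => hW v
  have key : ∀ S : Set (Fin n), IsWhiskerCutset B W S →
      numComponents B S + (S ∩ W).ncard = S.ncard + 1 ∧
        (S.Nonempty → ∃ t ∈ S, IsWhiskerCutset B W (S \ {t})) := by
    intro S hS
    obtain ⟨T, hT, hST⟩ := hc.exists_list S
    have hTs := List.mem_sublists.mp hT
    have hnd : T.Nodup := List.nodup_range.sublist hTs
    have hTF : ∀ a ∈ T, a ∈ List.range n := fun a ha => hTs.subset ha
    obtain rfl : S = {v : Fin n | v.val ∈ T} := Set.ext fun v => hST v (hc.mem v)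
    obtain ⟨h1, h2⟩ := hcheck T hT ((hc.cutB_iff hnd hTF hw).mpr hS)
    refine ⟨(hc.tightB_iff hnd hTF hw).mp h1, ?_⟩
    rintro ⟨x, hx⟩
    rcases h2 with rfl | ⟨t, ht, h2⟩
    · simp at hx
    · refine ⟨⟨t, List.mem_range.mp (hTF t ht)⟩, ht, ?_⟩
      have h3 := (hc.cutB_iff (T := removeB T [t]) (hnd.filter _)
        (fun a ha => hTF a (mem_removeB.mp ha).1) hw).mp h2
      convert h3 using 1
      ext u
      simp only [Set.mem_sdiff, Set.mem_ofPred_eq, Set.mem_singleton_iff, mem_removeB,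
        List.mem_singleton, Fin.ext_iff]
  have h0 := numComponents_addWhiskers B W ∅
  rw [Set.image_empty, Set.empty_inter, Set.ncard_empty, numComponents_empty_of_connected hB]
    at h0
  refine ⟨(isUnmixed_binomialEdgeIdeal_iff _).mpr fun T hT => ?_, fun T hT hne => ?_⟩
  · obtain ⟨S, rfl⟩ := exists_eq_image_of_isCutset_addWhiskers hT
    rw [numComponents_addWhiskers, Set.ncard_image_of_injective _ Sum.inl_injective, h0]
    exact (key S ((isCutset_addWhiskers B W S).mp hT)).1
  · obtain ⟨S, rfl⟩ := exists_eq_image_of_isCutset_addWhiskers hT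
    obtain ⟨t, ht, hcut⟩ := (key S ((isCutset_addWhiskers B W S).mp hT)).2
      (Set.image_nonempty.mp hne)
    refine ⟨Sum.inl t, ⟨t, ht, rfl⟩, ?_⟩
    rwa [← Set.image_singleton, ← Set.image_sdiff Sum.inl_injective, isCutset_addWhiskers]

lemma card_edgeSet (h : HasEdgeList B E) :
    Nat.card B.edgeSet = ((Finset.univ : Finset (Fin n × Fin n)).filter fun x =>
      x.1 < x.2 ∧ ((x.1.val, x.2.val) ∈ E ∨ (x.2.val, x.1.val) ∈ E)).card := by
  rw [Nat.card_coe_set_eq, ← Set.ncard_coe_finset]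
  symm
  -- Each edge is counted once through its increasing ordered pair, which makes the number of edges
  -- decidable.
  refine Set.ncard_congr (fun x _ => s(x.1, x.2)) ?_ ?_ ?_
  · rintro ⟨a, b⟩ hx
    have hx := (Finset.mem_filter.mp hx).2.2
    exact (h.2 a b).mpr hx
  · rintro ⟨a, b⟩ ⟨c, d⟩ hx hy hxy
    have hx := (Finset.mem_filter.mp hx).2.1
    have hy := (Finset.mem_filter.mp hy).2.1
    rcases Sym2.eq_iff.mp hxy with ⟨h1, h2⟩ | ⟨h1, h2⟩
    · exact Prod.ext h1 h2
    · simp only at hx hy h1 h2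
      subst h1 h2
      exact absurd hx (lt_asymm hy)
  · intro x hx
    induction x with
    | _ a b =>
      have hab : B.Adj a b := hx
      rcases lt_or_gt_of_ne hab.ne with hlt | hlt
      · exact ⟨(a, b), by simpa [hlt] using (h.2 a b).mp hab, rfl⟩
      · exact ⟨(b, a), by simpa [hlt] using (h.2 b a).mp hab.symm, Sym2.eq_swap⟩

end HasEdgeList

lemma isLine_of_adj {β : Type*} {B : SimpleGraph β} {a b : β} (h : B.Adj a b)
    (ha : IsPivotal B a) (hb : IsPivotal B b) : IsLine B h.toWalk := by
  refine ⟨SimpleGraph.Walk.IsPath.of_adj h, ha, hb, fun v hv h1 h2 => ?_⟩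
  simp at hv
  tauto

lemma isLine_of_adj_adj {β : Type*} {B : SimpleGraph β} {a b c : β} (hac : B.Adj a c)
    (hcb : B.Adj c b) (hab : a ≠ b) (ha : IsPivotal B a) (hb : IsPivotal B b)
    (hc : ¬ IsPivotal B c) : IsLine B (SimpleGraph.Walk.cons hac hcb.toWalk) := by
  refine ⟨?_, ha, hb, fun v hv h1 h2 => ?_⟩
  · rw [SimpleGraph.Walk.cons_isPath_iff]
    refine ⟨SimpleGraph.Walk.IsPath.of_adj hcb, ?_⟩
    simp [hab, hac.ne]
  · simp at hv
    obtain rfl : v = c := by tauto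
    exact hc

/-- Graphs with four vertices of degree 3 joined by lines of at most two edges are subdivisions
of `K₄`. -/
lemma isSubdividedK4Block_of_short {β : Type*} {B : SimpleGraph β} (hB : B.Connected)
    (hcut : ∀ v, ¬ IsCutpoint B v) (hrank : cycleRank B = 3) {p : Fin 4 → β}
    (hinj : Function.Injective p) (hdeg : ∀ i, deg B (p i) = 3)
    (hpiv : ∀ v, IsPivotal B v → v ∈ Set.range p)
    (hline : ∀ i j, i ≠ j → B.Adj (p i) (p j) ∨
      ∃ c, c ∉ Set.range p ∧ B.Adj (p i) c ∧ B.Adj c (p j))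
    (hedge : ∀ c v, c ∉ Set.range p → B.Adj c v →
      v ∈ Set.range p ∧ ∃ j, B.Adj c (p j) ∧ v ≠ p j) : IsSubdividedK4Block B where
  connected := hB
  noCutpoint := hcut
  cycleRank_eq := hrank
  lines := by
    have hp : ∀ i, IsPivotal B (p i) := fun i => (hdeg i).ge
    refine ⟨p, hinj, fun v => ⟨hpiv v, ?_⟩, hdeg, fun i j hij => ?_, ?_⟩
    · rintro ⟨i, rfl⟩
      exact hp i
    · rcases hline i j hij with h | ⟨c, hc, h1, h2⟩
      · exact ⟨_, isLine_of_adj h (hp i) (hp j)⟩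
      · exact ⟨_, isLine_of_adj_adj h1 h2 (hinj.ne hij) (hp i) (hp j) fun h => hc (hpiv c h)⟩
    · intro x hx
      induction x with
      | _ u v =>
        have hadj : B.Adj u v := hx
        have key : ∀ c y, c ∉ Set.range p → B.Adj c y → ∃ i j, i ≠ j ∧
            ∃ L : B.Walk (p i) (p j), IsLine B L ∧ s(y, c) ∈ L.edges := by
          intro c y hc hcy
          obtain ⟨⟨i, rfl⟩, j, hj, hij⟩ := hedge c y hc hcy
          exact ⟨i, j, fun h => hij (congrArg p h), _, isLine_of_adj_adj hcy.symm hj hij (hp i)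
            (hp j) fun h => hc (hpiv c h), by simp⟩
        by_cases hu : u ∈ Set.range p
        · by_cases hv : v ∈ Set.range p
          · obtain ⟨i, rfl⟩ := hu
            obtain ⟨j, rfl⟩ := hv
            exact ⟨i, j, fun h => hadj.ne (congrArg p h), _, isLine_of_adj hadj (hp i) (hp j),
              by simp⟩
          · exact key v u hv hadj.symm
        · rw [Sym2.eq_swap]
          exact key u v hu hadj

lemma isSubdividedK4Block_top : IsSubdividedK4Block (⊤ : SimpleGraph (Fin 4)) := by
  have h := hasEdgeList_top
  refine isSubdividedK4Block_of_short (p := id) (h.connected (by decide +kernel))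
    (h.not_isCutpoint (by decide +kernel)) ?_ Function.injective_id ?_ (by simp) ?_ (by simp)
  · rw [cycleRank, h.card_edgeSet, Nat.card_fin]
    decide +kernel
  · simp only [h.deg_eq]
    decide +kernel
  · exact fun i j hij => Or.inl hij

lemma isSubdividedK4Block_k4Sub1 : IsSubdividedK4Block K4Sub1 := by
  have h := hasEdgeList_k4Sub1
  refine isSubdividedK4Block_of_short (p := ![0, 1, 2, 3]) (h.connected (by decide +kernel))
    (h.not_isCutpoint (by decide +kernel)) ?_ (by decide) ?_ ?_ ?_ ?_
  · rw [cycleRank, h.card_edgeSet, Nat.card_fin]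
    decide +kernel
  · simp only [h.deg_eq]
    decide +kernel
  · simp only [IsPivotal, h.deg_eq, Set.mem_range]
    decide +kernel
  · simp only [h.2, Set.mem_range]
    decide +kernel
  · simp only [h.2, Set.mem_range]
    decide +kernel

lemma isSubdividedK4Block_k4Sub2 : IsSubdividedK4Block K4Sub2 := by
  have h := hasEdgeList_k4Sub2
  refine isSubdividedK4Block_of_short (p := ![0, 1, 2, 3]) (h.connected (by decide +kernel))
    (h.not_isCutpoint (by decide +kernel)) ?_ (by decide) ?_ ?_ ?_ ?_
  · rw [cycleRank, h.card_edgeSet, Nat.card_fin]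
    decide +kernel
  · simp only [h.deg_eq]
    decide +kernel
  · simp only [IsPivotal, h.deg_eq, Set.mem_range]
    decide +kernel
  · simp only [h.2, Set.mem_range]
    decide +kernel
  · simp only [h.2, Set.mem_range]
    decide +kernel

section

variable (K : Type*) [Field K]

lemma isAccessible_top (W : Set (Fin 4)) :
    IsAccessible K (addWhiskers (⊤ : SimpleGraph (Fin 4)) W) := by
  have h := hasEdgeList_top
  obtain ⟨w, hw, hW⟩ := h.isCoding.exists_list W
  refine h.isAccessible isSubdividedK4Block_top.connected (w := w)
    (fun v => hW v (h.isCoding.mem v)) ?_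
  revert w
  have : ∀ w ∈ (List.range 4).sublists, ∀ T ∈ (List.range 4).sublists,
      cutB 4 edgesK4 (List.range 4) w T = true → tightB 4 edgesK4 (List.range 4) w T = true ∧
        (T = [] ∨ ∃ t ∈ T, cutB 4 edgesK4 (List.range 4) w (removeB T [t]) = true) := by
    decide +kernel
  exact fun w hw _ => this w hw

lemma isAccessible_k4Sub2 : IsAccessible K (addWhiskers K4Sub2 {0, 2}) :=
  hasEdgeList_k4Sub2.isAccessible isSubdividedK4Block_k4Sub2.connected (w := [0, 2])
    (by simp only [Set.mem_insert_iff, Set.mem_singleton_iff]; decide) (by decide +kernel)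

lemma isAccessible_k4Sub1_two_three : IsAccessible K (addWhiskers K4Sub1 {0, 2, 3}) :=
  hasEdgeList_k4Sub1.isAccessible isSubdividedK4Block_k4Sub1.connected (w := [0, 2, 3])
    (by simp only [Set.mem_insert_iff, Set.mem_singleton_iff]; decide) (by decide +kernel)

lemma isAccessible_k4Sub1_two_four : IsAccessible K (addWhiskers K4Sub1 {0, 2, 4}) :=
  hasEdgeList_k4Sub1.isAccessible isSubdividedK4Block_k4Sub1.connected (w := [0, 2, 4])
    (by simp only [Set.mem_insert_iff, Set.mem_singleton_iff]; decide) (by decide +kernel)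

end

end Members
end WhiskeredBlocks

theorem mainTheorem6 {K : Type*} [Field K] {V : Type*} [Finite V] (H : SimpleGraph V) :
    (WhiskeredBlocks.IsAccessible K H ∧
      ∃ (n : ℕ) (G : SimpleGraph (Fin n)) (B : Set (Fin n)),
        G.Connected ∧
        WhiskeredBlocks.IsUnmixed (WhiskeredBlocks.binomialEdgeIdeal K G) ∧
        WhiskeredBlocks.IsBlock G B ∧
        WhiskeredBlocks.IsSubdividedK4Block (G.induce B) ∧
        Nonempty (H ≃g WhiskeredBlocks.blockWithWhiskers G B)) ↔
    WhiskeredBlocks.InFamilyK4 H := by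
  open WhiskeredBlocks in
  constructor
  · rintro ⟨hH, n, G, B, -, -, -, hB, ⟨e⟩⟩
    obtain ⟨p, L, hL⟩ := hB.exists_lines
    exact (hL.inFamilyK4 hB.connected ((isCombinatoriallyUnmixed_iso e).mp
      ((isUnmixed_binomialEdgeIdeal_iff H).mp hH.1))).of_iso e
  · rintro (⟨W, ⟨e⟩⟩ | ⟨⟨e⟩⟩ | ⟨⟨e⟩⟩ | ⟨⟨e⟩⟩)
    · exact exists_blockWithWhiskers isSubdividedK4Block_top (isAccessible_top K W) e
    · exact exists_blockWithWhiskers isSubdividedK4Block_k4Sub2 (isAccessible_k4Sub2 K) e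
    · exact exists_blockWithWhiskers isSubdividedK4Block_k4Sub1
        (isAccessible_k4Sub1_two_three K) e
    · exact exists_blockWithWhiskers isSubdividedK4Block_k4Sub1
        (isAccessible_k4Sub1_two_four K) e
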